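/- **Setting.** Let $q\ge 3$ be an integer, $\ell=2\cos(\pi/q)$, $m=\lfloor (q-1)/2\rfloor$. In $\mathrm{PGL}_2(\mathbb R)$ put $S=\begin{pmatrix}0&1\\-1&0\end{pmatrix}$, $T=\begin{pmatrix}1&\ell\\0&1\end{pmatrix}$, $Q=\begin{pmatrix}0&1\\1&0\end{pmatrix}$, $J=\begin{pmatrix}-1&0\\0&1\end{pmatrix}$, let $\widetilde\Gamma=\langle S,T,Q\rangle$ be the triangle group underlying the Hecke triangle group $\Gamma_q=\langle S,T\rangle$, and let $g_k=((TS)^kS)^{-1}$ for $k\in\mathbb Z$. Let $\chi$ be a unitary representation of $\widetilde\Gamma$ on a finite-dimensional complex inner product space $V$. For $s\in\mathbb C$, $g\in\widetilde\Gamma$ with $g^{-1}=\begin{pmatrix}a&b\\c&d\end{pmatrix}$ and a $V$-valued function $f$ put $$\alpha_s(g)f(z)=\bigl(|ad-bc|\,(cz+d)^{-2}\bigr)^s\,\chi(g)\,f(g^{-1}.z),\qquad g^{-1}.z=\tfrac{az+b}{cz+d},$$ with the principal branch of the power. Fix a sign $\pm$ ($+$: even, $-$: odd). **Slow side.** Let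 $I=(0,1)$ if $q$ is odd and $I=(0,\infty)$ if $q$ is even, and $$\mathcal L^{\mathrm{slow},\pm}_s=(1\pm\alpha_s(Q))\Bigl(\sum_{k=1}^m\alpha_s(g_{-k})+\delta\Bigr),\qquad \delta=\begin{cases}0&q\text{ odd}\\ \tfrac12\alpha_s(g_{q/2})&q\text{ even.}\end{cases}$$ Let $\mathrm{SFE}_s^{\omega,\pm}$ be the space of real-analytic $\varphi\colon I\to V$ with $\varphi=\mathcal L_s^{\mathrm{slow},\pm}\varphi$; let $\mathrm{SFE}_s^{\omega,\mathrm{as},\pm}$ be its subspace of those $\varphi$ with $\varphi(x)=\frac cx+O(1)$ as $x\to0^+$ for some $c\in V$; and let $\mathrm{SFE}_s^{\omega,\mathrm{dec},\pm}$ be its subspace of those $\varphi$ for which the function equal to $\varphi$ on $(0,1/\ell)$ and to $\mp\alpha_s(J)\varphi$ on $(-1/\ell,0)$ extends to a $C^\infty$ function on $(-1/\ell,1/\ell)$. **Fast side.** Let $D_{-1}=(0,1/\ell)$, and $D_0=(1/\ell,1)$ for odd $q$ (empty for $q=3$, in which case there is no component $f_0$), $D_0=(1/\ell,1]$ for even $q$.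 Let $$\mathcal L_{0,s}=\sum_{k=2}^m\alpha_s(g_{-k})+\delta,\qquad \mathcal L_{-1,s}=\sum_{n=1}^\infty\alpha_s(g_{-1}^n)\quad(\operatorname{Re}s>\tfrac12),$$ where $\mathcal L_{-1,s}$ is defined for other $s$ by meromorphic continuation in $s$ (holomorphic on $\operatorname{Re}s>0$, $s\ne\frac12$), and $$\mathcal L_s^{\mathrm{fast},\pm}=\begin{pmatrix}(1\pm\alpha_s(Q))\mathcal L_{0,s}&(1\pm\alpha_s(Q))\mathcal L_{-1,s}\\(1\pm\alpha_s(Q))\mathcal L_{0,s}&\pm\alpha_s(Q)\mathcal L_{-1,s}\end{pmatrix},$$ acting on function vectors $(f_0,f_{-1})^\top$. It acts on $\mathcal B=\varinjlim\,(B(\mathcal E_0)\oplus B(\mathcal E_{-1}))$, where $B(\mathcal E)$ is the space of continuous functions $\overline{\mathcal E}\to V$ that are holomorphic on $\mathcal E$, and $(\mathcal E_0,\mathcal E_{-1})$ runs over all pairs of bounded connected open complex neighbourhoods of $\overline{D_0}$, $\overline{D_{-1}}$ with $\overline{\mathcal E_0}\subset\{\operatorname{Re}z>0\}$, $\overline{\mathcal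 E_{-1}}\subset\{\operatorname{Re}z>-1/\ell\}$ and $g^{-1}.\overline{\mathcal E_a}\subseteq\mathcal E_b$ whenever $\alpha_s(g)$ occurs in the $(a,b)$ entry of $\mathcal L_s^{\mathrm{fast},\pm}$. Let $\mathrm{FFE}_s^{\pm}=\{f\in\mathcal B: f=\mathcal L_s^{\mathrm{fast},\pm}f\}$, and let $\mathrm{FFE}_s^{\mathrm{dec},\pm}$ be the set of $f\in\mathrm{FFE}_s^{\pm}$ for which the function equal to $(1+\mathcal L_{-1,s})f_{-1}$ for $x>0$ and to $\mp\alpha_s(J)(1+\mathcal L_{-1,s})f_{-1}$ for $x<0$, on a punctured neighbourhood of $0$ in $\mathbb R$, extends smoothly to $0$. **Theorem.** Let $s\in\mathbb C\setminus\{\frac12\}$ with $\operatorname{Re}s>0$. Then $\mathrm{FFE}_s^\pm$ and $\mathrm{SFE}_s^{\omega,\mathrm{as},\pm}$ are isomorphic as vector spaces. An isomorphism $\mathrm{FFE}_s^\pm\to\mathrm{SFE}_s^{\omega,\mathrm{as},\pm}$, $f=(f_0,f_{-1})^\top\mapsto\varphi$, is determined by $$\varphi|_{D_0}=f_0|_{D_0},\qquad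 \varphi|_{D_{-1}}=(1+\mathcal L_{-1,s})f_{-1}|_{D_{-1}},$$ and its inverse $\varphi\mapsto f=(f_0,f_{-1})^\top$ is determined by $$f_0|_{D_0}=\varphi|_{D_0},\qquad f_{-1}|_{D_{-1}}=(1-\alpha_s(g_{-1}))\varphi|_{D_{-1}}.$$ These isomorphisms induce isomorphisms between $\mathrm{FFE}_s^{\mathrm{dec},\pm}$ and $\mathrm{SFE}_s^{\omega,\mathrm{dec},\pm}$. -/

import Mathlib

open scoped ContDiff Topology

namespace HeckeTransfer

noncomputable section

/-! ### The triangle group and its action -/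

/-- The group `PGL₂(ℝ) = GL₂(ℝ) / (ℝˣ · id)`. -/
abbrev PGL2 : Type := GL (Fin 2) ℝ ⧸ Subgroup.center (GL (Fin 2) ℝ)

/-- An element of the centre of `GL₂(ℝ)` is a nonzero scalar matrix. -/
theorem exists_scalar {g : GL (Fin 2) ℝ} (hg : g ∈ Subgroup.center (GL (Fin 2) ℝ)) :
    ∃ r : ℝ, r ≠ 0 ∧ (g 0 0 = r ∧ g 0 1 = 0 ∧ g 1 0 = 0 ∧ g 1 1 = r) := by
  obtain ⟨r, hr⟩ := Matrix.GeneralLinearGroup.mem_center_iff_val_mem_range_scalar.mp hg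
  have hdet : (g : Matrix (Fin 2) (Fin 2) ℝ).det ≠ 0 := by
    have := (Matrix.isUnit_iff_isUnit_det _).mp g.isUnit
    exact this.ne_zero
  refine ⟨r, ?_, ?_⟩
  · rintro rfl
    apply hdet
    rw [← hr]
    simp
  · rw [← hr]
    simp

/-- If `A` and `B` represent the same element of `PGL₂(ℝ)`, then `B = r A` with `r ≠ 0`. -/
theorem exists_smul_of_leftRel {A B : GL (Fin 2) ℝ}
    (h : QuotientGroup.leftRel (Subgroup.center (GL (Fin 2) ℝ)) A B) :
    ∃ r : ℝ, r ≠ 0 ∧ ∀ i j, B i j = r * A i j := by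
  rw [QuotientGroup.leftRel_apply] at h
  obtain ⟨r, hr, h00, h01, h10, h11⟩ := exists_scalar h
  refine ⟨r, hr, fun i j => ?_⟩
  have hB : B = A * (A⁻¹ * B) := by group
  rw [hB]
  set C := A⁻¹ * B
  have : ∀ i j, (A * C) i j = A i 0 * C 0 j + A i 1 * C 1 j := by
    intro i j
    simp [Matrix.mul_apply, Fin.sum_univ_two]
  rw [this]
  fin_cases j <;> simp [h00, h01, h10, h11, mul_comm]

/-- The action `g.z = (az+b)/(cz+d)` of `PGL₂(ℝ)` by fractional linear transformations, on the real
line (`𝕜 = ℝ`) or on the complex plane (`𝕜 = ℂ`); only used where `cz+d ≠ 0`. -/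
def act (𝕜 : Type) [Field 𝕜] [Algebra ℝ 𝕜] (g : PGL2) (z : 𝕜) : 𝕜 :=
  Quotient.liftOn' g
    (fun A => (algebraMap ℝ 𝕜 (A 0 0) * z + algebraMap ℝ 𝕜 (A 0 1)) /
      (algebraMap ℝ 𝕜 (A 1 0) * z + algebraMap ℝ 𝕜 (A 1 1)))
    (by
      intro A B h
      obtain ⟨r, hr, hB⟩ := exists_smul_of_leftRel h
      have hr' : algebraMap ℝ 𝕜 r ≠ 0 := by simpa using hr
      simp only [hB, map_mul, mul_assoc, ← mul_add]
      rw [mul_div_mul_left _ _ hr'])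

/-- The factor `|ad - bc| (cz+d)⁻²`, that is, `|g'(z)|` for real `z`. -/
def jac (𝕜 : Type) [Field 𝕜] [Algebra ℝ 𝕜] (g : PGL2) (z : 𝕜) : 𝕜 :=
  Quotient.liftOn' g
    (fun A => algebraMap ℝ 𝕜 |A 0 0 * A 1 1 - A 0 1 * A 1 0| *
      ((algebraMap ℝ 𝕜 (A 1 0) * z + algebraMap ℝ 𝕜 (A 1 1)) ^ 2)⁻¹)
    (by
      intro A B h
      obtain ⟨r, hr, hB⟩ := exists_smul_of_leftRel h
      have hr' : algebraMap ℝ 𝕜 r ≠ 0 := by simpa using hr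
      have h1 : |B 0 0 * B 1 1 - B 0 1 * B 1 0| = r ^ 2 * |A 0 0 * A 1 1 - A 0 1 * A 1 0| := by
        have h3 : B 0 0 * B 1 1 - B 0 1 * B 1 0 =
            r ^ 2 * (A 0 0 * A 1 1 - A 0 1 * A 1 0) := by
          rw [hB, hB, hB, hB]
          ring
        rw [h3, abs_mul, abs_of_nonneg (sq_nonneg r)]
      have h2 : algebraMap ℝ 𝕜 (B 1 0) * z + algebraMap ℝ 𝕜 (B 1 1) =
          algebraMap ℝ 𝕜 r * (algebraMap ℝ 𝕜 (A 1 0) * z + algebraMap ℝ 𝕜 (A 1 1)) := by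
        simp only [hB, map_mul]
        ring
      simp only [h1, h2, map_mul, map_pow, mul_pow, mul_inv]
      field_simp)

/-- The cusp width `ℓ(q) = 2 cos(π/q)`. -/
def ell (q : ℕ) : ℝ := 2 * Real.cos (Real.pi / q)

/-- The class of `S = (0 1; -1 0)`. -/
def matS : PGL2 :=
  QuotientGroup.mk (Matrix.GeneralLinearGroup.mkOfDetNeZero !![0, 1; -1, 0] (by simp))

/-- The class of `T_q = (1 ℓ(q); 0 1)`. -/
def matT (q : ℕ) : PGL2 :=
  QuotientGroup.mk (Matrix.GeneralLinearGroup.mkOfDetNeZero !![1, ell q; 0, 1] (by simp))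

/-- The class of `Q = (0 1; 1 0)`. -/
def matQ : PGL2 :=
  QuotientGroup.mk (Matrix.GeneralLinearGroup.mkOfDetNeZero !![0, 1; 1, 0] (by simp))

/-- The Hecke triangle group `Γ_q`, generated by `S` and `T_q`. -/
def heckeGroup (q : ℕ) : Subgroup PGL2 := Subgroup.closure {matS, matT q}

/-- The triangle group underlying `Γ_q`, generated by `Γ_q` and `Q`. -/
def triangleGroup (q : ℕ) : Subgroup PGL2 := heckeGroup q ⊔ Subgroup.closure {matQ}

/-- `S` as an element of the triangle group. -/
def elS (q : ℕ) : triangleGroup q :=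
  ⟨matS, Subgroup.mem_sup_left (Subgroup.subset_closure (by simp))⟩

/-- `T_q` as an element of the triangle group. -/
def elT (q : ℕ) : triangleGroup q :=
  ⟨matT q, Subgroup.mem_sup_left (Subgroup.subset_closure (by simp))⟩

/-- `Q` as an element of the triangle group. -/
def elQ (q : ℕ) : triangleGroup q :=
  ⟨matQ, Subgroup.mem_sup_right (Subgroup.subset_closure (by simp))⟩

/-- `J = SQ`, the class of `(-1 0; 0 1)`, as an element of the triangle group. -/
def elJ (q : ℕ) : triangleGroup q := elS q * elQ q

/-- `SQ` is indeed the class of `(-1 0; 0 1)`. -/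
theorem coe_elJ (q : ℕ) : (elJ q : PGL2) =
    QuotientGroup.mk (Matrix.GeneralLinearGroup.mkOfDetNeZero !![-1, 0; 0, 1] (by simp)) := by
  change QuotientGroup.mk _ = _
  rw [QuotientGroup.eq, Matrix.GeneralLinearGroup.mem_center_iff_val_mem_range_scalar]
  refine ⟨-1, ?_⟩
  rw [eq_comm, Units.val_mul, Matrix.coe_units_inv, Matrix.inv_mul_eq_iff_eq_mul_of_invertible]
  ext i j
  fin_cases i <;> fin_cases j <;>
    simp [Matrix.GeneralLinearGroup.mkOfDetNeZero, Matrix.mul_apply, Fin.sum_univ_two]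

/-- `g_{q,k} = ((T_q S)^k S)⁻¹`. -/
def elG (q : ℕ) (k : ℤ) : triangleGroup q := ((elT q * elS q) ^ k * elS q)⁻¹

/-- `m = ⌊(q-1)/2⌋`. -/
def numM (q : ℕ) : ℕ := (q - 1) / 2

/-! ### The action on functions -/

section Operators

variable {V : Type*} [NormedAddCommGroup V] [InnerProductSpace ℂ V] {q : ℕ}

/-- `α_s(g) φ(x) = |(g⁻¹)'(x)|^s χ(g) φ(g⁻¹.x)` for functions on (subsets of) the real line. -/
def alphaR (χ : triangleGroup q →* (V ≃ₗᵢ[ℂ] V)) (s : ℂ) (g : triangleGroup q)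
    (φ : ℝ → V) (x : ℝ) : V :=
  ((jac ℝ ((g⁻¹ : triangleGroup q) : PGL2) x : ℝ) : ℂ) ^ s •
    χ g (φ (act ℝ ((g⁻¹ : triangleGroup q) : PGL2) x))

/-- `α_s(g) ψ(z) = (|ad-bc| (cz+d)⁻²)^s χ(g) ψ(g⁻¹.z)`, where `g⁻¹ = (a b; c d)` and the power is
the principal one, for functions on (subsets of) the complex plane. -/
def alphaC (χ : triangleGroup q →* (V ≃ₗᵢ[ℂ] V)) (s : ℂ) (g : triangleGroup q)
    (ψ : ℂ → V) (z : ℂ) : V :=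
  (jac ℂ ((g⁻¹ : triangleGroup q) : PGL2) z) ^ s •
    χ g (ψ (act ℂ ((g⁻¹ : triangleGroup q) : PGL2) z))

/-! ### Intervals -/

/-- The interval on which the slow transfer operator acts: `(0,1)` for odd `q`, and `(0,∞)` for
even `q`. -/
def slowInterval (q : ℕ) : Set ℝ := if Even q then Set.Ioi 0 else Set.Ioo 0 1

/-- `D₋₁ = (0, 1/ℓ)`. -/
def dMinus (q : ℕ) : Set ℝ := Set.Ioo 0 (1 / ell q)

/-- `D₀ = (1/ℓ, 1)` for odd `q` (empty for `q = 3`), and `D₀ = (1/ℓ, 1]` for even `q`. -/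
def dZero (q : ℕ) : Set ℝ :=
  if Even q then Set.Ioc (1 / ell q) 1 else Set.Ioo (1 / ell q) 1

/-! ### Slow transfer operators -/

/-- The slow transfer operator, even for `ε = 1` and odd for `ε = -1`:
`∑_{k=1}^m (α_s(g_{-k}) + ε α_s(Q g_{-k}))`, plus, for even `q`,
`½ (α_s(g_{q/2}) + ε α_s(Q g_{q/2}))`. -/
def slowOp (χ : triangleGroup q →* (V ≃ₗᵢ[ℂ] V)) (ε : ℤˣ) (s : ℂ) (φ : ℝ → V) (x : ℝ) : V :=
  (∑ k ∈ Finset.Icc 1 (numM q), (alphaR χ s (elG q (-(k : ℤ))) φ x +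
      ε • alphaR χ s (elQ q * elG q (-(k : ℤ))) φ x)) +
    if Even q then
      (1 / 2 : ℂ) • (alphaR χ s (elG q ((q / 2 : ℕ) : ℤ)) φ x +
        ε • alphaR χ s (elQ q * elG q ((q / 2 : ℕ) : ℤ)) φ x)
    else 0

theorem alphaR_add (χ : triangleGroup q →* (V ≃ₗᵢ[ℂ] V)) (s : ℂ) (g : triangleGroup q)
    (φ ψ : ℝ → V) (x : ℝ) :
    alphaR χ s g (φ + ψ) x = alphaR χ s g φ x + alphaR χ s g ψ x := by
  simp [alphaR]

theorem alphaR_smul (χ : triangleGroup q →* (V ≃ₗᵢ[ℂ] V)) (s : ℂ) (g : triangleGroup q)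
    (c : ℂ) (φ : ℝ → V) (x : ℝ) :
    alphaR χ s g (c • φ) x = c • alphaR χ s g φ x := by
  simp [alphaR, smul_comm c]

theorem slowOp_add (χ : triangleGroup q →* (V ≃ₗᵢ[ℂ] V)) (ε : ℤˣ) (s : ℂ) (φ ψ : ℝ → V) (x : ℝ) :
    slowOp χ ε s (φ + ψ) x = slowOp χ ε s φ x + slowOp χ ε s ψ x := by
  unfold slowOp
  have h : ∀ u v : V, (∑ k ∈ Finset.Icc 1 (numM q), (alphaR χ s (elG q (-(k : ℤ))) (φ + ψ) x +
      ε • alphaR χ s (elQ q * elG q (-(k : ℤ))) (φ + ψ) x)) =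
      (∑ k ∈ Finset.Icc 1 (numM q), (alphaR χ s (elG q (-(k : ℤ))) φ x +
      ε • alphaR χ s (elQ q * elG q (-(k : ℤ))) φ x)) +
      ∑ k ∈ Finset.Icc 1 (numM q), (alphaR χ s (elG q (-(k : ℤ))) ψ x +
      ε • alphaR χ s (elQ q * elG q (-(k : ℤ))) ψ x) := by
    intro _ _
    rw [← Finset.sum_add_distrib]
    refine Finset.sum_congr rfl fun k _ => ?_
    rw [alphaR_add, alphaR_add, smul_add]
    abel
  rw [h 0 0]
  split_ifs
  · rw [alphaR_add, alphaR_add]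
    simp only [smul_add]
    abel
  · simp

theorem slowOp_smul (χ : triangleGroup q →* (V ≃ₗᵢ[ℂ] V)) (ε : ℤˣ) (s c : ℂ) (φ : ℝ → V) (x : ℝ) :
    slowOp χ ε s (c • φ) x = c • slowOp χ ε s φ x := by
  unfold slowOp
  have hε : ∀ v : V, ε • c • v = c • ε • v := fun v => smul_comm ε c v
  have h2 : ∀ v : V, (1 / 2 : ℂ) • c • v = c • (1 / 2 : ℂ) • v := fun v => smul_comm _ c v
  rw [smul_add c, Finset.smul_sum]
  simp only [alphaR_smul, hε, ← smul_add c, h2]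
  congr 1
  split_ifs
  · rfl
  · simp

variable (V q) in
/-- The space `C^ω(I; V)` of real-analytic functions on `I = slowInterval q`. A function on `I` is
represented by its extension by `0` to the real line. -/
def analyticSpace : Submodule ℂ (ℝ → V) where
  carrier := {φ | AnalyticOnNhd ℝ φ (slowInterval q) ∧ ∀ x ∉ slowInterval q, φ x = 0}
  zero_mem' := ⟨fun _ _ => analyticAt_const, fun _ _ => rfl⟩
  add_mem' := fun h₁ h₂ => ⟨h₁.1.add h₂.1, fun x hx => by simp [h₁.2 x hx, h₂.2 x hx]⟩
  smul_mem' := fun c _ h =>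
    ⟨fun x hx => (analyticAt_const (v := c)).smul (h.1 x hx), fun x hx => by simp [h.2 x hx]⟩

/-- The space `SFE^{ω,±}` of real-analytic eigenfunctions with eigenvalue `1` of the slow transfer
operator. -/
def slowEigen (χ : triangleGroup q →* (V ≃ₗᵢ[ℂ] V)) (ε : ℤˣ) (s : ℂ) : Submodule ℂ (ℝ → V) where
  carrier := {φ | φ ∈ analyticSpace V q ∧ ∀ x ∈ slowInterval q, φ x = slowOp χ ε s φ x}
  zero_mem' := ⟨zero_mem _, fun x _ => by
    simpa using (slowOp_smul χ ε s 0 (0 : ℝ → V) x).symm⟩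
  add_mem' := fun h₁ h₂ => ⟨add_mem h₁.1 h₂.1, fun x hx => by
    rw [slowOp_add, ← h₁.2 x hx, ← h₂.2 x hx]; rfl⟩
  smul_mem' := fun c _ h => ⟨Submodule.smul_mem _ c h.1, fun x hx => by
    rw [slowOp_smul, ← h.2 x hx]; rfl⟩

/-- The space `SFE^{ω,as,±}` of those `φ` in `SFE^{ω,±}` with `φ(x) = c/x + O(1)` as `x → 0⁺` for
some `c` in `V`. -/
def slowEigenAs (χ : triangleGroup q →* (V ≃ₗᵢ[ℂ] V)) (ε : ℤˣ) (s : ℂ) :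
    Submodule ℂ (ℝ → V) where
  carrier := {φ | φ ∈ slowEigen χ ε s ∧ ∃ c : V,
    (fun x : ℝ => φ x - x⁻¹ • c) =O[𝓝[>] 0] (fun _ : ℝ => (1 : ℝ))}
  zero_mem' := ⟨zero_mem _, 0, by
    simpa using Asymptotics.isBigO_zero (E' := V) (fun _ : ℝ => (1 : ℝ)) (𝓝[>] 0)⟩
  add_mem' := by
    rintro φ₁ φ₂ ⟨h₁, c₁, hc₁⟩ ⟨h₂, c₂, hc₂⟩
    refine ⟨add_mem h₁ h₂, c₁ + c₂, (hc₁.add hc₂).congr_left fun x => ?_⟩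
    simp only [Pi.add_apply, smul_add]
    abel
  smul_mem' := by
    rintro a φ ⟨h, c, hc⟩
    refine ⟨Submodule.smul_mem _ a h, a • c, (hc.const_smul_left a).congr_left fun x => ?_⟩
    simp only [Pi.smul_apply, smul_sub]
    rw [smul_comm a]

/-- The space `SFE^{ω,dec,±}` of those `φ` in `SFE^{ω,±}` for which the function given by `φ` on
`(0, 1/ℓ)` and by `∓α_s(J)φ` on `(-1/ℓ, 0)` extends to a smooth function on `(-1/ℓ, 1/ℓ)`. -/
def slowEigenDec (χ : triangleGroup q →* (V ≃ₗᵢ[ℂ] V)) (ε : ℤˣ) (s : ℂ) :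
    Submodule ℂ (ℝ → V) where
  carrier := {φ | φ ∈ slowEigen χ ε s ∧ ∃ G : ℝ → V,
    ContDiffOn ℝ ∞ G (Set.Ioo (-(1 / ell q)) (1 / ell q)) ∧
    (∀ x ∈ Set.Ioo 0 (1 / ell q), G x = φ x) ∧
    (∀ x ∈ Set.Ioo (-(1 / ell q)) 0, G x = -(ε • alphaR χ s (elJ q) φ x))}
  zero_mem' := ⟨zero_mem _, 0, contDiffOn_const, fun _ _ => rfl, fun x _ => by
    have := alphaR_smul χ s (elJ q) 0 (0 : ℝ → V) x
    rw [zero_smul, zero_smul] at this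
    simp [this]⟩
  add_mem' := by
    rintro φ₁ φ₂ ⟨h₁, G₁, s₁, p₁, n₁⟩ ⟨h₂, G₂, s₂, p₂, n₂⟩
    refine ⟨add_mem h₁ h₂, G₁ + G₂, s₁.add s₂, fun x hx => ?_, fun x hx => ?_⟩
    · simp [p₁ x hx, p₂ x hx]
    · simp only [Pi.add_apply, n₁ x hx, n₂ x hx, alphaR_add, smul_add]
      abel
  smul_mem' := by
    rintro a φ ⟨h, G, hs, p, n⟩
    refine ⟨Submodule.smul_mem _ a h, a • G, hs.const_smul a, fun x hx => ?_, fun x hx => ?_⟩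
    · simp [p x hx]
    · simp only [Pi.smul_apply, n x hx, alphaR_smul, smul_neg]
      rw [smul_comm a]

/-! ### Meromorphic continuation of infinite sums -/

open Classical in
/-- The value at `s` of the continuation of the infinite sum `s' ↦ ∑_n a s' n`, which is to converge
for `Re s' > 1/2`, to the half plane `Re s' > 0` with the point `1/2` (the only possible pole there)
removed. As this domain is connected, the continuation is unique. (If there is no
continuation, the value is `0`.) -/
def contSum (a : ℂ → ℕ → V) (s : ℂ) : V :=
  if h : ∃ M : ℂ → V, DifferentiableOn ℂ M {w | 0 < w.re ∧ w ≠ 1 / 2} ∧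
      ∀ w : ℂ, 1 / 2 < w.re → HasSum (a w) (M w)
  then h.choose s else 0

/-! ### Fast transfer operators -/

/-- `α_s(h) L_{0,s}^fast`, that is, `∑_{k=2}^m α_s(h g_{-k})`, plus `½ α_s(h g_{q/2})` for
even `q`. -/
def fastZero (χ : triangleGroup q →* (V ≃ₗᵢ[ℂ] V)) (s : ℂ) (h : triangleGroup q)
    (ψ : ℂ → V) (z : ℂ) : V :=
  (∑ k ∈ Finset.Icc 2 (numM q), alphaC χ s (h * elG q (-(k : ℤ))) ψ z) +
    if Even q then (1 / 2 : ℂ) • alphaC χ s (h * elG q ((q / 2 : ℕ) : ℤ)) ψ z else 0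

/-- `α_s(h) L_{-1,s}^fast`, that is, `∑_{n≥1} α_s(h g_{-1}^n)` for `Re s > 1/2`, and its meromorphic
continuation in `s` otherwise. -/
def fastMinus (χ : triangleGroup q →* (V ≃ₗᵢ[ℂ] V)) (s : ℂ) (h : triangleGroup q)
    (ψ : ℂ → V) (z : ℂ) : V :=
  contSum (fun w n => alphaC χ w (h * elG q (-1) ^ (n + 1)) ψ z) s

/-- `L_{-1,s}^fast` at points of the positive real line, where it only involves the values
of the function on `D₋₁`. -/
def fastMinusR (χ : triangleGroup q →* (V ≃ₗᵢ[ℂ] V)) (s : ℂ) (f : ℝ → V) (x : ℝ) : V :=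
  contSum (fun w n => alphaR χ w (elG q (-1) ^ (n + 1)) f x) s

end Operators

/-! ### The inductive limit space -/

/-- The elements acting from the component `f₀`: `h g_{-k}` for `2 ≤ k ≤ m` and, for even `q`,
`h g_{q/2}`, where `h` is `1` or `Q`. -/
def zeroElements (q : ℕ) : Set (triangleGroup q) :=
  {g | ∃ h : triangleGroup q, (h = 1 ∨ h = elQ q) ∧
    ((∃ k : ℕ, 2 ≤ k ∧ k ≤ numM q ∧ g = h * elG q (-(k : ℤ))) ∨
      (Even q ∧ g = h * elG q ((q / 2 : ℕ) : ℤ)))}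

/-- A pair `(E₀, E₋₁)` of bounded connected complex neighbourhoods of the closures of `D₀` and `D₋₁`
such that `g⁻¹.closure E_a ⊆ E_b` for every element `g` that acts in the `(a,b)` entry of the fast
transfer operator. The half planes are those on which all occurring cocycles are holomorphic.
(For `q = 3`, where `D₀` is empty, there is no component `f₀`; then `E₀` may be empty.) -/
structure AdmissiblePair (q : ℕ) where
  /-- the neighbourhood `E₀` of the closure of `D₀` -/
  zero : Set ℂ
  /-- the neighbourhood `E₋₁` of the closure of `D₋₁` -/
  minus : Set ℂ
  isOpen_zero : IsOpen zero
  isOpen_minus : IsOpen minus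
  isPreconnected_zero : IsPreconnected zero
  isPreconnected_minus : IsPreconnected minus
  isBounded_zero : Bornology.IsBounded zero
  isBounded_minus : Bornology.IsBounded minus
  subset_zero : ∀ x ∈ closure (dZero q), (x : ℂ) ∈ zero
  subset_minus : ∀ x ∈ closure (dMinus q), (x : ℂ) ∈ minus
  halfPlane_zero : ∀ z ∈ closure zero, 0 < z.re
  halfPlane_minus : ∀ z ∈ closure minus, -(1 / ell q) < z.re
  mapsTo_zero_zero : ∀ g ∈ zeroElements q,
    Set.MapsTo (act ℂ ((g⁻¹ : triangleGroup q) : PGL2)) (closure zero) zero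
  mapsTo_minus_zero : ∀ g ∈ zeroElements q,
    Set.MapsTo (act ℂ ((g⁻¹ : triangleGroup q) : PGL2)) (closure minus) zero
  mapsTo_zero_minus : ∀ h : triangleGroup q, (h = 1 ∨ h = elQ q) → ∀ n : ℕ, 1 ≤ n →
    Set.MapsTo (act ℂ (((h * elG q (-1) ^ n)⁻¹ : triangleGroup q) : PGL2)) (closure zero) minus
  mapsTo_minus_minus : ∀ n : ℕ, 1 ≤ n →
    Set.MapsTo (act ℂ (((elQ q * elG q (-1) ^ n)⁻¹ : triangleGroup q) : PGL2)) (closure minus) minus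

/-- Admissible pairs are ordered by reverse inclusion: smaller neighbourhoods come later in the
inductive system. -/
instance (q : ℕ) : Preorder (AdmissiblePair q) where
  le E E' := E'.zero ⊆ E.zero ∧ E'.minus ⊆ E.minus
  le_refl _ := ⟨subset_rfl, subset_rfl⟩
  le_trans _ _ _ h₁ h₂ := ⟨h₂.1.trans h₁.1, h₂.2.trans h₁.2⟩

open Classical in
instance (q : ℕ) : DecidableEq (AdmissiblePair q) := fun _ _ => propDecidable _

section Limit

variable (V : Type*) [NormedAddCommGroup V] [InnerProductSpace ℂ V]

/-- The space `B(E)` of continuous functions on the closure of `E` that are holomorphic on `E`. A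
function on the closure of `E` is represented by its extension by `0` to the plane. -/
def holSpace (E : Set ℂ) : Submodule ℂ (ℂ → V) where
  carrier := {ψ | ContinuousOn ψ (closure E) ∧ DifferentiableOn ℂ ψ E ∧ ∀ z ∉ closure E, ψ z = 0}
  zero_mem' := ⟨continuousOn_const, differentiableOn_const _, fun _ _ => rfl⟩
  add_mem' := fun h₁ h₂ => ⟨h₁.1.add h₂.1, h₁.2.1.add h₂.2.1, fun z hz => by
    simp [h₁.2.2 z hz, h₂.2.2 z hz]⟩
  smul_mem' := fun c _ h => ⟨h.1.const_smul c, h.2.1.const_smul c, fun z hz => by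
    simp [h.2.2 z hz]⟩

open Classical in
/-- The restriction map `B(E) → B(E')` for `E' ⊆ E`. -/
def holRestrict {E E' : Set ℂ} (h : E' ⊆ E) : holSpace V E →ₗ[ℂ] holSpace V E' where
  toFun ψ := ⟨(closure E').indicator ψ.1, by
    refine ⟨?_, ?_, fun z hz => Set.indicator_of_notMem hz _⟩
    · exact (ψ.2.1.mono (closure_mono h)).congr fun z hz => Set.indicator_of_mem hz _
    · exact (ψ.2.2.1.mono h).congr fun z hz => Set.indicator_of_mem (subset_closure hz) _⟩
  map_add' ψ₁ ψ₂ := Subtype.ext (Set.indicator_add _ _ _)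
  map_smul' c ψ := Subtype.ext (Set.indicator_const_smul (closure E') c ψ.1)

/-- The space `B(E₀) ⊕ B(E₋₁)`. -/
abbrev pairSpace {q : ℕ} (E : AdmissiblePair q) : Type _ :=
  holSpace V E.zero × holSpace V E.minus

/-- The transition maps of the inductive system: componentwise restriction. -/
def pairRestrict {q : ℕ} (E E' : AdmissiblePair q) (h : E ≤ E') :
    pairSpace V E →ₗ[ℂ] pairSpace V E' :=
  (holRestrict V h.1).prodMap (holRestrict V h.2)

/-- The space `𝓑 = 𝓑(D₀) ⊕ 𝓑(D₋₁)`, the inductive limit of the spaces `B(E₀) ⊕ B(E₋₁)` over all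
admissible pairs. -/
abbrev LimitSpace (q : ℕ) : Type _ :=
  Module.DirectLimit (fun E : AdmissiblePair q => pairSpace V E) (pairRestrict V)

variable {V} {q : ℕ}

/-- The element of `𝓑` represented by `(ψ₀, ψ₋₁)` in `B(E₀) ⊕ B(E₋₁)`. -/
def toLimit (E : AdmissiblePair q) (ψ : pairSpace V E) : LimitSpace V q :=
  Module.DirectLimit.of ℂ (AdmissiblePair q) (fun E => pairSpace V E) (pairRestrict V) E ψ

/-- The restriction of a function on the plane to a subset `D` of the real line, extended
by `0`. -/
def realRestrict (D : Set ℝ) : (ℂ → V) →ₗ[ℂ] (ℝ → V) where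
  toFun ψ := D.indicator fun x => ψ x
  map_add' _ _ := Set.indicator_add _ _ _
  map_smul' c ψ := Set.indicator_const_smul D c fun x : ℝ => ψ x

theorem realRestrict_indicator {D : Set ℝ} {E : Set ℂ} (h : ∀ x ∈ D, (x : ℂ) ∈ E) (ψ : ℂ → V) :
    realRestrict D (E.indicator ψ) = realRestrict D ψ := by
  change (D.indicator fun x : ℝ => E.indicator ψ (x : ℂ)) = D.indicator fun x : ℝ => ψ (x : ℂ)
  exact Set.indicator_congr fun x hx => Set.indicator_of_mem (h x hx) ψ

/-- The restriction `f₀|_{D₀}` of the component `f₀` of `f ∈ 𝓑`, extended by `0`. -/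
def resZero : LimitSpace V q →ₗ[ℂ] (ℝ → V) :=
  Module.DirectLimit.lift ℂ (AdmissiblePair q) (fun E => pairSpace V E) (pairRestrict V)
    (fun E => realRestrict (dZero q) ∘ₗ (holSpace V E.zero).subtype ∘ₗ LinearMap.fst ℂ _ _)
    (fun _ E' _ ψ => realRestrict_indicator
      (fun x hx => subset_closure (E'.subset_zero x (subset_closure hx))) ψ.1.1)

/-- The restriction `f₋₁|_{D₋₁}` of the component `f₋₁` of `f ∈ 𝓑`, extended by `0`. -/
def resMinus : LimitSpace V q →ₗ[ℂ] (ℝ → V) :=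
  Module.DirectLimit.lift ℂ (AdmissiblePair q) (fun E => pairSpace V E) (pairRestrict V)
    (fun E => realRestrict (dMinus q) ∘ₗ (holSpace V E.minus).subtype ∘ₗ LinearMap.snd ℂ _ _)
    (fun _ E' _ ψ => realRestrict_indicator
      (fun x hx => subset_closure (E'.subset_minus x (subset_closure hx))) ψ.2.1)

/-- The set `FFE^±` of those `f` in `𝓑` with `f = L^{fast,±} f`. The operator `L^{fast,±}` maps
`B(E₀) ⊕ B(E₋₁)` to itself; it is given by the matrix with rows
`((1 ± α_s(Q)) L_{0,s}, (1 ± α_s(Q)) L_{-1,s})` and `((1 ± α_s(Q)) L_{0,s}, ± α_s(Q) L_{-1,s})`. -/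
def fastEigen (χ : triangleGroup q →* (V ≃ₗᵢ[ℂ] V)) (ε : ℤˣ) (s : ℂ) : Set (LimitSpace V q) :=
  {f | ∃ (E : AdmissiblePair q) (ψ : pairSpace V E), toLimit E ψ = f ∧
    (∀ z ∈ E.zero, ψ.1.1 z =
      (fastZero χ s 1 ψ.1.1 z + ε • fastZero χ s (elQ q) ψ.1.1 z) +
      (fastMinus χ s 1 ψ.2.1 z + ε • fastMinus χ s (elQ q) ψ.2.1 z)) ∧
    (∀ z ∈ E.minus, ψ.2.1 z =
      (fastZero χ s 1 ψ.1.1 z + ε • fastZero χ s (elQ q) ψ.1.1 z) +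
      ε • fastMinus χ s (elQ q) ψ.2.1 z)}

/-- The function `(1 + L_{-1,s}^fast) f₋₁` on the positive real line near `0`, more precisely
on `D₋₁`. -/
def onePlusFast (χ : triangleGroup q →* (V ≃ₗᵢ[ℂ] V)) (s : ℂ) (f : LimitSpace V q) (x : ℝ) : V :=
  resMinus f x + fastMinusR χ s (resMinus f) x

/-- The set `FFE^{dec,±}` of those `f` in `FFE^±` for which the function given by
`(1 + L_{-1,s}^fast) f₋₁` for `x > 0` and by `∓α_s(J) (1 + L_{-1,s}^fast) f₋₁` for `x < 0`, on some
punctured neighbourhood of `0`, extends smoothly to `0`. -/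
def fastEigenDec (χ : triangleGroup q →* (V ≃ₗᵢ[ℂ] V)) (ε : ℤˣ) (s : ℂ) : Set (LimitSpace V q) :=
  {f | f ∈ fastEigen χ ε s ∧ ∃ δ > 0, δ ≤ 1 / ell q ∧ ∃ G : ℝ → V,
    ContDiffOn ℝ ∞ G (Set.Ioo (-δ) δ) ∧
    (∀ x ∈ Set.Ioo 0 δ, G x = onePlusFast χ s f x) ∧
    (∀ x ∈ Set.Ioo (-δ) 0, G x = -(ε • alphaR χ s (elJ q) (onePlusFast χ s f) x))}

end Limit

end

end HeckeTransfer

/-!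
Both eigenspaces are described by functions on the real line near `0`, and the two maps of the
theorem are inverse to each other because `1 - α_s(g_{-1})` and `1 + L_{-1}` are inverse operators
on suitable spaces: formally, `1 + L_{-1} = ∑_{n ≥ 0} α_s(g_{-1})ⁿ` is a geometric series.

*Continuation.* In the coordinate `v = 1/x` the element `g_{-1}` acts as the translation
`v ↦ v + ℓ`, so that `L_{-1}` becomes the Lerch-type sum `∑_{n ≥ 1} (v + nℓ)^{-2s} Aⁿ ψ(1/(v + nℓ))` with
the isometry `A = χ(g_{-1})`. Since `V` is finite-dimensional, `ψ(0)` is the sum of a vector fixed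
by `A` and a coboundary `r - A r`. The first is summed by the primitive of `y^{-2s}` up to an
error of order `|y|^{-2 Re s - 1}`, the second telescopes; what remains converges absolutely for
`Re s > 0`. This gives an explicit continuation (`LerchData.cont`), its functional equation
(`LerchData.cont_eq`), its holomorphy in both variables and its asymptotics
`v^{1-2s} c + O(v^{-2 Re s})`. By the identity theorem it computes `contSum` (`contSum_eq`).

*From fast to slow.* The right-hand side of the first fast equation makes sense on the whole
positive half line. On `I` it is real-analytic, and `α_s(g_{-1})(1 + L_{-1}) = L_{-1}` turns the
fast equations into the slow one (`exists_slowEigenAs_of_fast`). The asymptotics of the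
continuation give the condition `φ(x) = c/x + O(1)`.

*From slow to fast.* For `φ` in `SFE^{ω,as,±}` the slow equation shows that `(1 - α_s(g_{-1}))φ`
is real-analytic on the closed interval `[0, 1/ℓ]`, and that `φ` is so on a neighbourhood of the
closure of `D₀`. Hence both extend to complex neighbourhoods (`exists_holomorphic_extension`).
Lenses, which Möbius transformations permute, provide admissible pairs inside any such
neighbourhoods (`exists_admissiblePair`). It remains to see that `φ = (1 + L_{-1})ψ` for
`ψ = (1 - α_s(g_{-1}))φ`: the difference, in the coordinate `v`, satisfies `p(v) = A p(v + ℓ)` and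
`p(v) = v^{1-2s} c + O(v^{-2 Re s})`. As `s ≠ 1/2`, such a function vanishes (`eq_zero_of_shift_eq`):
iterating, the sequence `(v + nℓ)^{1-2s} c` converges to `p(v)`, which forces `c = 0` unless the powers
tend to `0`. The fast equations then hold on real intervals, hence everywhere.

An element of the inductive limit is determined by its restrictions to `D₀` and `D₋₁`
(`eq_of_res_eq`), and an analytic function on `I` by its restriction to `D₋₁`; this gives
linearity, uniqueness, and the characterizations of both maps. Finally, `φ = (1 + L_{-1})f₋₁` near
`0`, so the two smoothness conditions agree.
-/

namespace HeckeTransfer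

/-! ### Matrices of the occurring group elements -/

/-- `g` is the class in `PGL₂(ℝ)` of the matrix `M`. -/
def Represents (g : PGL2) (M : Matrix (Fin 2) (Fin 2) ℝ) : Prop :=
  ∃ A : GL (Fin 2) ℝ, (A : Matrix (Fin 2) (Fin 2) ℝ) = M ∧ g = QuotientGroup.mk A

theorem Represents.mul {g h : PGL2} {M N : Matrix (Fin 2) (Fin 2) ℝ} (hg : Represents g M)
    (hh : Represents h N) : Represents (g * h) (M * N) := by
  obtain ⟨A, rfl, rfl⟩ := hg
  obtain ⟨B, rfl, rfl⟩ := hh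
  exact ⟨A * B, by simp, rfl⟩

theorem Represents.neg {g : PGL2} {M : Matrix (Fin 2) (Fin 2) ℝ} (hg : Represents g M) :
    Represents g (-M) := by
  obtain ⟨A, rfl, rfl⟩ := hg
  refine ⟨-A, by simp, ?_⟩
  rw [QuotientGroup.eq, Matrix.GeneralLinearGroup.mem_center_iff_val_mem_range_scalar]
  refine ⟨-1, ?_⟩
  have : A⁻¹ * -A = -1 := by simp
  rw [this]
  ext i j
  fin_cases i <;> fin_cases j <;> simp

theorem Represents.congr {g : PGL2} {M N : Matrix (Fin 2) (Fin 2) ℝ} (hg : Represents g M)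
    (h : M = N) : Represents g N := h ▸ hg

theorem represents_mk {M : Matrix (Fin 2) (Fin 2) ℝ} (h : M.det ≠ 0) :
    Represents (QuotientGroup.mk (Matrix.GeneralLinearGroup.mkOfDetNeZero M h)) M :=
  ⟨_, rfl, rfl⟩

theorem Represents.inv {g : PGL2} {a b c d : ℝ} (hg : Represents g !![a, b; c, d])
    (hdet : a * d - b * c = 1) : Represents g⁻¹ !![d, -b; -c, a] := by
  obtain ⟨A, hA, rfl⟩ := hg
  refine ⟨A⁻¹, ?_, rfl⟩
  rw [Matrix.coe_units_inv, hA, Matrix.inv_def, Matrix.det_fin_two_of, hdet]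
  simp [Matrix.adjugate_fin_two_of]

/-- `s_k = sin(kπ/q) / sin(π/q)`, the entries of the powers of the elliptic element `T_q S`. -/
noncomputable def sn (q : ℕ) (k : ℤ) : ℝ := Real.sin (k * (Real.pi / q)) / Real.sin (Real.pi / q)

variable {q : ℕ}

theorem sin_pi_div_pos (hq : 3 ≤ q) : 0 < Real.sin (Real.pi / q) := by
  have h3 : (3 : ℝ) ≤ q := by exact_mod_cast hq
  apply Real.sin_pos_of_pos_of_lt_pi (by positivity)
  exact div_lt_self Real.pi_pos (by linarith)

theorem sn_succ (q : ℕ) (k : ℤ) : sn q (k + 1) = ell q * sn q k - sn q (k - 1) := by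
  unfold sn ell
  push_cast
  rw [add_mul, sub_mul, Real.sin_add, Real.sin_sub, one_mul]
  ring

theorem sn_zero (q : ℕ) : sn q 0 = 0 := by simp [sn]

theorem sn_one (hq : 3 ≤ q) : sn q 1 = 1 := by
  simp [sn, (sin_pi_div_pos hq).ne']

theorem sn_neg (q : ℕ) (k : ℤ) : sn q (-k) = -sn q k := by
  simp [sn, neg_div]

theorem sn_two (hq : 3 ≤ q) : sn q 2 = ell q := by
  have := sn_succ q 1
  norm_num [sn_one hq, sn_zero] at this
  exact this

theorem sn_det (hq : 3 ≤ q) (k : ℤ) : sn q k * sn q k - sn q (k - 1) * sn q (k + 1) = 1 := by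
  unfold sn
  have h := (sin_pi_div_pos hq).ne'
  push_cast
  rw [add_mul, sub_mul, Real.sin_add, Real.sin_sub, one_mul]
  field_simp
  have h1 := Real.sin_sq_add_cos_sq (k * Real.pi / q)
  have h2 := Real.sin_sq_add_cos_sq (Real.pi / q)
  linear_combination Real.sin (Real.pi / q) ^ 2 * h1 - Real.sin (k * Real.pi / q) ^ 2 * h2

theorem sn_sub (hq : 3 ≤ q) (k : ℤ) : sn q (q - k) = sn q k := by
  have h3 : (q : ℝ) ≠ 0 := by positivity
  unfold sn
  push_cast
  rw [sub_mul, mul_div_cancel₀ _ h3, Real.sin_pi_sub]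

theorem sn_pos (hq : 3 ≤ q) {k : ℤ} (h0 : 0 < k) (h1 : k < q) : 0 < sn q k := by
  have h3 : (3 : ℝ) ≤ q := by exact_mod_cast hq
  have h0' : (0 : ℝ) < k := by exact_mod_cast h0
  have h1' : (k : ℝ) < q := by exact_mod_cast h1
  refine div_pos (Real.sin_pos_of_pos_of_lt_pi (by positivity) ?_) (sin_pi_div_pos hq)
  rw [← mul_div_assoc, div_lt_iff₀ (by positivity)]
  nlinarith [Real.pi_pos]

theorem sn_nonneg (hq : 3 ≤ q) {k : ℤ} (h0 : 0 ≤ k) (h1 : k ≤ q) : 0 ≤ sn q k := by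
  rcases h0.eq_or_lt with rfl | h0
  · rw [sn_zero]
  rcases h1.eq_or_lt with rfl | h1
  · have := sn_sub hq 0
    rw [sub_zero, sn_zero] at this
    exact this.ge
  · exact (sn_pos hq h0 h1).le

theorem one_le_ell (hq : 3 ≤ q) : 1 ≤ ell q := by
  have h := sn_nonneg hq (k := 3) (by norm_num) (by exact_mod_cast hq)
  have h2 := sn_pos hq (k := 2) (by norm_num) (by omega)
  have h3 := sn_succ q 2
  norm_num at h3
  rw [h3, sn_two hq, sn_one hq] at h
  rw [sn_two hq] at h2
  nlinarith

theorem one_lt_ell (hq : 3 ≤ q) (hq3 : q ≠ 3) : 1 < ell q := by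
  have h := sn_pos hq (k := 3) (by norm_num) (by omega)
  have h2 := sn_pos hq (k := 2) (by norm_num) (by omega)
  have h3 := sn_succ q 2
  norm_num at h3
  rw [h3, sn_two hq, sn_one hq] at h
  rw [sn_two hq] at h2
  nlinarith

theorem ell_pos (hq : 3 ≤ q) : 0 < ell q := one_pos.trans_le (one_le_ell hq)

theorem ell_three : ell 3 = 1 := by
  unfold ell
  norm_num

theorem represents_TS (q : ℕ) : Represents (matT q * matS) !![ell q, -1; 1, 0] := by
  have := ((represents_mk (M := !![1, ell q; 0, 1]) (by simp)).mul
    (represents_mk (M := !![0, 1; -1, 0]) (by simp))).neg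
  refine this.congr ?_
  ext i j
  fin_cases i <;> fin_cases j <;> simp

theorem represents_TS_zpow (hq : 3 ≤ q) (k : ℤ) : Represents ((matT q * matS) ^ k)
    !![sn q (k + 1), -sn q k; sn q k, -sn q (k - 1)] := by
  induction k with
  | zero =>
    refine ⟨1, ?_, rfl⟩
    ext i j
    fin_cases i <;> fin_cases j <;> simp [sn_zero, sn_one hq, sn_neg]
  | succ k ih =>
    rw [zpow_add_one]
    convert ih.mul (represents_TS q) using 1
    have h1 := sn_succ q (k + 1)
    have h2 := sn_succ q k
    rw [add_sub_cancel_right] at h1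
    ext i j
    fin_cases i <;> fin_cases j <;> simp [h1, h2] <;> ring
  | pred k ih =>
    rw [zpow_sub_one]
    convert ih.mul ((represents_TS q).inv (by simp)) using 1
    have h1 := sn_succ q (-k - 1)
    have h2 := sn_succ q (-k)
    rw [sub_add_cancel] at h1
    ext i j
    fin_cases i <;> fin_cases j <;> simp [h1, h2] <;> ring

theorem represents_elG_inv (hq : 3 ≤ q) (k : ℤ) :
    Represents (((elG q k)⁻¹ : triangleGroup q) : PGL2)
      !![sn q k, sn q (k + 1); sn q (k - 1), sn q k] := by
  have h := ((represents_TS_zpow hq k).mul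
    (represents_mk (M := !![0, 1; -1, 0]) (by simp)))
  have he : (((elG q k)⁻¹ : triangleGroup q) : PGL2) = (matT q * matS) ^ k * matS := by
    simp [elG, elT, elS]
  rw [he]
  refine h.congr ?_
  ext i j
  fin_cases i <;> fin_cases j <;> simp

theorem represents_Q_mul {g : triangleGroup q} {a b c d : ℝ}
    (h : Represents ((g⁻¹ : triangleGroup q) : PGL2) !![a, b; c, d]) :
    Represents (((elQ q * g)⁻¹ : triangleGroup q) : PGL2) !![b, a; d, c] := by
  have hQ : Represents (((elQ q)⁻¹ : triangleGroup q) : PGL2) !![0, 1; 1, 0] := by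
    have h1 : (((elQ q)⁻¹ : triangleGroup q) : PGL2) = matQ := by
      change matQ⁻¹ = matQ
      rw [inv_eq_iff_mul_eq_one]
      refine congrArg QuotientGroup.mk (?_ : _ * _ = (1 : GL (Fin 2) ℝ))
      ext i j
      fin_cases i <;> fin_cases j <;> simp [Matrix.GeneralLinearGroup.mkOfDetNeZero]
    rw [h1]
    exact represents_mk _
  have := h.mul hQ
  rw [mul_inv_rev]
  refine this.congr ?_
  ext i j
  fin_cases i <;> fin_cases j <;> simp

/-- The element `g_{-k}`, except that `g_{q/2}` is used for `k = q/2` (the two agree in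
`PGL₂(ℝ)`). With this notation the slow and fast operators are sums over `k ≤ ⌊q/2⌋`. -/
noncomputable def gel (q k : ℕ) : triangleGroup q := if 2 * k = q then elG q k else elG q (-k)

/-- The weight of `g_{-k}` in the transfer operators: `½` for `k = q/2` and `1` otherwise. -/
noncomputable def wt (q k : ℕ) : ℂ := if 2 * k = q then 1 / 2 else 1

theorem represents_gel_inv (hq : 3 ≤ q) (k : ℕ) :
    Represents (((gel q k)⁻¹ : triangleGroup q) : PGL2)
      !![sn q k, sn q (k - 1); sn q (k + 1), sn q k] := by
  unfold gel
  split_ifs with h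
  · have h1 : sn q (k + 1) = sn q (k - 1) := by
      rw [← sn_sub hq]
      congr 1
      omega
    convert represents_elG_inv hq k using 3
    · rw [h1]
    · rw [h1]
  · convert (represents_elG_inv hq (-k)).neg using 1
    have h1 : (-k + 1 : ℤ) = -(k - 1) := by ring
    have h2 : (-k - 1 : ℤ) = -(k + 1) := by ring
    rw [h1, h2, sn_neg, sn_neg, sn_neg]
    ext i j
    fin_cases i <;> fin_cases j <;> simp

theorem represents_Q_gel_inv (hq : 3 ≤ q) (k : ℕ) :
    Represents (((elQ q * gel q k)⁻¹ : triangleGroup q) : PGL2)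
      !![sn q (k - 1), sn q k; sn q k, sn q (k + 1)] :=
  represents_Q_mul (represents_gel_inv hq k)

theorem represents_parabolic_inv (hq : 3 ≤ q) (n : ℕ) :
    Represents (((elG q (-1) ^ n)⁻¹ : triangleGroup q) : PGL2)
      !![1, 0; n * ell q, 1] := by
  induction n with
  | zero =>
    refine ⟨1, ?_, by simp⟩
    ext i j
    fin_cases i <;> fin_cases j <;> simp
  | succ n ih =>
    rw [pow_succ', mul_inv_rev]
    refine (ih.mul (represents_elG_inv hq (-1)).neg).congr ?_
    have h2 : (-1 - 1 : ℤ) = -2 := by ring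
    ext i j
    fin_cases i <;> fin_cases j <;>
      simp [sn_neg, sn_zero, sn_one hq, h2, sn_two hq]
    ring

theorem represents_Q_parabolic_inv (hq : 3 ≤ q) (n : ℕ) :
    Represents (((elQ q * elG q (-1) ^ n)⁻¹ : triangleGroup q) : PGL2)
      !![0, 1; 1, n * ell q] :=
  represents_Q_mul (represents_parabolic_inv hq n)

theorem represents_J_inv (q : ℕ) :
    Represents (((elJ q)⁻¹ : triangleGroup q) : PGL2) !![-1, 0; 0, 1] := by
  have h1 : (((elJ q)⁻¹ : triangleGroup q) : PGL2) = elJ q := by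
    rw [InvMemClass.coe_inv, coe_elJ, inv_eq_iff_mul_eq_one]
    refine congrArg QuotientGroup.mk (?_ : _ * _ = (1 : GL (Fin 2) ℝ))
    ext i j
    fin_cases i <;> fin_cases j <;> simp [Matrix.GeneralLinearGroup.mkOfDetNeZero]
  rw [h1, coe_elJ]
  exact represents_mk _

/-! ### Explicit formulas for the action -/

theorem Represents.act_eq {g : PGL2} {a b c d : ℝ} (h : Represents g !![a, b; c, d])
    {𝕜 : Type} [Field 𝕜] [Algebra ℝ 𝕜] (z : 𝕜) :
    act 𝕜 g z = (algebraMap ℝ 𝕜 a * z + algebraMap ℝ 𝕜 b) /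
      (algebraMap ℝ 𝕜 c * z + algebraMap ℝ 𝕜 d) := by
  obtain ⟨A, hA, rfl⟩ := h
  change (algebraMap ℝ 𝕜 (A 0 0) * z + algebraMap ℝ 𝕜 (A 0 1)) /
      (algebraMap ℝ 𝕜 (A 1 0) * z + algebraMap ℝ 𝕜 (A 1 1)) = _
  rw [hA]
  simp

theorem Represents.jac_eq {g : PGL2} {a b c d : ℝ} (h : Represents g !![a, b; c, d])
    (hdet : |a * d - b * c| = 1)
    {𝕜 : Type} [Field 𝕜] [Algebra ℝ 𝕜] (z : 𝕜) :
    jac 𝕜 g z = ((algebraMap ℝ 𝕜 c * z + algebraMap ℝ 𝕜 d) ^ 2)⁻¹ := by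
  obtain ⟨A, hA, rfl⟩ := h
  change algebraMap ℝ 𝕜 |A 0 0 * A 1 1 - A 0 1 * A 1 0| *
      ((algebraMap ℝ 𝕜 (A 1 0) * z + algebraMap ℝ 𝕜 (A 1 1)) ^ 2)⁻¹ = _
  rw [hA]
  simp [hdet]

/-- On the right half plane the principal powers satisfy `(y⁻²)^s = y^{-2s}`. -/
theorem inv_sq_cpow {y : ℂ} (hy : 0 < y.re) (s : ℂ) : ((y ^ 2)⁻¹) ^ s = y ^ (-2 * s) := by
  have h0 : y ≠ 0 := by rintro rfl; simp at hy
  have harg := Complex.abs_arg_lt_pi_div_two_iff.mpr (Or.inl hy)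
  rw [abs_lt] at harg
  have h1 : (y ^ 2)⁻¹ = y ^ (-2 : ℂ) := by
    rw [Complex.cpow_neg]
    norm_num
  rw [h1, ← Complex.cpow_mul]
  · simp [Complex.log_im]
    linarith
  · simp [Complex.log_im]
    linarith

section

variable {V : Type*} [NormedAddCommGroup V] [InnerProductSpace ℂ V]
variable (χ : triangleGroup q →* (V ≃ₗᵢ[ℂ] V)) (s : ℂ)

theorem alphaC_eq {g : triangleGroup q} {a b c d : ℝ}
    (h : Represents ((g⁻¹ : triangleGroup q) : PGL2) !![a, b; c, d])
    (hdet : |a * d - b * c| = 1) (ψ : ℂ → V) {z : ℂ} (hz : 0 < c * z.re + d) :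
    alphaC χ s g ψ z = (c * z + d : ℂ) ^ (-2 * s) • χ g (ψ ((a * z + b) / (c * z + d))) := by
  unfold alphaC
  rw [h.act_eq, h.jac_eq hdet]
  simp only [Complex.coe_algebraMap]
  rw [inv_sq_cpow (by simpa using hz)]

theorem alphaR_eq {g : triangleGroup q} {a b c d : ℝ}
    (h : Represents ((g⁻¹ : triangleGroup q) : PGL2) !![a, b; c, d])
    (hdet : |a * d - b * c| = 1) (φ : ℝ → V) {x : ℝ} (hx : 0 < c * x + d) :
    alphaR χ s g φ x = (c * x + d : ℂ) ^ (-2 * s) • χ g (φ ((a * x + b) / (c * x + d))) := by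
  unfold alphaR
  rw [h.act_eq, h.jac_eq hdet]
  simp only [Algebra.algebraMap_self, RingHom.id_apply]
  push_cast
  rw [inv_sq_cpow (by simpa using hx)]

theorem alphaR_J (φ : ℝ → V) (x : ℝ) : alphaR χ s (elJ q) φ x = χ (elJ q) (φ (-x)) := by
  rw [alphaR_eq χ s (represents_J_inv q) (by norm_num) φ (by norm_num)]
  simp

end

end HeckeTransfer

namespace HeckeTransfer

/-! ### Lerch-type sums: elementary estimates -/

open Filter Asymptotics

theorem norm_cpow_le_rpow_mul_exp (y z : ℂ) :
    ‖y ^ z‖ ≤ ‖y‖ ^ z.re * Real.exp (Real.pi * ‖z‖) := by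
  refine (Complex.norm_cpow_le y z).trans ?_
  rw [div_eq_mul_inv, ← Real.exp_neg]
  gcongr
  refine (neg_le_abs _).trans ?_
  rw [abs_mul]
  exact mul_le_mul (Complex.abs_arg_le_pi y) (Complex.abs_im_le_norm z) (abs_nonneg _)
    Real.pi_pos.le

theorem ne_zero_of_re_pos {y : ℂ} (hy : 0 < y.re) : y ≠ 0 := by
  rintro rfl
  simp at hy

theorem norm_le_norm_add_ofReal {y : ℂ} (hy : 0 < y.re) {t : ℝ} (ht : 0 ≤ t) :
    ‖y‖ ≤ ‖y + t‖ := by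
  rw [← sq_le_sq₀ (norm_nonneg _) (norm_nonneg _), Complex.sq_norm, Complex.sq_norm,
    Complex.normSq_apply, Complex.normSq_apply]
  simp
  nlinarith

theorem hasDerivWithinAt_add_cpow {y : ℂ} (hy : 0 < y.re) (z : ℂ) {t : ℝ} (ht : 0 ≤ t)
    (S : Set ℝ) :
    HasDerivWithinAt (fun t : ℝ => (y + t) ^ z) (z * (y + t) ^ (z - 1)) S t := by
  have h1 : HasDerivAt (fun t : ℂ => (y + t) ^ z) (z * (y + t) ^ (z - 1) * 1) (t : ℂ) :=
    ((hasDerivAt_id (t : ℂ)).const_add y).cpow_const (Or.inl (by simp; linarith))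
  rw [mul_one] at h1
  exact h1.comp_ofReal.hasDerivWithinAt

/-- The exponential factor that bounds the contribution of the argument in the powers with
exponent `-2w` or `-2w - 1`, for `‖w‖ ≤ ρ`. -/
noncomputable def argFactor (ρ : ℝ) : ℝ := Real.exp (Real.pi * (2 * ρ + 1))

theorem argFactor_pos (ρ : ℝ) : 0 < argFactor ρ := Real.exp_pos _

theorem norm_cpow_neg_two_mul_le {y w : ℂ} {ρ : ℝ} (hρ : ‖w‖ ≤ ρ) :
    ‖y ^ (-2 * w)‖ ≤ argFactor ρ * ‖y‖ ^ (-2 * w.re) := by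
  refine (norm_cpow_le_rpow_mul_exp y _).trans ?_
  rw [mul_comm, argFactor]
  have h : (-2 * w).re = -2 * w.re := by simp
  rw [h]
  gcongr
  simp
  linarith

theorem norm_cpow_sub_cpow_le {y w : ℂ} {ρ L : ℝ} (hy : 0 < y.re) (hw : 0 < w.re)
    (hρ : ‖w‖ ≤ ρ) {t : ℝ} (ht : t ∈ Set.Icc 0 L) :
    ‖(y + t) ^ (-2 * w) - y ^ (-2 * w)‖ ≤
      2 * ρ * argFactor ρ * L * ‖y‖ ^ (-2 * w.re - 1) := by
  have hy0 : 0 < ‖y‖ := norm_pos_iff.mpr (ne_zero_of_re_pos hy)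
  have hρ0 : 0 ≤ ρ := (norm_nonneg w).trans hρ
  have h := norm_image_sub_le_of_norm_deriv_le_segment' (a := 0) (b := L)
    (C := 2 * ρ * argFactor ρ * ‖y‖ ^ (-2 * w.re - 1))
    (fun x hx => hasDerivWithinAt_add_cpow hy (-2 * w) hx.1 (Set.Icc 0 L))
    (fun x hx => by
      rw [norm_mul, mul_assoc]
      have h1 : ‖-2 * w‖ ≤ 2 * ρ := by simp; linarith
      refine mul_le_mul h1 ?_ (norm_nonneg _) (by positivity)
      refine (norm_cpow_le_rpow_mul_exp _ _).trans ?_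
      rw [mul_comm, argFactor]
      have h2 : (-2 * w - 1).re = -2 * w.re - 1 := by simp
      have h3 : ‖-2 * w - 1‖ ≤ 2 * ρ + 1 := by
        refine (norm_sub_le _ _).trans ?_
        rw [norm_one]
        linarith
      rw [h2]
      have h4 : ‖y + x‖ ^ (-2 * w.re - 1) ≤ ‖y‖ ^ (-2 * w.re - 1) :=
        Real.rpow_le_rpow_of_nonpos hy0 (norm_le_norm_add_ofReal hy hx.1) (by linarith)
      gcongr) t ht
  simp only [Complex.ofReal_zero, add_zero, sub_zero] at h
  refine h.trans ?_
  have := argFactor_pos ρ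
  calc _ ≤ 2 * ρ * argFactor ρ * ‖y‖ ^ (-2 * w.re - 1) * L := by gcongr; exact ht.2
    _ = _ := by ring

/-- The trapezoid-type estimate comparing `y^{-2w}` with its mean over `[y, y + L]`. -/
theorem norm_cpow_add_sub_div_le {y w : ℂ} {ρ L : ℝ} (hy : 0 < y.re) (hw : 0 < w.re)
    (hw2 : w ≠ 1 / 2) (hρ : ‖w‖ ≤ ρ) (hL : 0 < L) :
    ‖y ^ (-2 * w) + ((y + L) ^ (1 - 2 * w) - y ^ (1 - 2 * w)) / (L * (2 * w - 1))‖ ≤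
      2 * ρ * argFactor ρ * L * ‖y‖ ^ (-2 * w.re - 1) := by
  have hne : 1 - 2 * w ≠ 0 := by
    intro h
    apply hw2
    linear_combination (-1 / 2 : ℂ) * h
  have hd : ∀ x ∈ Set.Icc 0 L, HasDerivWithinAt
      (fun t : ℝ => (y + t) ^ (1 - 2 * w) / (1 - 2 * w) - t * y ^ (-2 * w))
      ((y + x) ^ (-2 * w) - y ^ (-2 * w)) (Set.Icc 0 L) x := by
    intro x hx
    have h1 := (hasDerivWithinAt_add_cpow hy (1 - 2 * w) hx.1 (Set.Icc 0 L)).div_const (1 - 2 * w)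
    have h2 := ((hasDerivAt_id (x : ℂ)).mul_const (y ^ (-2 * w))).comp_ofReal.hasDerivWithinAt
      (s := Set.Icc 0 L)
    refine (h1.sub h2).congr_deriv ?_
    rw [mul_div_cancel_left₀ _ hne]
    ring_nf
  have h := norm_image_sub_le_of_norm_deriv_le_segment' hd
    (fun x hx => norm_cpow_sub_cpow_le hy hw hρ ⟨hx.1, hx.2.le⟩) L ⟨hL.le, le_rfl⟩
  have hLc : (L : ℂ) ≠ 0 := by exact_mod_cast hL.ne'
  have hne' : 2 * w - 1 ≠ 0 := by
    intro h
    apply hne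
    linear_combination -h
  have he : y ^ (-2 * w) + ((y + L) ^ (1 - 2 * w) - y ^ (1 - 2 * w)) / (L * (2 * w - 1)) =
      -((y + L) ^ (1 - 2 * w) / (1 - 2 * w) - L * y ^ (-2 * w) -
        ((y + (0 : ℝ)) ^ (1 - 2 * w) / (1 - 2 * w) - (0 : ℝ) * y ^ (-2 * w))) / L := by
    have : 2 * w - 1 = -(1 - 2 * w) := by ring
    rw [this]
    push_cast
    rw [add_zero]
    field_simp
    ring
  rw [he, norm_div, norm_neg, Complex.norm_real, Real.norm_eq_abs, abs_of_pos hL, div_le_iff₀ hL]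
  refine h.trans (le_of_eq ?_)
  ring

/-- A telescoping bound for `∑ (v + (n+1)L)^{-a-1}`. -/
theorem sum_rpow_le {a L v : ℝ} (ha : 0 < a) (hL : 0 < L) (hv : 0 < v) (N : ℕ) :
    ∑ n ∈ Finset.range N, (v + (n + 1) * L) ^ (-a - 1) ≤ (a * L)⁻¹ * v ^ (-a) := by
  have key : ∀ x : ℝ, 0 < x →
      (x + L) ^ (-a - 1) ≤ (a * L)⁻¹ * (x ^ (-a) - (x + L) ^ (-a)) := by
    intro x hx
    have hX : 0 < x + L := by linarith
    have h1 : 1 + a * (L / (x + L)) ≤ (x / (x + L)) ^ (-a) := by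
      rw [Real.rpow_def_of_pos (by positivity)]
      have h2 := Real.log_le_sub_one_of_pos (show 0 < x / (x + L) by positivity)
      have h3 := Real.add_one_le_exp (Real.log (x / (x + L)) * -a)
      have h4 : x / (x + L) - 1 = -(L / (x + L)) := by field_simp; ring
      nlinarith
    rw [Real.div_rpow hx.le hX.le, le_div_iff₀ (by positivity)] at h1
    rw [Real.rpow_sub_one hX.ne', inv_mul_eq_div, le_div_iff₀ (by positivity)]
    have h5 : (x + L) ^ (-a) / (x + L) * (a * L) =
        (a * (L / (x + L))) * (x + L) ^ (-a) := by ring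
    rw [h5]
    linarith
  have h6 : ∀ N : ℕ, ∑ n ∈ Finset.range N, (v + (n + 1) * L) ^ (-a - 1) ≤
      (a * L)⁻¹ * (v ^ (-a) - (v + N * L) ^ (-a)) := by
    intro N
    induction N with
    | zero => simp
    | succ N ih =>
      rw [Finset.sum_range_succ]
      have h7 := key (v + N * L) (by positivity)
      have h8 : v + N * L + L = v + (N + 1) * L := by ring
      rw [h8] at h7
      push_cast
      linarith [mul_sub (a * L)⁻¹ (v ^ (-a)) ((v + N * L) ^ (-a)),
        mul_sub (a * L)⁻¹ ((v + N * L) ^ (-a)) ((v + (N + 1) * L) ^ (-a)),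
        mul_sub (a * L)⁻¹ (v ^ (-a)) ((v + (N + 1) * L) ^ (-a))]
  refine (h6 N).trans ?_
  have : 0 ≤ (v + N * L) ^ (-a) := by positivity
  gcongr
  linarith

/-! ### The meromorphic continuation of Lerch-type sums -/

section

variable {V : Type*} [NormedAddCommGroup V] [InnerProductSpace ℂ V]

/-- For an isometry `A` of a finite-dimensional space, the fixed space is complementary to the
range of `1 - A`. -/
theorem exists_fixed_add_sub [FiniteDimensional ℂ V] (A : V ≃ₗᵢ[ℂ] V) (v : V) :
    ∃ p r : V, A p = p ∧ v = p + (r - A r) := by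
  let T : V →ₗ[ℂ] V := LinearMap.id - A.toLinearEquiv.toLinearMap
  obtain ⟨k, ⟨r, rfl⟩, p, hp, rfl⟩ :=
    Submodule.exists_add_mem_mem_orthogonal (𝕜 := ℂ) (K := LinearMap.range T) v
  refine ⟨p, r, ?_, add_comm _ _⟩
  have h1 : inner ℂ (T p) p = 0 := (Submodule.mem_orthogonal _ _).mp hp _ ⟨p, rfl⟩
  have h2 : RCLike.re (inner ℂ (A p) p) = ‖p‖ ^ 2 := by
    have h3 : T p = p - A p := rfl
    rw [h3, inner_sub_left, sub_eq_zero] at h1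
    rw [← h1, inner_self_eq_norm_sq]
  have h4 := norm_sub_sq (𝕜 := ℂ) (A p) p
  rw [h2, A.norm_map] at h4
  rw [← sub_eq_zero, ← norm_eq_zero]
  nlinarith [norm_nonneg (A p - p)]

/-- Termwise criterion for complex differentiability of a series at a point, allowing finitely many
exceptional terms. -/
theorem differentiableAt_tsum_of_eventually [CompleteSpace V] {f : ℕ → ℂ → V} {z₀ : ℂ}
    (hd : ∀ n, DifferentiableAt ℂ (f n) z₀) (N : ℕ) {u : ℕ → ℝ} (hu : Summable u)
    (hU : ∀ᶠ z in 𝓝 z₀, ∀ n, N ≤ n → DifferentiableAt ℂ (f n) z ∧ ‖f n z‖ ≤ u n) :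
    DifferentiableAt ℂ (fun z => ∑' n, f n z) z₀ := by
  obtain ⟨U, hUsub, hUo, hz⟩ := eventually_nhds_iff.mp hU
  have hu' : Summable fun n => u (n + N) := (summable_nat_add_iff N).mpr hu
  have h1 : DifferentiableOn ℂ (fun z => ∑' n, f (n + N) z) U :=
    Complex.differentiableOn_tsum_of_summable_norm hu'
      (fun n z hz => (hUsub z hz (n + N) (by omega)).1.differentiableWithinAt) hUo
      fun n z hz => (hUsub z hz (n + N) (by omega)).2
  have h2 : DifferentiableAt ℂ (fun z => ∑ n ∈ Finset.range N, f n z) z₀ :=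
    DifferentiableAt.fun_sum fun n _ => hd n
  refine (h2.add (h1.differentiableAt (hUo.mem_nhds hz))).congr_of_eventuallyEq ?_
  filter_upwards [hUo.mem_nhds hz] with z hz
  have h3 : Summable fun n => f n z := by
    rw [← summable_nat_add_iff N]
    exact Summable.of_norm_bounded hu' fun n => (hUsub z hz (n + N) (by omega)).2
  exact (h3.sum_add_tsum_nat_add N).symm

/-- Data for the continuation of `∑_{n ≥ 1} (v + nL)^{-2w} Aⁿ ψ(1/(v + nL))`: the value `ψ(0)` is
decomposed into a fixed vector `fix` of the isometry `A` and a coboundary `cob - A cob`. -/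
structure LerchData (V : Type*) [NormedAddCommGroup V] [InnerProductSpace ℂ V] where
  /-- the isometry -/
  A : V ≃ₗᵢ[ℂ] V
  /-- the step length -/
  L : ℝ
  /-- the function -/
  ψ : ℂ → V
  /-- the fixed part of `ψ(0)` -/
  fix : V
  /-- the vector whose coboundary is the remaining part of `ψ(0)` -/
  cob : V
  L_pos : 0 < L
  map_fix : A fix = fix
  ψ_zero : ψ 0 = fix + (cob - A cob)
  diff_zero : DifferentiableAt ℂ ψ 0

namespace LerchData

variable (d : LerchData V)

/-- The `n`-th term `y^{-2w} ψ(1/y)`, without the power of the isometry. -/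
noncomputable def term (w y : ℂ) : V := y ^ (-2 * w) • d.ψ (1 / y)

/-- The approximate primitive: `main w y - A (main w (y + L))` agrees with `term w y` up to
`O(|y|^{-2 Re w - 1})`. -/
noncomputable def main (w y : ℂ) : V :=
  (y ^ (1 - 2 * w) / (d.L * (2 * w - 1))) • d.fix + y ^ (-2 * w) • d.cob

/-- The error of the approximate primitive. -/
noncomputable def err (w y : ℂ) : V := d.term w y - d.main w y + d.A (d.main w (y + d.L))

/-- The continuation of `∑_{n ≥ 1} (v + nL)^{-2w} Aⁿ ψ(1/(v + nL))` to `Re w > 0`, `w ≠ ½`. -/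
noncomputable def cont (w v : ℂ) : V :=
  d.A (d.main w (v + d.L)) + ∑' n : ℕ, (d.A ^ (n + 1)) (d.err w (v + (n + 1) * d.L))

theorem err_eq (w y : ℂ) : d.err w y = y ^ (-2 * w) • (d.ψ (1 / y) - d.ψ 0) +
    (y ^ (-2 * w) + ((y + d.L) ^ (1 - 2 * w) - y ^ (1 - 2 * w)) / (d.L * (2 * w - 1))) • d.fix +
    ((y + d.L) ^ (-2 * w) - y ^ (-2 * w)) • d.A d.cob := by
  simp only [err, term, main, map_add, map_smul, d.map_fix, d.ψ_zero]
  module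

/-- The bound of the error term, uniform in the exponent on bounded sets. -/
theorem exists_norm_err_le (ρ : ℝ) (hρ : 0 ≤ ρ) : ∃ C K : ℝ, 0 ≤ C ∧ 1 ≤ K ∧ ∀ w y : ℂ, 0 < w.re →
    w ≠ 1 / 2 → ‖w‖ ≤ ρ → 0 < y.re → K ≤ ‖y‖ → ‖d.err w y‖ ≤ C * ‖y‖ ^ (-2 * w.re - 1) := by
  obtain ⟨c, hc0, hc⟩ := d.diff_zero.isBigO_sub.exists_pos
  rw [IsBigOWith, Metric.eventually_nhds_iff] at hc
  obtain ⟨η, hη, hc⟩ := hc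
  have hL := d.L_pos
  have hF := argFactor_pos ρ
  refine ⟨argFactor ρ * c + 2 * ρ * argFactor ρ * d.L * (‖d.fix‖ + ‖d.cob‖), max 1 (2 / η),
    by positivity, le_max_left _ _, ?_⟩
  intro w y hw hw2 hwρ hy hK
  have hy0 : 0 < ‖y‖ := norm_pos_iff.mpr (ne_zero_of_re_pos hy)
  have h1 : ‖d.ψ (1 / y) - d.ψ 0‖ ≤ c * ‖y‖⁻¹ := by
    have := @hc (1 / y) (by
      rw [dist_zero_right, norm_div, norm_one, div_lt_iff₀ hy0]
      have h2 : 2 / η ≤ ‖y‖ := (le_max_right _ _).trans hK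
      rw [div_le_iff₀ hη] at h2
      linarith)
    simpa using this
  rw [err_eq]
  refine (norm_add₃_le).trans ?_
  rw [norm_smul, norm_smul, norm_smul, LinearIsometryEquiv.norm_map]
  have e1 := norm_cpow_neg_two_mul_le (y := y) hwρ
  have e2 := norm_cpow_add_sub_div_le hy hw hw2 hwρ hL
  have e3 := norm_cpow_sub_cpow_le hy hw hwρ (t := d.L) ⟨hL.le, le_rfl⟩
  calc _ ≤ (argFactor ρ * ‖y‖ ^ (-2 * w.re)) * (c * ‖y‖⁻¹) +
      (2 * ρ * argFactor ρ * d.L * ‖y‖ ^ (-2 * w.re - 1)) * ‖d.fix‖ +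
      (2 * ρ * argFactor ρ * d.L * ‖y‖ ^ (-2 * w.re - 1)) * ‖d.cob‖ := by gcongr
    _ = _ := by
      rw [Real.rpow_sub_one hy0.ne']
      ring

theorem le_norm_shift {v : ℂ} (hv : -d.L < v.re) (n : ℕ) : n * d.L ≤ ‖v + (n + 1) * d.L‖ := by
  refine le_trans ?_ (Complex.re_le_norm _)
  have : (v + (n + 1) * d.L).re = v.re + (n + 1) * d.L := by
    simp
  rw [this]
  linarith

theorem re_shift_pos {v : ℂ} (hv : -d.L < v.re) (n : ℕ) : 0 < (v + (n + 1) * d.L).re := by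
  have : (v + (n + 1) * d.L).re = v.re + (n + 1) * d.L := by
    simp
  rw [this]
  nlinarith [d.L_pos]

/-- A summable majorant of the tail of the error series that is uniform in both variables. -/
theorem exists_tail_bound {ρ σ : ℝ} (hρ : 0 ≤ ρ) (hσ : 0 < σ) : ∃ (N : ℕ) (u : ℕ → ℝ), Summable u ∧
    ∀ w v : ℂ, σ ≤ w.re → w ≠ 1 / 2 → ‖w‖ ≤ ρ → -d.L < v.re → ∀ n, N ≤ n →
      ‖d.err w (v + (n + 1) * d.L)‖ ≤ u n := by
  obtain ⟨C, K, hC, hK, h⟩ := d.exists_norm_err_le ρ hρ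
  have hL := d.L_pos
  obtain ⟨N, hN⟩ := exists_nat_ge (K / d.L)
  rw [div_le_iff₀ hL] at hN
  refine ⟨N, fun n => C * d.L ^ (-2 * σ - 1) * (n : ℝ) ^ (-2 * σ - 1), ?_, ?_⟩
  · exact (Real.summable_nat_rpow.mpr (by linarith)).mul_left _
  intro w v hw hw2 hwρ hv n hn
  have hnL : K ≤ n * d.L := hN.trans (by gcongr)
  have hnK := hnL.trans (d.le_norm_shift hv n)
  refine (h w _ (hσ.trans_le hw) hw2 hwρ (d.re_shift_pos hv n) hnK).trans ?_
  have h2 : d.L ^ (-2 * σ - 1) * (n : ℝ) ^ (-2 * σ - 1) = (n * d.L) ^ (-2 * σ - 1) := by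
    rw [Real.mul_rpow (by positivity) hL.le, mul_comm]
  beta_reduce
  rw [mul_assoc, h2]
  gcongr
  calc _ ≤ ‖v + (n + 1) * d.L‖ ^ (-2 * σ - 1) :=
        Real.rpow_le_rpow_of_exponent_le (hK.trans hnK) (by linarith)
    _ ≤ _ := Real.rpow_le_rpow_of_nonpos (by linarith) (d.le_norm_shift hv n) (by linarith)

theorem summable_err [CompleteSpace V] {w v : ℂ} (hw : 0 < w.re) (hw2 : w ≠ 1 / 2)
    (hv : -d.L < v.re) :
    Summable fun n : ℕ => (d.A ^ (n + 1)) (d.err w (v + (n + 1) * d.L)) := by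
  obtain ⟨N, u, hu, h⟩ := d.exists_tail_bound (norm_nonneg w) hw
  rw [← summable_nat_add_iff N]
  refine Summable.of_norm_bounded ((summable_nat_add_iff N).mpr hu) fun n => ?_
  rw [LinearIsometryEquiv.norm_map]
  exact h w v le_rfl hw2 le_rfl hv (n + N) (by omega)

/-- The functional equation of the continuation. -/
theorem cont_eq [CompleteSpace V] {w v : ℂ} (hw : 0 < w.re) (hw2 : w ≠ 1 / 2) (hv : -d.L < v.re) :
    d.cont w v = d.A (d.term w (v + d.L) + d.cont w (v + d.L)) := by
  have hs := d.summable_err hw hw2 hv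
  have h1 : ∀ n : ℕ, (d.A ^ (n + 1 + 1)) (d.err w (v + ((n + 1 : ℕ) + 1) * d.L)) =
      d.A ((d.A ^ (n + 1)) (d.err w (v + d.L + (n + 1) * d.L))) := by
    intro n
    rw [pow_succ' d.A (n + 1)]
    have : v + ((n + 1 : ℕ) + 1) * d.L = v + d.L + (n + 1) * d.L := by push_cast; ring
    rw [this]
    rfl
  unfold cont
  rw [hs.tsum_eq_zero_add]
  simp only [h1]
  have h2 : ∑' n : ℕ, d.A ((d.A ^ (n + 1)) (d.err w (v + d.L + (n + 1) * d.L))) =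
      d.A (∑' n : ℕ, (d.A ^ (n + 1)) (d.err w (v + d.L + (n + 1) * d.L))) :=
    (d.A.toContinuousLinearEquiv.map_tsum).symm
  rw [h2]
  simp only [err, map_add, map_sub, zero_add, pow_one, Nat.cast_zero, one_mul]
  abel

theorem differentiableAt_main_exponent {w y : ℂ} (hw2 : w ≠ 1 / 2) (hy : y ≠ 0) :
    DifferentiableAt ℂ (fun w => d.main w y) w := by
  have hL : (d.L : ℂ) ≠ 0 := by exact_mod_cast d.L_pos.ne'
  have h1 : (d.L : ℂ) * (2 * w - 1) ≠ 0 := by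
    refine mul_ne_zero hL fun h => hw2 ?_
    linear_combination (1 / 2 : ℂ) * h
  unfold main
  have h2 : DifferentiableAt ℂ (fun w : ℂ => y ^ (1 - 2 * w)) w :=
    DifferentiableAt.const_cpow (by fun_prop) (Or.inl hy)
  have h3 : DifferentiableAt ℂ (fun w : ℂ => y ^ (-2 * w)) w :=
    DifferentiableAt.const_cpow (by fun_prop) (Or.inl hy)
  exact ((h2.div (by fun_prop) h1).smul_const _).add (h3.smul_const _)

theorem differentiableAt_err_exponent {w y : ℂ} (hw2 : w ≠ 1 / 2) (hy : 0 < y.re) :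
    DifferentiableAt ℂ (fun w => d.err w y) w := by
  have hy0 := ne_zero_of_re_pos hy
  have hy1 : y + d.L ≠ 0 := ne_zero_of_re_pos (by simp; linarith [d.L_pos])
  have h3 : DifferentiableAt ℂ (fun w : ℂ => y ^ (-2 * w)) w :=
    DifferentiableAt.const_cpow (by fun_prop) (Or.inl hy0)
  unfold err term
  exact ((h3.smul_const _).sub (d.differentiableAt_main_exponent hw2 hy0)).add
    (d.A.differentiable.differentiableAt.comp w (d.differentiableAt_main_exponent hw2 hy1))

theorem differentiableAt_cont_exponent [CompleteSpace V] {w v : ℂ} (hw : 0 < w.re)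
    (hw2 : w ≠ 1 / 2) (hv : -d.L < v.re) : DifferentiableAt ℂ (fun w => d.cont w v) w := by
  have hv1 : v + d.L ≠ 0 := ne_zero_of_re_pos (by simp; linarith)
  unfold cont
  refine DifferentiableAt.add
    (d.A.differentiable.differentiableAt.comp w (d.differentiableAt_main_exponent hw2 hv1)) ?_
  have hd : ∀ w : ℂ, w ≠ 1 / 2 → ∀ n : ℕ,
      DifferentiableAt ℂ (fun w => (d.A ^ (n + 1)) (d.err w (v + (n + 1) * d.L))) w :=
    fun w hw n => (d.A ^ (n + 1)).differentiable.differentiableAt.comp w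
      (d.differentiableAt_err_exponent hw (d.re_shift_pos hv n))
  obtain ⟨N, u, hu, h⟩ := d.exists_tail_bound (ρ := ‖w‖ + 1) (σ := w.re / 2) (by positivity)
    (by linarith)
  refine differentiableAt_tsum_of_eventually (hd w hw2) N hu ?_
  have e1 : ∀ᶠ z : ℂ in 𝓝 w, w.re / 2 < z.re :=
    Complex.continuous_re.continuousAt.eventually (lt_mem_nhds (by linarith))
  have e2 : ∀ᶠ z : ℂ in 𝓝 w, ‖z‖ < ‖w‖ + 1 :=
    continuous_norm.continuousAt.eventually (gt_mem_nhds (by linarith))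
  filter_upwards [e1, e2, isOpen_ne.mem_nhds hw2] with z h1 h2 h3 n hn
  refine ⟨hd z h3 n, ?_⟩
  rw [LinearIsometryEquiv.norm_map]
  exact h z v h1.le h3 h2.le hv n hn

theorem differentiableAt_main {w y : ℂ} (hy : 0 < y.re) :
    DifferentiableAt ℂ (fun y => d.main w y) y := by
  have hy' : y ∈ Complex.slitPlane := Or.inl hy
  have h (z : ℂ) : DifferentiableAt ℂ (fun y : ℂ => y ^ z) y :=
    differentiableAt_id.cpow_const hy'
  unfold main
  exact (((h _).div_const _).smul_const _).add ((h _).smul_const _)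

theorem differentiableAt_err {w y : ℂ} (hy : 0 < y.re) (hψ : DifferentiableAt ℂ d.ψ (1 / y)) :
    DifferentiableAt ℂ (fun y => d.err w y) y := by
  have hy' : y ∈ Complex.slitPlane := Or.inl hy
  have h (z : ℂ) : DifferentiableAt ℂ (fun y : ℂ => y ^ z) y :=
    differentiableAt_id.cpow_const hy'
  have hdiv : DifferentiableAt ℂ (fun y : ℂ => 1 / y) y :=
    (differentiableAt_const _).div differentiableAt_id (ne_zero_of_re_pos hy)
  have h2 : DifferentiableAt ℂ (fun y => d.main w (y + d.L)) y :=
    DifferentiableAt.comp y (f := fun y => y + (d.L : ℂ)) (d.differentiableAt_main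
      (by simp; linarith [d.L_pos])) (by fun_prop)
  unfold err term
  exact (((h _).smul (DifferentiableAt.comp y hψ hdiv)).sub (d.differentiableAt_main hy)).add
    (d.A.differentiable.differentiableAt.comp y h2)

/-- Holomorphy of the continuation in the base point. -/
theorem differentiableAt_cont [CompleteSpace V] {w v : ℂ} (hw : 0 < w.re) (hw2 : w ≠ 1 / 2)
    (hv : -d.L < v.re)
    (hψ0 : ∀ᶠ y in 𝓝 0, DifferentiableAt ℂ d.ψ y)
    (hψ : ∀ n : ℕ, DifferentiableAt ℂ d.ψ (1 / (v + (n + 1) * d.L))) :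
    DifferentiableAt ℂ (fun v => d.cont w v) v := by
  have hL := d.L_pos
  unfold cont
  refine DifferentiableAt.add (d.A.differentiable.differentiableAt.comp v
    (DifferentiableAt.comp v (f := fun y => y + (d.L : ℂ)) (d.differentiableAt_main
      (by simp; linarith)) (by fun_prop))) ?_
  have hd : ∀ v : ℂ, -d.L < v.re → ∀ n : ℕ, DifferentiableAt ℂ d.ψ (1 / (v + (n + 1) * d.L)) →
      DifferentiableAt ℂ (fun v => (d.A ^ (n + 1)) (d.err w (v + (n + 1) * d.L))) v :=
    fun v hv n h => (d.A ^ (n + 1)).differentiable.differentiableAt.comp v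
      (DifferentiableAt.comp v (f := fun v => v + ((n : ℂ) + 1) * d.L)
        (d.differentiableAt_err (d.re_shift_pos hv n) h) (by fun_prop))
  obtain ⟨N, u, hu, h⟩ := d.exists_tail_bound (norm_nonneg w) hw
  rw [Metric.eventually_nhds_iff] at hψ0
  obtain ⟨η, hη, hψ0⟩ := hψ0
  obtain ⟨N', hN'⟩ := exists_nat_gt (1 / (η * d.L))
  rw [div_lt_iff₀ (by positivity)] at hN'
  refine differentiableAt_tsum_of_eventually (fun n => hd v hv n (hψ n)) (max N N') hu ?_
  filter_upwards [Complex.continuous_re.continuousAt.eventually (lt_mem_nhds hv)] with z hz n hn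
  refine ⟨hd z hz n (hψ0 ?_), ?_⟩
  · have h1 := d.le_norm_shift hz n
    have h2 : (N' : ℝ) ≤ n := by exact_mod_cast (le_max_right N N').trans hn
    have h3 : 1 < η * ‖z + (n + 1) * d.L‖ := by
      calc 1 < N' * (η * d.L) := hN'
        _ ≤ n * (η * d.L) := by gcongr
        _ = η * (n * d.L) := by ring
        _ ≤ _ := by gcongr
    rw [dist_zero_right, norm_div, norm_one,
      div_lt_iff₀ (norm_pos_iff.mpr (ne_zero_of_re_pos (d.re_shift_pos hz n)))]
    exact h3
  · rw [LinearIsometryEquiv.norm_map]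
    exact h w z le_rfl hw2 le_rfl hz n ((le_max_left _ _).trans hn)

/-- For `Re w > ½` the continuation is the sum of the series. -/
theorem hasSum_cont [CompleteSpace V] {w v : ℂ} (hw : 1 / 2 < w.re) (hv : -d.L < v.re) :
    HasSum (fun n : ℕ => (d.A ^ (n + 1)) (d.term w (v + (n + 1) * d.L))) (d.cont w v) := by
  have hL := d.L_pos
  have hw0 : 0 < w.re := by linarith
  have hw2 : w ≠ 1 / 2 := by
    rintro rfl
    norm_num at hw
  have hs := d.summable_err hw0 hw2 hv
  -- the series itself converges absolutely, as `ψ` is bounded near `0`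
  have hterm : Summable fun n : ℕ => (d.A ^ (n + 1)) (d.term w (v + (n + 1) * d.L)) := by
    obtain ⟨η, hη, hb⟩ := Metric.eventually_nhds_iff.mp
      (d.diff_zero.continuousAt.norm.eventually (gt_mem_nhds (lt_add_one ‖d.ψ 0‖)))
    obtain ⟨N, hN⟩ := exists_nat_gt (1 / (η * d.L))
    rw [div_lt_iff₀ (by positivity)] at hN
    rw [← summable_nat_add_iff (N + 1)]
    have hu : Summable fun n : ℕ =>
        argFactor ‖w‖ * d.L ^ (-2 * w.re) * (‖d.ψ 0‖ + 1) * (n : ℝ) ^ (-2 * w.re) :=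
      (Real.summable_nat_rpow.mpr (by linarith)).mul_left _
    refine Summable.of_norm_bounded ((summable_nat_add_iff (N + 1)).mpr hu) fun m => ?_
    rw [LinearIsometryEquiv.norm_map]
    generalize hn : m + (N + 1) = n
    have hn1 : (N : ℝ) ≤ n := by exact_mod_cast (by omega : N ≤ n)
    have hn0 : (0 : ℝ) < n := by exact_mod_cast (by omega : 0 < n)
    have hy := norm_pos_iff.mpr (ne_zero_of_re_pos (d.re_shift_pos hv n))
    have h1 := d.le_norm_shift hv n
    have h3 : 1 < η * ‖v + (n + 1) * d.L‖ := by
      calc 1 < N * (η * d.L) := hN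
        _ ≤ n * (η * d.L) := by gcongr
        _ = η * (n * d.L) := by ring
        _ ≤ _ := by gcongr
    have h4 := @hb (1 / (v + (n + 1) * d.L)) (by
      rw [dist_zero_right, norm_div, norm_one, div_lt_iff₀ hy]
      exact h3)
    rw [term, norm_smul]
    have h5 : d.L ^ (-2 * w.re) * (n : ℝ) ^ (-2 * w.re) = (n * d.L) ^ (-2 * w.re) := by
      rw [Real.mul_rpow (by positivity) hL.le, mul_comm]
    have hF := argFactor_pos ‖w‖
    calc _ ≤ (argFactor ‖w‖ * ‖v + (n + 1) * d.L‖ ^ (-2 * w.re)) * (‖d.ψ 0‖ + 1) := by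
          gcongr
          exact norm_cpow_neg_two_mul_le le_rfl
      _ ≤ (argFactor ‖w‖ * (n * d.L) ^ (-2 * w.re)) * (‖d.ψ 0‖ + 1) := by
          have := Real.rpow_le_rpow_of_nonpos (z := -2 * w.re) (by positivity) h1 (by linarith)
          gcongr
      _ = _ := by rw [← h5]; ring
  -- the remaining part telescopes
  have htel : ∀ n : ℕ, (d.A ^ (n + 1)) (d.term w (v + (n + 1) * d.L)) -
      (d.A ^ (n + 1)) (d.err w (v + (n + 1) * d.L)) =
      (d.A ^ (n + 1)) (d.main w (v + (n + 1) * d.L)) -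
      (d.A ^ (n + 1 + 1)) (d.main w (v + ((n + 1 : ℕ) + 1) * d.L)) := by
    intro n
    have h1 : v + ((n + 1 : ℕ) + 1) * d.L = v + (n + 1) * d.L + d.L := by push_cast; ring
    have h2 : (d.A ^ (n + 1 + 1)) (d.main w (v + ((n + 1 : ℕ) + 1) * d.L)) =
        (d.A ^ (n + 1)) (d.A (d.main w (v + (n + 1) * d.L + d.L))) := by
      rw [h1, pow_succ]
      rfl
    rw [h2, ← map_sub, ← map_sub, err]
    congr 1
    abel
  have hlim : Tendsto (fun n : ℕ => (d.A ^ (n + 1)) (d.main w (v + (n + 1) * d.L))) atTop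
      (𝓝 0) := by
    rw [tendsto_zero_iff_norm_tendsto_zero]
    simp only [LinearIsometryEquiv.norm_map]
    rw [← tendsto_zero_iff_norm_tendsto_zero]
    have hy : Tendsto (fun n : ℕ => ‖v + (n + 1) * d.L‖) atTop atTop :=
      tendsto_atTop_mono (d.le_norm_shift hv)
        (tendsto_natCast_atTop_atTop.atTop_mul_const hL)
    have hpow : ∀ z : ℂ, z.re < 0 →
        Tendsto (fun n : ℕ => (v + (n + 1) * d.L) ^ z) atTop (𝓝 0) := by
      intro z hz
      have h1 := ((tendsto_rpow_neg_atTop (neg_pos.mpr hz)).comp hy).mul_const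
        (Real.exp (Real.pi * ‖z‖))
      rw [zero_mul] at h1
      refine squeeze_zero_norm (fun n => ?_) h1
      simpa using norm_cpow_le_rpow_mul_exp (v + (n + 1) * d.L) z
    have h1 := ((hpow (1 - 2 * w) (by simp; linarith)).div_const (d.L * (2 * w - 1))).smul_const
      d.fix
    have h2 := (hpow (-2 * w) (by simp; linarith)).smul_const d.cob
    simpa [main] using h1.add h2
  have hdiff : HasSum (fun n : ℕ => (d.A ^ (n + 1)) (d.term w (v + (n + 1) * d.L)) -
      (d.A ^ (n + 1)) (d.err w (v + (n + 1) * d.L))) (d.A (d.main w (v + d.L))) := by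
    rw [(hterm.sub hs).hasSum_iff_tendsto_nat]
    simp only [htel]
    have h3 : ∀ N : ℕ, ∑ n ∈ Finset.range N, ((d.A ^ (n + 1)) (d.main w (v + (n + 1) * d.L)) -
        (d.A ^ (n + 1 + 1)) (d.main w (v + ((n + 1 : ℕ) + 1) * d.L))) =
        d.A (d.main w (v + d.L)) - (d.A ^ (N + 1)) (d.main w (v + (N + 1) * d.L)) := by
      intro N
      rw [Finset.sum_range_sub'
        (f := fun n : ℕ => (d.A ^ (n + 1)) (d.main w (v + (n + 1) * d.L)))]
      simp
    simp only [h3]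
    simpa using hlim.const_sub (d.A (d.main w (v + d.L)))
  have := hdiff.add hs.hasSum
  simpa [cont] using this

/-- The asymptotics of the continuation at `+∞`. -/
theorem cont_sub_isBigO {w : ℂ} (hw : 0 < w.re) (hw2 : w ≠ 1 / 2) :
    (fun v : ℝ => d.cont w v - d.A (d.main w (v + d.L))) =O[atTop]
      fun v : ℝ => v ^ (-2 * w.re) := by
  obtain ⟨C, K, hC, hK, h⟩ := d.exists_norm_err_le ‖w‖ (norm_nonneg w)
  have hL := d.L_pos
  refine IsBigO.of_bound (C * ((2 * w.re) * d.L)⁻¹) ?_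
  filter_upwards [eventually_ge_atTop K, eventually_gt_atTop 0] with v hvK hv
  have hterm : ∀ n : ℕ, ‖(d.A ^ (n + 1)) (d.err w (v + (n + 1) * d.L))‖ ≤
      C * (v + (n + 1) * d.L) ^ (-(2 * w.re) - 1) := by
    intro n
    rw [LinearIsometryEquiv.norm_map]
    have h1 : ‖(v + (n + 1) * d.L : ℂ)‖ = v + (n + 1) * d.L := by
      have h2 : (v + (n + 1) * d.L : ℂ) = ((v + (n + 1) * d.L : ℝ) : ℂ) := by push_cast; ring
      rw [h2, Complex.norm_real, Real.norm_eq_abs, abs_of_pos (by positivity)]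
    have := h w (v + (n + 1) * d.L) hw hw2 le_rfl
      (d.re_shift_pos (by simp; linarith) n) (by
        rw [h1]
        have : 0 ≤ (n + 1) * d.L := by positivity
        linarith)
    rw [h1] at this
    convert this using 3
    ring
  have hnn : ∀ n : ℕ, 0 ≤ C * (v + (n + 1) * d.L) ^ (-(2 * w.re) - 1) :=
    fun n => mul_nonneg hC (by positivity)
  have hpart : ∀ N : ℕ, ∑ n ∈ Finset.range N, C * (v + (n + 1) * d.L) ^ (-(2 * w.re) - 1) ≤
      C * (((2 * w.re) * d.L)⁻¹ * v ^ (-(2 * w.re))) := by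
    intro N
    rw [← Finset.mul_sum]
    exact mul_le_mul_of_nonneg_left (sum_rpow_le (by linarith) hL hv N) hC
  have hsum := summable_of_sum_range_le hnn hpart
  rw [cont, add_sub_cancel_left]
  refine (tsum_of_norm_bounded hsum.hasSum hterm).trans ?_
  refine (Real.tsum_le_of_sum_range_le hnn hpart).trans (le_of_eq ?_)
  rw [Real.norm_of_nonneg (by positivity), ← neg_mul]
  ring_nf

end LerchData

end

end HeckeTransfer

namespace HeckeTransfer

open Filter Asymptotics

/-! ### Uniqueness of continuations and of decaying solutions -/

theorem isPreconnected_puncturedHalfPlane : IsPreconnected {w : ℂ | 0 < w.re ∧ w ≠ 1 / 2} := by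
  have h1 : IsPreconnected {w : ℂ | 0 < w.re ∧ 0 < w.im} :=
    ((convex_halfSpace_re_gt 0).inter (convex_halfSpace_im_gt 0)).isPreconnected
  have h2 : IsPreconnected {w : ℂ | 0 < w.re ∧ w.im < 0} :=
    ((convex_halfSpace_re_gt 0).inter (convex_halfSpace_im_lt 0)).isPreconnected
  have h3 : IsPreconnected {w : ℂ | 1 / 2 < w.re} := (convex_halfSpace_re_gt _).isPreconnected
  have h4 : IsPreconnected {w : ℂ | 0 < w.re ∧ w.re < 1 / 2} :=
    ((convex_halfSpace_re_gt 0).inter (convex_halfSpace_re_lt (1 / 2))).isPreconnected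
  have h13 := h1.union' (t := {w : ℂ | 1 / 2 < w.re}) ⟨⟨1, 1⟩, by norm_num, by norm_num⟩ h3
  have h132 := h13.union' (t := {w : ℂ | 0 < w.re ∧ w.im < 0})
    ⟨⟨1, -1⟩, by norm_num, by norm_num⟩ h2
  have h := h132.union' (t := {w : ℂ | 0 < w.re ∧ w.re < 1 / 2})
    ⟨⟨1 / 4, 1⟩, by norm_num, by norm_num⟩ h4
  convert h using 1
  ext w
  simp only [Set.mem_ofPred_eq, Set.mem_union]
  constructor
  · rintro ⟨h0, h2⟩
    rcases lt_trichotomy w.im 0 with h | h | h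
    · exact Or.inl (Or.inr ⟨h0, h⟩)
    · rcases lt_trichotomy w.re (1 / 2) with h' | h' | h'
      · exact Or.inr ⟨h0, h'⟩
      · exact absurd (Complex.ext (by simpa using h') (by simpa using h)) h2
      · exact Or.inl (Or.inl (Or.inr h'))
    · exact Or.inl (Or.inl (Or.inl ⟨h0, h⟩))
  · rintro (((h | h) | h) | h) <;>
      refine ⟨by linarith, ?_⟩ <;> rintro rfl <;> norm_num at h

theorem isOpen_puncturedHalfPlane : IsOpen {w : ℂ | 0 < w.re ∧ w ≠ 1 / 2} :=
  (isOpen_lt continuous_const Complex.continuous_re).inter isOpen_ne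

section

variable {V : Type*} [NormedAddCommGroup V] [InnerProductSpace ℂ V]

/-- By the identity theorem, any continuation computes `contSum`. -/
theorem contSum_eq [CompleteSpace V] {a : ℂ → ℕ → V} {M : ℂ → V}
    (hM : ∀ w : ℂ, 0 < w.re → w ≠ 1 / 2 → DifferentiableAt ℂ M w)
    (ha : ∀ w : ℂ, 1 / 2 < w.re → HasSum (a w) (M w)) {s : ℂ} (hs0 : 0 < s.re) (hs : s ≠ 1 / 2) :
    contSum a s = M s := by
  have h : ∃ M : ℂ → V, DifferentiableOn ℂ M {w | 0 < w.re ∧ w ≠ 1 / 2} ∧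
      ∀ w : ℂ, 1 / 2 < w.re → HasSum (a w) (M w) :=
    ⟨M, fun w hw => (hM w hw.1 hw.2).differentiableWithinAt, ha⟩
  rw [contSum, dif_pos h]
  have hM' : DifferentiableOn ℂ M {w | 0 < w.re ∧ w ≠ 1 / 2} :=
    fun w hw => (hM w hw.1 hw.2).differentiableWithinAt
  have h1 := (h.choose_spec.1.analyticOnNhd
    isOpen_puncturedHalfPlane).eqOn_of_preconnected_of_eventuallyEq (z₀ := 1)
    (hM'.analyticOnNhd isOpen_puncturedHalfPlane)
    isPreconnected_puncturedHalfPlane (by norm_num) (by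
      have : ∀ᶠ w : ℂ in 𝓝 1, 1 / 2 < w.re :=
        Complex.continuous_re.continuousAt.eventually (lt_mem_nhds (by norm_num))
      filter_upwards [this] with w hw
      exact (h.choose_spec.2 w hw).unique (ha w hw))
  exact h1 ⟨hs0, hs⟩

/-- For `Re κ ≥ 0` and `κ ≠ 0` the sequence `(v + nL)^κ` does not converge: passing from `n` to
`⌊aⁿ⌋`-fold arguments multiplies the terms asymptotically by `a^κ`. -/
theorem not_tendsto_cpow {κ : ℂ} (hκ : κ ≠ 0) (hκ0 : 0 ≤ κ.re) {v L : ℝ} (hv : 0 < v)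
    (hL : 0 < L) (z : ℂ) :
    ¬ Tendsto (fun n : ℕ => ((v + n * L : ℝ) : ℂ) ^ κ) atTop (𝓝 z) := by
  intro h
  have hpos : ∀ n : ℕ, 0 < v + n * L := fun n => by positivity
  have hbig : Tendsto (fun n : ℕ => v + n * L) atTop atTop :=
    tendsto_atTop_add_const_left _ _ (tendsto_natCast_atTop_atTop.atTop_mul_const hL)
  -- the terms stay away from `0`
  have hz : z ≠ 0 := by
    rintro rfl
    have h1 := h.norm
    rw [norm_zero] at h1
    have h2 : ∀ᶠ n : ℕ in atTop, (1 : ℝ) ≤ ‖((v + n * L : ℝ) : ℂ) ^ κ‖ := by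
      filter_upwards [hbig.eventually_ge_atTop 1] with n hn
      rw [Complex.norm_cpow_eq_rpow_re_of_pos (hpos n)]
      exact Real.one_le_rpow hn hκ0
    have := ge_of_tendsto h1 h2
    norm_num at this
  have key : ∀ a : ℝ, 0 < a → (a : ℂ) ^ κ = 1 := by
    intro a ha
    have hm : Tendsto (fun n : ℕ => ⌊a * (n : ℝ)⌋₊) atTop atTop :=
      tendsto_nat_floor_atTop.comp (tendsto_natCast_atTop_atTop.const_mul_atTop ha)
    have h1 := h.comp hm
    have hq : Tendsto (fun n : ℕ => (v + ⌊a * (n : ℝ)⌋₊ * L) / (v + n * L)) atTop (𝓝 a) := by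
      have e1 : Tendsto (fun n : ℕ => (⌊a * (n : ℝ)⌋₊ : ℝ) / n) atTop (𝓝 a) :=
        (tendsto_nat_floor_mul_div_atTop ha.le).comp tendsto_natCast_atTop_atTop
      have e2 : Tendsto (fun n : ℕ => v / (n : ℝ)) atTop (𝓝 0) :=
        tendsto_const_div_atTop_nhds_zero_nat v
      have e3 := (e2.add (e1.mul_const L)).div (e2.add_const L) (by simpa using hL.ne')
      have e4 : (0 + a * L) / (0 + L) = a := by field_simp; ring
      rw [e4] at e3
      refine e3.congr' ?_
      filter_upwards [eventually_gt_atTop 0] with n hn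
      have hn' : (0 : ℝ) < n := by exact_mod_cast hn
      simp only [Pi.div_apply]
      field_simp
    have hq' : Tendsto (fun n : ℕ => (((v + ⌊a * (n : ℝ)⌋₊ * L) / (v + n * L) : ℝ) : ℂ) ^ κ)
        atTop (𝓝 ((a : ℂ) ^ κ)) := by
      have hc : ContinuousAt (fun x : ℂ => x ^ κ) (a : ℂ) :=
        continuousAt_cpow_const (Or.inl (by simpa using ha))
      exact hc.tendsto.comp ((Complex.continuous_ofReal.tendsto a).comp hq)
    have hq2 := hq'.mul h
    have he : ∀ n : ℕ, (((v + ⌊a * (n : ℝ)⌋₊ * L) / (v + n * L) : ℝ) : ℂ) ^ κ *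
        ((v + n * L : ℝ) : ℂ) ^ κ = ((v + ⌊a * (n : ℝ)⌋₊ * L : ℝ) : ℂ) ^ κ := by
      intro n
      rw [← Complex.mul_cpow_ofReal_nonneg (by have := hpos n; positivity) (hpos n).le,
        ← Complex.ofReal_mul, div_mul_cancel₀ _ (hpos n).ne']
    simp only [he] at hq2
    have := tendsto_nhds_unique hq2 h1
    exact mul_right_cancel₀ hz (by rw [this, one_mul])
  have hre : κ.re = 0 := by
    have h1 := congrArg norm (key 2 (by norm_num))
    rw [Complex.norm_cpow_eq_rpow_re_of_pos (by norm_num), norm_one] at h1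
    have h2 := congrArg Real.log h1
    rw [Real.log_rpow (by norm_num), Real.log_one] at h2
    exact (mul_eq_zero.mp h2).resolve_right (Real.log_pos (by norm_num)).ne'
  have him : κ.im ≠ 0 := fun him => hκ (Complex.ext hre him)
  -- for `a = exp(π / Im κ)` one has `a^κ = -1`
  have h2 := key (Real.exp (Real.pi / κ.im)) (Real.exp_pos _)
  rw [Complex.cpow_def_of_ne_zero (by simp), ← Complex.ofReal_log
    (Real.exp_pos _).le, Real.log_exp] at h2
  have h3 : ((Real.pi / κ.im : ℝ) : ℂ) * κ = Real.pi * Complex.I := by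
    apply Complex.ext
    · simp [hre]
    · simp
      field_simp
  rw [h3, Complex.exp_pi_mul_I] at h2
  norm_num at h2

theorem cpow_add_sub_cpow_isBigO {L : ℝ} (hL : 0 < L) {s : ℂ} (hs0 : 0 < s.re) :
    (fun v : ℝ => ((v + L : ℝ) : ℂ) ^ (1 - 2 * s) - (v : ℂ) ^ (1 - 2 * s)) =O[atTop]
      fun v : ℝ => v ^ (-2 * s.re) := by
  refine IsBigO.of_bound (‖1 - 2 * s‖ * argFactor ‖s‖ * L) ?_
  filter_upwards [eventually_gt_atTop 0] with v hv
  have h3 := norm_image_sub_le_of_norm_deriv_le_segment' (a := 0) (b := L)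
    (C := ‖1 - 2 * s‖ * argFactor ‖s‖ * v ^ (-2 * s.re))
    (fun x hx => hasDerivWithinAt_add_cpow (y := v) (by simpa using hv) (1 - 2 * s) hx.1
      (Set.Icc 0 L))
    (fun x hx => by
      rw [norm_mul, mul_assoc]
      refine mul_le_mul_of_nonneg_left ?_ (norm_nonneg _)
      have h4 : 1 - 2 * s - 1 = -2 * s := by ring
      rw [h4]
      refine (norm_cpow_neg_two_mul_le le_rfl).trans ?_
      refine mul_le_mul_of_nonneg_left ?_ (argFactor_pos ‖s‖).le
      have h5 : ‖(v : ℂ) + x‖ = v + x := by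
        rw [← Complex.ofReal_add, Complex.norm_real, Real.norm_of_nonneg]
        linarith [hx.1]
      rw [h5]
      exact Real.rpow_le_rpow_of_nonpos hv (by linarith [hx.1]) (by linarith)) L ⟨hL.le, le_rfl⟩
  rw [Real.norm_of_nonneg (by positivity)]
  simp only [Complex.ofReal_zero, add_zero, sub_zero] at h3
  rw [Complex.ofReal_add]
  refine h3.trans (le_of_eq ?_)
  ring

theorem rpow_add_isBigO {L : ℝ} (hL : 0 < L) {a : ℝ} (ha : a ≤ 0) :
    (fun v : ℝ => (v + L) ^ a) =O[atTop] fun v : ℝ => v ^ a := by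
  refine IsBigO.of_bound 1 ?_
  filter_upwards [eventually_gt_atTop 0] with v hv
  rw [Real.norm_of_nonneg (by positivity), Real.norm_of_nonneg (by positivity), one_mul]
  exact Real.rpow_le_rpow_of_nonpos hv (by linarith) ha

theorem smul_const_isBigO {f : ℝ → ℂ} {g : ℝ → ℝ} (h : f =O[atTop] g) (c : V) :
    (fun v => f v • c) =O[atTop] g := by
  have := h.smul (isBigO_refl (fun _ : ℝ => c) atTop)
  refine this.trans (IsBigO.of_bound ‖c‖ (Eventually.of_forall fun v => ?_))
  rw [norm_smul, mul_comm]

/-- The leading term of the continuation at `+∞`. -/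
theorem LerchData.exists_cont_asymp (d : LerchData V) {s : ℂ} (hs0 : 0 < s.re) (hs : s ≠ 1 / 2) :
    ∃ c : V, (fun v : ℝ => d.cont s v - (v : ℂ) ^ (1 - 2 * s) • c) =O[atTop]
      fun v : ℝ => v ^ (-2 * s.re) := by
  have hL := d.L_pos
  refine ⟨((d.L : ℂ) * (2 * s - 1))⁻¹ • d.fix, ?_⟩
  have h1 := d.cont_sub_isBigO hs0 hs
  have h2 := smul_const_isBigO (cpow_add_sub_cpow_isBigO hL hs0)
    (((d.L : ℂ) * (2 * s - 1))⁻¹ • d.fix)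
  have h3 : (fun v : ℝ => ((v + d.L : ℝ) : ℂ) ^ (-2 * s)) =O[atTop]
      fun v : ℝ => v ^ (-2 * s.re) := by
    refine IsBigO.trans ?_ (rpow_add_isBigO hL (a := -2 * s.re) (by linarith))
    refine IsBigO.of_bound 1 ?_
    filter_upwards [eventually_gt_atTop 0] with v hv
    rw [Complex.norm_cpow_eq_rpow_re_of_pos (by positivity), one_mul]
    simp [le_abs_self]
  refine ((h1.add h2).add (smul_const_isBigO h3 (d.A d.cob))).congr_left fun v => ?_
  simp only [LerchData.main, map_add, map_smul, d.map_fix, Complex.ofReal_add, div_eq_mul_inv]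
  module

/-- A solution of `p(v) = A p(v + L)` with `p(v) = v^{1-2s} c + O(v^{-2 Re s})` vanishes. -/
theorem eq_zero_of_shift_eq (A : V ≃ₗᵢ[ℂ] V) {L : ℝ} (hL : 0 < L) {s : ℂ} (hs0 : 0 < s.re)
    (hs : s ≠ 1 / 2) {p : ℝ → V} {v₀ : ℝ} (hv₀ : 0 ≤ v₀) (hp : ∀ v, v₀ < v → p v = A (p (v + L)))
    (c : V) (hc : (fun v : ℝ => p v - (v : ℂ) ^ (1 - 2 * s) • c) =O[atTop]
      fun v : ℝ => v ^ (-2 * s.re)) {v : ℝ} (hv : v₀ < v) : p v = 0 := by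
  have hshift : Tendsto (fun v : ℝ => v + L) atTop atTop :=
    tendsto_atTop_add_const_right _ _ tendsto_id
  -- first, `c` is fixed by `A`
  have hfix : A c = c := by
    have h1 : (fun v : ℝ => p (v + L) - ((v + L : ℝ) : ℂ) ^ (1 - 2 * s) • c) =O[atTop]
        fun v : ℝ => v ^ (-2 * s.re) := by
      exact (hc.comp_tendsto hshift).trans (rpow_add_isBigO hL (by linarith))
    have h2 := smul_const_isBigO (cpow_add_sub_cpow_isBigO hL hs0) c
    have h3 : (fun v : ℝ => (v : ℂ) ^ (1 - 2 * s) • (A c - c)) =O[atTop]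
        fun v : ℝ => v ^ (-2 * s.re) := by
      have hA : (fun v : ℝ => A (p (v + L) - ((v + L : ℝ) : ℂ) ^ (1 - 2 * s) • c) +
          A ((((v + L : ℝ) : ℂ) ^ (1 - 2 * s) - (v : ℂ) ^ (1 - 2 * s)) • c)) =O[atTop]
          fun v : ℝ => v ^ (-2 * s.re) := by
        refine IsBigO.add ?_ ?_
        · exact h1.norm_left.congr_left (fun v => (A.norm_map _).symm) |>.of_norm_left
        · exact h2.norm_left.congr_left (fun v => (A.norm_map _).symm) |>.of_norm_left
      refine (hc.sub hA).congr' ?_ EventuallyEq.rfl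
      filter_upwards [eventually_gt_atTop v₀] with v hv
      rw [hp v hv]
      simp only [map_sub, map_smul]
      module
    obtain ⟨C, hC⟩ := isBigO_iff.mp h3
    by_contra hne
    have hpos : 0 < ‖A c - c‖ := norm_pos_iff.mpr (sub_ne_zero.mpr hne)
    obtain ⟨v, hv1, hv2, hv3⟩ := (hC.and ((eventually_gt_atTop 0).and
      (eventually_gt_atTop (C / ‖A c - c‖)))).exists
    rw [norm_smul, Complex.norm_cpow_eq_rpow_re_of_pos hv2, Real.norm_of_nonneg (by positivity)]
      at hv1
    have h4 : (1 - 2 * s).re = -2 * s.re + 1 := by simp; ring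
    rw [h4, Real.rpow_add_one hv2.ne'] at hv1
    rw [div_lt_iff₀ hpos] at hv3
    have h5 : 0 < v ^ (-2 * s.re) := by positivity
    nlinarith
  have hvpos : 0 < v := hv₀.trans_lt hv
  have hApow : ∀ n : ℕ, (A ^ n) c = c := by
    intro n
    induction n with
    | zero => rfl
    | succ n ih =>
      rw [pow_succ]
      change (A ^ n) (A c) = c
      rw [hfix, ih]
  have hpn : ∀ n : ℕ, p v = (A ^ n) (p (v + n * L)) := by
    intro n
    induction n with
    | zero => simp
    | succ n ih =>
      rw [ih, hp (v + n * L) (hv.trans_le (by simp; positivity)), pow_succ]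
      have : v + n * L + L = v + (n + 1 : ℕ) * L := by push_cast; ring
      rw [this]
      rfl
  have hbig : Tendsto (fun n : ℕ => v + n * L) atTop atTop :=
    tendsto_atTop_add_const_left _ _ (tendsto_natCast_atTop_atTop.atTop_mul_const hL)
  have hdec : Tendsto (fun v : ℝ => v ^ (-2 * s.re)) atTop (𝓝 0) := by
    have := tendsto_rpow_neg_atTop (y := 2 * s.re) (by linarith)
    simpa using this
  have hlim : Tendsto (fun n : ℕ => ((v + n * L : ℝ) : ℂ) ^ (1 - 2 * s) • c) atTop (𝓝 (p v)) := by
    have h1 := (hc.comp_tendsto hbig).trans_tendsto (hdec.comp hbig)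
    have h2 : Tendsto (fun n : ℕ => p v - ((v + n * L : ℝ) : ℂ) ^ (1 - 2 * s) • c) atTop
        (𝓝 0) := by
      rw [tendsto_zero_iff_norm_tendsto_zero] at h1 ⊢
      refine h1.congr fun n => ?_
      simp only [Function.comp_apply]
      rw [← LinearIsometryEquiv.norm_map (A ^ n), map_sub, map_smul, hApow, ← hpn]
    simpa using h2.const_sub (p v)
  have hκ : 1 - 2 * s ≠ 0 := by
    intro h
    apply hs
    linear_combination (-1 / 2 : ℂ) * h
  rcases lt_or_ge (1 - 2 * s).re 0 with hneg | hnonneg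
  · have h1 : Tendsto (fun n : ℕ => ((v + n * L : ℝ) : ℂ) ^ (1 - 2 * s)) atTop (𝓝 0) := by
      rw [tendsto_zero_iff_norm_tendsto_zero]
      have h2 := (tendsto_rpow_neg_atTop (neg_pos.mpr hneg)).comp hbig
      refine h2.congr fun n => ?_
      rw [Complex.norm_cpow_eq_rpow_re_of_pos (by positivity), neg_neg]
      rfl
    have := tendsto_nhds_unique hlim (h1.smul_const c)
    rwa [zero_smul] at this
  · by_cases hc0 : c = 0
    · simp only [hc0, smul_zero] at hlim
      exact tendsto_nhds_unique hlim tendsto_const_nhds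
    · exfalso
      have h1 : Tendsto (fun n : ℕ => inner ℂ c (((v + n * L : ℝ) : ℂ) ^ (1 - 2 * s) • c)) atTop
          (𝓝 (inner ℂ c (p v))) := (tendsto_const_nhds (x := c)).inner hlim
      simp only [inner_smul_right] at h1
      have h0 : inner ℂ c c ≠ 0 := by simpa using hc0
      have h2 := h1.div_const (inner ℂ c c)
      simp only [mul_div_cancel_right₀ _ h0] at h2
      exact not_tendsto_cpow hκ hnonneg hvpos hL _ h2

/-! ### The operator `∑ α_s(g_{-1}ⁿ)` and its continuation -/

theorem mul_cpow_of_re_pos {x y : ℂ} (hx : 0 < x.re) (hy : 0 < y.re) (z : ℂ) :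
    (x * y) ^ z = x ^ z * y ^ z := by
  have hx0 := ne_zero_of_re_pos hx
  have hy0 := ne_zero_of_re_pos hy
  have h1 := abs_lt.mp (Complex.abs_arg_lt_pi_div_two_iff.mpr (Or.inl hx))
  have h2 := abs_lt.mp (Complex.abs_arg_lt_pi_div_two_iff.mpr (Or.inl hy))
  rw [Complex.cpow_def_of_ne_zero (mul_ne_zero hx0 hy0), Complex.cpow_def_of_ne_zero hx0,
    Complex.cpow_def_of_ne_zero hy0, ← Complex.exp_add, ← add_mul,
    (Complex.log_mul_eq_add_log_iff hx0 hy0).mpr ⟨by linarith, by linarith⟩]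

theorem re_one_div_pos {z : ℂ} (hz : 0 < z.re) : 0 < (1 / z).re := by
  rw [one_div, Complex.inv_re]
  exact div_pos hz (Complex.normSq_pos.mpr (ne_zero_of_re_pos hz))

variable {q : ℕ} [FiniteDimensional ℂ V]

/-- The continuation data of the operator `∑_{n ≥ 1} α_s(g_{-1}ⁿ)` applied to `ψ`. -/
noncomputable def lerchData (hq : 3 ≤ q) (χ : triangleGroup q →* (V ≃ₗᵢ[ℂ] V)) (ψ : ℂ → V)
    (hψ : DifferentiableAt ℂ ψ 0) : LerchData V where
  A := χ (elG q (-1))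
  L := ell q
  ψ := ψ
  fix := (exists_fixed_add_sub (χ (elG q (-1))) (ψ 0)).choose
  cob := (exists_fixed_add_sub (χ (elG q (-1))) (ψ 0)).choose_spec.choose
  L_pos := ell_pos hq
  map_fix := (exists_fixed_add_sub (χ (elG q (-1))) (ψ 0)).choose_spec.choose_spec.1
  ψ_zero := (exists_fixed_add_sub (χ (elG q (-1))) (ψ 0)).choose_spec.choose_spec.2
  diff_zero := hψ

variable {s : ℂ}

theorem fastMinus_Q_eq (hq : 3 ≤ q) (χ : triangleGroup q →* (V ≃ₗᵢ[ℂ] V)) {ψ : ℂ → V}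
    (hψ : DifferentiableAt ℂ ψ 0) (hs0 : 0 < s.re) (hs : s ≠ 1 / 2) {z : ℂ} (hz : -ell q < z.re) :
    fastMinus χ s (elQ q) ψ z = χ (elQ q) ((lerchData hq χ ψ hψ).cont s z) := by
  have : CompleteSpace V := FiniteDimensional.complete ℂ V
  have hz' : -(lerchData hq χ ψ hψ).L < z.re := hz
  refine contSum_eq (M := fun w => χ (elQ q) ((lerchData hq χ ψ hψ).cont w z))
    (fun w hw hw2 => (χ (elQ q)).differentiable.differentiableAt.comp w
      ((lerchData hq χ ψ hψ).differentiableAt_cont_exponent hw hw2 hz')) (fun w hw => ?_) hs0 hs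
  have h := ((lerchData hq χ ψ hψ).hasSum_cont hw hz').mapL
    ((χ (elQ q)).toContinuousLinearEquiv : V →L[ℂ] V)
  refine (congrArg (HasSum · _) (funext fun n => ?_)).mpr h
  have hre := (lerchData hq χ ψ hψ).re_shift_pos hz' n
  have hre' : 0 < 1 * z.re + ((n + 1 : ℕ) : ℝ) * ell q := by
    change 0 < (z + (n + 1) * (ell q : ℂ)).re at hre
    simpa using hre
  rw [alphaC_eq χ w (represents_Q_parabolic_inv hq (n + 1)) (by norm_num) ψ hre', map_mul, map_pow]
  simp [LerchData.term, lerchData]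

theorem fastMinus_one_eq (hq : 3 ≤ q) (χ : triangleGroup q →* (V ≃ₗᵢ[ℂ] V)) {ψ : ℂ → V}
    (hψ : DifferentiableAt ℂ ψ 0) (hs0 : 0 < s.re) (hs : s ≠ 1 / 2) {z : ℂ} (hz : 0 < z.re) :
    fastMinus χ s 1 ψ z = z ^ (-2 * s) • (lerchData hq χ ψ hψ).cont s (1 / z) := by
  have : CompleteSpace V := FiniteDimensional.complete ℂ V
  have hz0 := ne_zero_of_re_pos hz
  have hz1 := re_one_div_pos hz
  have hL := ell_pos hq
  have hz' : -(lerchData hq χ ψ hψ).L < (1 / z).re := by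
    change -ell q < _
    linarith
  refine contSum_eq (M := fun w => z ^ (-2 * w) • (lerchData hq χ ψ hψ).cont w (1 / z))
    (fun w hw hw2 => (DifferentiableAt.const_cpow (by fun_prop) (Or.inl hz0)).smul
      ((lerchData hq χ ψ hψ).differentiableAt_cont_exponent hw hw2 hz')) (fun w hw => ?_) hs0 hs
  have h := ((lerchData hq χ ψ hψ).hasSum_cont hw hz').const_smul (z ^ (-2 * w))
  refine (congrArg (HasSum · _) (funext fun n => ?_)).mpr h
  have hre : 0 < (1 / z + (n + 1) * (ell q : ℂ)).re :=
    (lerchData hq χ ψ hψ).re_shift_pos hz' n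
  have hre' : 0 < ((n + 1 : ℕ) : ℝ) * ell q * z.re + 1 := by positivity
  rw [alphaC_eq χ w (by rw [one_mul]; exact represents_parabolic_inv hq (n + 1)) (by norm_num) ψ
    hre', one_mul, map_pow]
  have e1 : z * (1 / z + (n + 1) * ell q) =
      ((((n + 1 : ℕ) : ℝ) * ell q : ℝ) : ℂ) * z + (1 : ℝ) := by
    push_cast
    field_simp
    ring
  rw [← e1, mul_cpow_of_re_pos hz hre]
  have e2 : ((1 : ℝ) * z + (0 : ℝ)) / (z * (1 / z + (n + 1) * ell q)) =
      1 / (1 / z + (n + 1) * ell q) := by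
    push_cast
    rw [one_mul, add_zero]
    rw [div_mul_cancel_left₀ hz0, one_div (1 / z + _)]
  rw [e2]
  simp [LerchData.term, lerchData, mul_smul]

/-- The relation `α_s(g_{-1})(1 + L_{-1}) = L_{-1}` and its composition with `α_s(Q)`, for a
function `φ` that equals `(1 + L_{-1})ψ` on `D₋₁`. -/
theorem alphaR_parabolic_eq_fastMinus (hq : 3 ≤ q) (χ : triangleGroup q →* (V ≃ₗᵢ[ℂ] V)) {ψ : ℂ → V}
    (hs0 : 0 < s.re) (hs : s ≠ 1 / 2)
    (hψ : DifferentiableAt ℂ ψ 0) {φ : ℝ → V}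
    (hφ : ∀ y ∈ dMinus q, φ y = ψ y + fastMinus χ s 1 ψ y) {x : ℝ} (hx : 0 < x) :
    alphaR χ s (elG q (-1)) φ x = fastMinus χ s 1 ψ x ∧
    alphaR χ s (elQ q * elG q (-1)) φ x = fastMinus χ s (elQ q) ψ x := by
  have : CompleteSpace V := FiniteDimensional.complete ℂ V
  have hL := ell_pos hq
  -- the value of `φ` at `1/(v+ℓ)`
  have key : ∀ v : ℝ, 0 < v → ((v + ell q : ℝ) : ℂ) ^ (-2 * s) •
      χ (elG q (-1)) (φ (1 / (v + ell q))) = (lerchData hq χ ψ hψ).cont s v := by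
    intro v hv
    have hvL : 0 < v + ell q := by positivity
    have hmem : 1 / (v + ell q) ∈ dMinus q :=
      ⟨by positivity, one_div_lt_one_div_of_lt hL (by linarith)⟩
    have h0 : ((v + ell q : ℝ) : ℂ) ≠ 0 := by exact_mod_cast hvL.ne'
    have h1 : ((v + ell q : ℝ) : ℂ) ^ (-2 * s) * ((1 / (v + ell q) : ℝ) : ℂ) ^ (-2 * s) = 1 := by
      rw [← Complex.mul_cpow_ofReal_nonneg hvL.le (by positivity), ← Complex.ofReal_mul,
        mul_one_div_cancel hvL.ne', Complex.ofReal_one, Complex.one_cpow]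
    rw [(lerchData hq χ ψ hψ).cont_eq hs0 hs (by change -ell q < _; simp; linarith), hφ _ hmem,
      fastMinus_one_eq hq χ hψ hs0 hs (by rw [Complex.ofReal_re]; positivity), ← map_smul,
      smul_add, smul_smul, h1, one_smul]
    simp [LerchData.term, lerchData]
  constructor
  · have hr := represents_parabolic_inv hq 1
    rw [pow_one] at hr
    rw [alphaR_eq χ s hr (by norm_num) φ (by positivity), fastMinus_one_eq hq χ hψ hs0 hs
      (by simpa using hx)]
    have h2 := key (1 / x) (by positivity)
    rw [Complex.ofReal_div, Complex.ofReal_one] at h2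
    rw [← h2, smul_smul, ← Complex.mul_cpow_ofReal_nonneg hx.le (by positivity)]
    have hxc : (x : ℂ) ≠ 0 := by exact_mod_cast hx.ne'
    have e1 : ((1 * ell q : ℝ) * x + (1 : ℝ) : ℂ) = x * ((1 / x + ell q : ℝ) : ℂ) := by
      push_cast
      field_simp
      ring
    have e2 : (1 * x + 0) / (1 * ell q * x + 1) = 1 / (1 / x + ell q) := by
      field_simp
      ring
    rw [Nat.cast_one, e1, e2]
  · have hr := represents_Q_parabolic_inv hq 1
    rw [pow_one] at hr
    rw [alphaR_eq χ s hr (by norm_num) φ (by push_cast; linarith), fastMinus_Q_eq hq χ hψ hs0 hs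
      (by simp; linarith), ← key x hx, map_mul, map_smul]
    have e1 : ((1 : ℝ) * x + (1 * ell q : ℝ) : ℂ) = ((x + ell q : ℝ) : ℂ) := by
      push_cast
      ring
    have e2 : (0 * x + 1) / (1 * x + 1 * ell q) = 1 / (x + ell q) := by simp
    rw [Nat.cast_one, e1, e2]
    rfl

theorem differentiableAt_fastMinus_Q (hq : 3 ≤ q) (χ : triangleGroup q →* (V ≃ₗᵢ[ℂ] V)) {ψ : ℂ → V}
    (hs0 : 0 < s.re) (hs : s ≠ 1 / 2) {z : ℂ}
    (hz : -ell q < z.re) (hψ0 : ∀ᶠ y in 𝓝 0, DifferentiableAt ℂ ψ y)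
    (hψ : ∀ n : ℕ, DifferentiableAt ℂ ψ (1 / (z + (n + 1) * ell q))) :
    DifferentiableAt ℂ (fastMinus χ s (elQ q) ψ) z := by
  have : CompleteSpace V := FiniteDimensional.complete ℂ V
  have h := (χ (elQ q)).differentiable.differentiableAt.comp z
    ((lerchData hq χ ψ hψ0.self_of_nhds).differentiableAt_cont hs0 hs hz hψ0 hψ)
  refine h.congr_of_eventuallyEq ?_
  filter_upwards [Complex.continuous_re.continuousAt.eventually (lt_mem_nhds hz)] with y hy
  exact fastMinus_Q_eq hq χ _ hs0 hs hy

theorem differentiableAt_fastMinus_one (hq : 3 ≤ q) (χ : triangleGroup q →* (V ≃ₗᵢ[ℂ] V))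
    {ψ : ℂ → V} (hs0 : 0 < s.re) (hs : s ≠ 1 / 2) {z : ℂ}
    (hz : 0 < z.re) (hψ0 : ∀ᶠ y in 𝓝 0, DifferentiableAt ℂ ψ y)
    (hψ : ∀ n : ℕ, DifferentiableAt ℂ ψ (1 / (1 / z + (n + 1) * ell q))) :
    DifferentiableAt ℂ (fastMinus χ s 1 ψ) z := by
  have : CompleteSpace V := FiniteDimensional.complete ℂ V
  have h1 := re_one_div_pos hz
  have hz' : -(lerchData hq χ ψ hψ0.self_of_nhds).L < (1 / z).re := by
    change -ell q < _
    linarith [ell_pos hq]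
  have h2 : DifferentiableAt ℂ (fun z : ℂ => 1 / z) z :=
    (differentiableAt_const _).div differentiableAt_id (ne_zero_of_re_pos hz)
  have h := (differentiableAt_id.cpow_const (c := -2 * s) (Or.inl hz)).smul
    (DifferentiableAt.comp z (f := fun z : ℂ => 1 / z)
    ((lerchData hq χ ψ hψ0.self_of_nhds).differentiableAt_cont hs0 hs hz' hψ0 hψ) h2)
  refine h.congr_of_eventuallyEq ?_
  filter_upwards [Complex.continuous_re.continuousAt.eventually (lt_mem_nhds hz)] with y hy
  exact fastMinus_one_eq hq χ _ hs0 hs hy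

/-- The asymptotics at `0⁺` of the continued operator. -/
theorem exists_fastMinus_one_asymp (hq : 3 ≤ q) (χ : triangleGroup q →* (V ≃ₗᵢ[ℂ] V)) {ψ : ℂ → V}
    (hs0 : 0 < s.re) (hs : s ≠ 1 / 2)
    (hψ : DifferentiableAt ℂ ψ 0) : ∃ c : V,
    (fun x : ℝ => fastMinus χ s 1 ψ x - x⁻¹ • c) =O[𝓝[>] 0] fun _ : ℝ => (1 : ℝ) := by
  obtain ⟨c, hc⟩ := (lerchData hq χ ψ hψ).exists_cont_asymp hs0 hs
  refine ⟨c, ?_⟩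
  obtain ⟨C, hC⟩ := isBigO_iff.mp (hc.comp_tendsto tendsto_inv_nhdsGT_zero)
  refine isBigO_iff.mpr ⟨C, ?_⟩
  filter_upwards [hC, self_mem_nhdsWithin] with x hx hx0
  have hx0' : 0 < x := hx0
  have hxc : (x : ℂ) ≠ 0 := by exact_mod_cast hx0'.ne'
  have h1 : x⁻¹ • c = (x : ℂ) ^ (-2 * s) • ((x⁻¹ : ℝ) : ℂ) ^ (1 - 2 * s) • c := by
    have e1 : ((x⁻¹ : ℝ) : ℂ) ^ (1 - 2 * s) = (x : ℂ) ^ (2 * s - 1) := by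
      rw [Complex.ofReal_inv, Complex.inv_cpow _ _ (by
        rw [Complex.arg_ofReal_of_nonneg hx0'.le]; exact Real.pi_pos.ne), ← Complex.cpow_neg]
      congr 1
      ring
    have e2 : -2 * s + (2 * s - 1) = -1 := by ring
    rw [e1, smul_smul, ← Complex.cpow_add _ _ hxc, e2, Complex.cpow_neg_one,
      ← Complex.ofReal_inv, Complex.coe_smul]
  rw [fastMinus_one_eq hq χ hψ hs0 hs (by simpa using hx0'), h1, ← smul_sub, norm_smul,
    Complex.norm_cpow_eq_rpow_re_of_pos hx0', norm_one, mul_one]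
  simp only [Function.comp_apply] at hx
  have h2 : (1 / x : ℂ) = ((x⁻¹ : ℝ) : ℂ) := by simp
  have h3 : (-2 * s).re = -2 * s.re := by simp
  rw [h2, h3]
  rw [Real.norm_of_nonneg (by positivity), Real.inv_rpow hx0'.le] at hx
  calc _ ≤ x ^ (-2 * s.re) * (C * (x ^ (-2 * s.re))⁻¹) := by gcongr
    _ = C := by
      have : x ^ (-2 * s.re) ≠ 0 := (by positivity : 0 < x ^ (-2 * s.re)).ne'
      field_simp

end

end HeckeTransfer

namespace HeckeTransfer

open Filter

/-! ### Lens-shaped complex neighbourhoods of real intervals -/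

/-- The lens over the real interval `(a, b)`: the intersection of two discs whose boundary circles
pass through `a` and `b` and meet the interval at an angle with cotangent `c`. Real Möbius
transformations map lenses to lenses with the same angle, so that their mapping properties can be
read off from the end points. -/
def lens (c a b : ℝ) : Set ℂ :=
  {z | z.im ^ 2 + c * (b - a) * |z.im| < (z.re - a) * (b - z.re)}

theorem isOpen_lens (c a b : ℝ) : IsOpen (lens c a b) :=
  isOpen_lt (by fun_prop) (by fun_prop)

theorem convex_lens {c a b : ℝ} (hc : 0 ≤ c) (hab : a < b) : Convex ℝ (lens c a b) := by
  intro z hz w hw α β hα hβ hαβ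
  simp only [lens, Set.mem_ofPred_eq] at hz hw ⊢
  have hk : 0 ≤ c * (b - a) := mul_nonneg hc (by linarith)
  have h1 : |(α • z + β • w).im| ≤ α * |z.im| + β * |w.im| := by
    have : (α • z + β • w).im = α * z.im + β * w.im := by simp
    rw [this]
    refine (abs_add_le _ _).trans ?_
    rw [abs_mul, abs_mul, abs_of_nonneg hα, abs_of_nonneg hβ]
  have h2 : (α • z + β • w).im = α * z.im + β * w.im := by simp
  have h3 : (α • z + β • w).re = α * z.re + β * w.re := by simp
  obtain rfl : β = 1 - α := by linarith
  have h4 := mul_le_mul_of_nonneg_left h1 hk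
  rw [h2] at h4
  rw [h2, h3]
  have h5 : α * (z.im ^ 2 + c * (b - a) * |z.im|) + (1 - α) * (w.im ^ 2 + c * (b - a) * |w.im|) <
      α * ((z.re - a) * (b - z.re)) + (1 - α) * ((w.re - a) * (b - w.re)) := by
    rcases hα.eq_or_lt with rfl | hα'
    · simpa using hw
    · have e1 := mul_lt_mul_of_pos_left hz hα'
      have e2 := mul_le_mul_of_nonneg_left hw.le hβ
      linarith
  have h6 : 0 ≤ α * (1 - α) * ((z.im - w.im) ^ 2 + (z.re - w.re) ^ 2) := by positivity
  nlinarith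

theorem closure_lens_subset (c a b : ℝ) : closure (lens c a b) ⊆
    {z | z.im ^ 2 + c * (b - a) * |z.im| ≤ (z.re - a) * (b - z.re)} :=
  closure_minimal (fun z hz => by
    simp only [lens, Set.mem_ofPred_eq] at hz ⊢
    exact hz.le) (isClosed_le (by fun_prop) (by fun_prop))

theorem mem_lens_ofReal {c a b x : ℝ} (hx : x ∈ Set.Ioo a b) : (x : ℂ) ∈ lens c a b := by
  simp only [lens, Set.mem_ofPred_eq, Complex.ofReal_im, Complex.ofReal_re]
  simp
  nlinarith [hx.1, hx.2, mul_pos (sub_pos.mpr hx.1) (sub_pos.mpr hx.2)]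

theorem bounds_of_mem_closure_lens {c a b : ℝ} (hc : 0 ≤ c) (hab : a < b) {z : ℂ}
    (hz : z ∈ closure (lens c a b)) : a ≤ z.re ∧ z.re ≤ b ∧ c * |z.im| ≤ b - a := by
  have h := closure_lens_subset c a b hz
  simp only [Set.mem_ofPred_eq] at h
  have h0 : 0 ≤ c * (b - a) * |z.im| := by
    have : 0 ≤ b - a := by linarith
    positivity
  have h1 : a ≤ z.re := by
    by_contra hlt
    push Not at hlt
    nlinarith [sq_nonneg z.im, mul_pos (sub_pos.mpr hlt) (sub_pos.mpr (hlt.trans hab))]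
  have h2 : z.re ≤ b := by
    by_contra hlt
    push Not at hlt
    nlinarith [sq_nonneg z.im, mul_pos (sub_pos.mpr hlt) (sub_pos.mpr (hab.trans hlt))]
  refine ⟨h1, h2, ?_⟩
  have h3 : (z.re - a) * (b - z.re) ≤ (b - a) * (b - a) := by
    apply mul_le_mul <;> linarith
  have h4 : (b - a) * (c * |z.im|) ≤ (b - a) * (b - a) := by nlinarith [sq_nonneg z.im]
  exact le_of_mul_le_mul_left h4 (by linarith)

/-- A (possibly degenerate or reversed) closed lens is contained in any open lens of the same angle
over an interval containing its end points. -/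
theorem mem_lens_of_le {c α β a b : ℝ} (hc : 0 ≤ c) (hα : α ∈ Set.Ioo a b) (hβ : β ∈ Set.Ioo a b)
    {z : ℂ} (hz : z.im ^ 2 + c * |β - α| * |z.im| ≤ (z.re - α) * (β - z.re)) :
    z ∈ lens c a b := by
  wlog h : α ≤ β generalizing α β
  · refine this hβ hα ?_ (le_of_not_ge h)
    rw [abs_sub_comm]
    linarith
  rw [abs_of_nonneg (by linarith)] at hz
  obtain ⟨hα1, hα2⟩ := hα
  obtain ⟨hβ1, hβ2⟩ := hβ
  simp only [lens, Set.mem_ofPred_eq]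
  rcases h.eq_or_lt with rfl | hlt
  · have h1 : z.im = 0 := by nlinarith [sq_nonneg z.im, sq_nonneg (z.re - α)]
    have h2 : z.re = α := by nlinarith [sq_nonneg z.im, sq_nonneg (z.re - α)]
    rw [h1, h2]
    simp
    nlinarith [mul_pos (sub_pos.mpr hα1) (sub_pos.mpr hα2)]
  have h0 : 0 ≤ c * (β - α) * |z.im| := by
    have : 0 ≤ β - α := by linarith
    positivity
  have h1 : α ≤ z.re := by
    by_contra hlt'
    push Not at hlt'
    nlinarith [sq_nonneg z.im, mul_pos (sub_pos.mpr hlt') (sub_pos.mpr (hlt'.trans hlt))]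
  have h2 : z.re ≤ β := by
    by_contra hlt'
    push Not at hlt'
    nlinarith [sq_nonneg z.im, mul_pos (sub_pos.mpr hlt') (sub_pos.mpr (hlt.trans hlt'))]
  have h3 : c * |z.im| ≤ z.re - α := by
    have : (β - α) * (c * |z.im|) ≤ (β - α) * (z.re - α) := by
      nlinarith [sq_nonneg z.im]
    exact le_of_mul_le_mul_left this (by linarith)
  have h4 : c * |z.im| ≤ β - z.re := by
    have : (β - α) * (c * |z.im|) ≤ (β - α) * (β - z.re) := by
      nlinarith [sq_nonneg z.im]
    exact le_of_mul_le_mul_left this (by linarith)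
  have h5 := mul_le_mul_of_nonneg_left h3 (sub_nonneg.mpr hβ2.le)
  have h6 := mul_le_mul_of_nonneg_left h4 (sub_nonneg.mpr hα1.le)
  have h7 := mul_pos (sub_pos.mpr hα1) (sub_pos.mpr hβ2)
  nlinarith

/-- Real Möbius transformations without pole on `[a, b]` map the closed lens over `(a, b)` into
the open lens over any interval containing the images of the end points. -/
theorem Represents.mapsTo_lens {g : PGL2} {p u r t : ℝ} (hg : Represents g !![p, u; r, t])
    (hdet : |p * t - u * r| = 1) {c a b a' b' : ℝ} (hc : 0 ≤ c) (hab : a < b)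
    (hea : 0 < r * a + t) (heb : 0 < r * b + t)
    (ha : (p * a + u) / (r * a + t) ∈ Set.Ioo a' b')
    (hb : (p * b + u) / (r * b + t) ∈ Set.Ioo a' b') :
    Set.MapsTo (act ℂ g) (closure (lens c a b)) (lens c a' b') := by
  intro z hz
  obtain ⟨h1, h2, -⟩ := bounds_of_mem_closure_lens hc hab hz
  have hz := closure_lens_subset c a b hz
  simp only [Set.mem_ofPred_eq] at hz
  refine mem_lens_of_le hc ha hb ?_
  rw [hg.act_eq]
  simp only [Complex.coe_algebraMap]
  obtain ⟨x, y⟩ := z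
  simp only at h1 h2 hz
  have hpos : 0 < r * x + t := by
    rcases le_total 0 r with hr | hr <;> nlinarith
  have hN : 0 < (r * x + t) ^ 2 + (r * y) ^ 2 := by positivity
  set N := (r * x + t) ^ 2 + (r * y) ^ 2 with hNdef
  have hsq : (p * t - u * r) ^ 2 = 1 := by rw [← sq_abs, hdet, one_pow]
  have hre : (((p : ℂ) * ⟨x, y⟩ + u) / (r * ⟨x, y⟩ + t)).re =
      ((p * x + u) * (r * x + t) + p * r * y ^ 2) / N := by
    rw [Complex.div_re, Complex.normSq_apply]
    simp
    rw [hNdef, ← add_div]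
    congr 1 <;> ring
  have him : (((p : ℂ) * ⟨x, y⟩ + u) / (r * ⟨x, y⟩ + t)).im = (p * t - u * r) * y / N := by
    rw [Complex.div_im, Complex.normSq_apply]
    simp
    rw [hNdef, ← sub_div]
    congr 1 <;> ring
  rw [hre, him]
  have hd : (p * b + u) / (r * b + t) - (p * a + u) / (r * a + t) =
      (p * t - u * r) * ((b - a) / ((r * a + t) * (r * b + t))) := by
    rw [div_sub_div _ _ heb.ne' hea.ne', mul_div_assoc']
    congr 1 <;> ring
  have hd' : |(p * b + u) / (r * b + t) - (p * a + u) / (r * a + t)| =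
      (b - a) / ((r * a + t) * (r * b + t)) := by
    rw [hd, abs_mul, hdet, one_mul, abs_of_nonneg]
    have : 0 ≤ b - a := by linarith
    positivity
  have hy : |(p * t - u * r) * y / N| = |y| / N := by
    rw [abs_div, abs_mul, hdet, one_mul, abs_of_pos hN]
  have key : (((p * x + u) * (r * x + t) + p * r * y ^ 2) / N - (p * a + u) / (r * a + t)) *
      ((p * b + u) / (r * b + t) - ((p * x + u) * (r * x + t) + p * r * y ^ 2) / N) -
      ((p * t - u * r) * y / N) ^ 2 =
      (p * t - u * r) ^ 2 * (((x - a) * (b - x) - y ^ 2) / (N * ((r * a + t) * (r * b + t)))) := by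
    have hN' : N ≠ 0 := hN.ne'
    have e1 : ((p * x + u) * (r * x + t) + p * r * y ^ 2) / N - (p * a + u) / (r * a + t) =
        (p * t - u * r) * ((x - a) * (r * x + t) + r * y ^ 2) / (N * (r * a + t)) := by
      rw [div_sub_div _ _ hN' hea.ne', hNdef]
      congr 1
      ring
    have e2 : (p * b + u) / (r * b + t) - ((p * x + u) * (r * x + t) + p * r * y ^ 2) / N =
        (p * t - u * r) * ((b - x) * (r * x + t) - r * y ^ 2) / (N * (r * b + t)) := by
      rw [div_sub_div _ _ heb.ne' hN', hNdef]
      congr 1 <;> ring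
    rw [e1, e2]
    have e3 : ((x - a) * (r * x + t) + r * y ^ 2) * ((b - x) * (r * x + t) - r * y ^ 2) -
        y ^ 2 * ((r * a + t) * (r * b + t)) = ((x - a) * (b - x) - y ^ 2) * N := by
      rw [hNdef]
      ring
    have e4 := hea.ne'
    have e5 := heb.ne'
    field_simp
    linear_combination e3
  rw [hsq, one_mul] at key
  rw [hd', hy]
  have hfin : c * ((b - a) / ((r * a + t) * (r * b + t))) * (|y| / N) =
      c * (b - a) * |y| / (N * ((r * a + t) * (r * b + t))) := by
    field_simp
  rw [hfin]
  have h5 : c * (b - a) * |y| / (N * ((r * a + t) * (r * b + t))) ≤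
      ((x - a) * (b - x) - y ^ 2) / (N * ((r * a + t) * (r * b + t))) := by
    gcongr
    linarith
  linarith

/-- A neighbourhood of a compact real interval contains a rectangle around it. -/
theorem exists_rectangle_subset {W : Set ℂ} (hW : IsOpen W) {a b : ℝ}
    (h : ∀ x ∈ Set.Icc a b, (x : ℂ) ∈ W) : ∃ η > 0, ∀ z : ℂ, a - η ≤ z.re → z.re ≤ b + η →
      |z.im| ≤ η → a ≤ b → z ∈ W := by
  have hK : IsCompact ((fun x : ℝ => (x : ℂ)) '' Set.Icc a b) :=
    isCompact_Icc.image Complex.continuous_ofReal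
  obtain ⟨δ, hδ, hsub⟩ := hK.exists_thickening_subset_open hW (by
    rintro _ ⟨x, hx, rfl⟩
    exact h x hx)
  refine ⟨δ / 3, by positivity, fun z h1 h2 h3 hab => hsub ?_⟩
  rw [Metric.mem_thickening_iff]
  refine ⟨_, ⟨max a (min b z.re), ⟨le_max_left _ _, max_le hab (min_le_left _ _)⟩, rfl⟩, ?_⟩
  have h4 : |z.re - max a (min b z.re)| ≤ δ / 3 := by
    rw [abs_le]
    rcases le_total b z.re with h | h
    · rw [min_eq_left h, max_eq_right hab]
      constructor <;> linarith
    · rw [min_eq_right h]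
      rcases le_total a z.re with h' | h'
      · rw [max_eq_right h']
        constructor <;> linarith
      · rw [max_eq_left h']
        constructor <;> linarith
  rw [Complex.dist_eq]
  refine (Complex.norm_le_abs_re_add_abs_im _).trans_lt ?_
  simp only [Complex.sub_re, Complex.ofReal_re, Complex.sub_im, Complex.ofReal_im, sub_zero]
  linarith

/-! ### The real dynamics of the group elements -/

variable {q : ℕ}

/-- The right end point `s_K / s_{K+1}`, `K = ⌊q/2⌋`, of the range of the elements acting
from `f₀`; it equals `1` for odd `q`. -/
noncomputable def topEnd (q : ℕ) : ℝ := sn q (q / 2 : ℕ) / sn q ((q / 2 : ℕ) + 1)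

theorem sn_pos_of_le (hq : 3 ≤ q) {k : ℕ} (hk1 : 1 ≤ k) (hk : k ≤ q / 2) : 0 < sn q k :=
  sn_pos hq (by omega) (by omega)

theorem sn_succ_pos_of_le (hq : 3 ≤ q) {k : ℕ} (hk : k ≤ q / 2) : 0 < sn q (k + 1) :=
  sn_pos hq (by omega) (by omega)

theorem sn_pred_pos_of_le (hq : 3 ≤ q) {k : ℕ} (hk2 : 2 ≤ k) (hk : k ≤ q / 2) :
    0 < sn q (k - 1) :=
  sn_pos hq (by omega) (by omega)

theorem sn_ratio_mono (hq : 3 ≤ q) {i j : ℕ} (hij : i ≤ j) (hj : j ≤ q / 2) :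
    sn q i / sn q (i + 1) ≤ sn q j / sn q (j + 1) := by
  induction j, hij using Nat.le_induction with
  | base => exact le_rfl
  | succ j hij ih =>
    refine (ih (by omega)).trans ?_
    have h1 := sn_succ_pos_of_le hq (k := j) (by omega)
    have h2 := sn_succ_pos_of_le hq hj
    have h3 := sn_det hq (j + 1)
    push_cast at h2 ⊢
    rw [add_sub_cancel_right] at h3
    rw [div_le_div_iff₀ h1 h2]
    linarith

theorem one_div_ell_le_ratio (hq : 3 ≤ q) {k : ℕ} (hk2 : 2 ≤ k) (hk : k ≤ q / 2) :
    1 / ell q ≤ sn q (k - 1) / sn q k := by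
  have h := sn_ratio_mono hq (i := 1) (j := k - 1) (by omega) (by omega)
  rw [Nat.cast_sub (by omega : 1 ≤ k)] at h
  push_cast at h
  rw [sub_add_cancel, sn_one hq] at h
  norm_num at h
  rwa [sn_two hq, ← one_div] at h

theorem ratio_le_topEnd (hq : 3 ≤ q) {k : ℕ} (hk : k ≤ q / 2) :
    sn q k / sn q (k + 1) ≤ topEnd q :=
  sn_ratio_mono hq hk le_rfl

theorem one_div_ell_le_topEnd (hq : 3 ≤ q) : 1 / ell q ≤ topEnd q := by
  have := ratio_le_topEnd hq (k := 1) (by omega)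
  rw [Nat.cast_one, sn_one hq] at this
  norm_num at this
  rwa [sn_two hq, ← one_div] at this

theorem one_div_ell_lt_one (hq : 3 ≤ q) (hq3 : q ≠ 3) : 1 / ell q < 1 := by
  rw [div_lt_one (ell_pos hq)]
  exact one_lt_ell hq hq3

theorem topEnd_of_odd (hq : 3 ≤ q) (h : ¬ Even q) : topEnd q = 1 := by
  have h1 : sn q ((q / 2 : ℕ) + 1) = sn q (q / 2 : ℕ) := by
    rw [← sn_sub hq]
    congr 1
    rw [Nat.not_even_iff] at h
    omega
  rw [topEnd, h1, div_self (sn_pos_of_le hq (by omega) le_rfl).ne']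

theorem mobius_mem_Ioo {a b c : ℝ} (hb : 0 < b) (hc : 0 < c)
    (hdet : b * b - a * c = 1) {x : ℝ} (hx : 0 < x) :
    (b * x + a) / (c * x + b) ∈ Set.Ioo (a / b) (b / c) ∧
    (a * x + b) / (b * x + c) ∈ Set.Ioo (a / b) (b / c) := by
  refine ⟨⟨?_, ?_⟩, ?_, ?_⟩ <;> rw [div_lt_div_iff₀ (by positivity) (by positivity)] <;> nlinarith

/-- The values of the actions of `g_{-k}` and `Q g_{-k}` on the positive half line. The interval is
`(0, 1/ℓ)` for `k = 1` and is contained in `(1/ℓ, s_K/s_{K+1})` for `k ≥ 2`. -/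
theorem ratio_mem_Ioo (hq : 3 ≤ q) {k : ℕ} (hk1 : 1 ≤ k) (hk : k ≤ q / 2) {x : ℝ} (hx : 0 < x) :
    (sn q k * x + sn q (k - 1)) / (sn q (k + 1) * x + sn q k) ∈
      Set.Ioo (sn q (k - 1) / sn q k) (sn q k / sn q (k + 1)) ∧
    (sn q (k - 1) * x + sn q k) / (sn q k * x + sn q (k + 1)) ∈
      Set.Ioo (sn q (k - 1) / sn q k) (sn q k / sn q (k + 1)) :=
  mobius_mem_Ioo (sn_pos_of_le hq hk1 hk)
    (sn_succ_pos_of_le hq hk) (sn_det hq k) hx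

theorem abs_sn_det (hq : 3 ≤ q) (k : ℤ) : |sn q k * sn q k - sn q (k - 1) * sn q (k + 1)| = 1 := by
  rw [sn_det hq, abs_one]

theorem abs_sn_det' (hq : 3 ≤ q) (k : ℤ) : |sn q (k - 1) * sn q (k + 1) - sn q k * sn q k| = 1 := by
  rw [abs_sub_comm, abs_sn_det hq]

theorem mem_zeroElements_iff (hq : 3 ≤ q) {g : triangleGroup q} : g ∈ zeroElements q ↔
    ∃ k : ℕ, 2 ≤ k ∧ k ≤ q / 2 ∧ (g = gel q k ∨ g = elQ q * gel q k) := by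
  unfold zeroElements gel numM
  constructor
  · rintro ⟨h, hh, ⟨k, hk2, hk, rfl⟩ | ⟨he, rfl⟩⟩
    · refine ⟨k, hk2, by omega, ?_⟩
      rw [if_neg (by omega)]
      rcases hh with rfl | rfl <;> simp
    · have := Nat.even_iff.mp he
      refine ⟨q / 2, by omega, le_rfl, ?_⟩
      rw [if_pos (by omega)]
      rcases hh with rfl | rfl <;> simp
  · rintro ⟨k, hk2, hk, hg⟩
    have : ∃ h : triangleGroup q, (h = 1 ∨ h = elQ q) ∧
        g = h * (if 2 * k = q then elG q k else elG q (-k)) := by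
      rcases hg with rfl | rfl
      · exact ⟨1, Or.inl rfl, (one_mul _).symm⟩
      · exact ⟨_, Or.inr rfl, rfl⟩
    obtain ⟨h, hh, rfl⟩ := this
    refine ⟨h, hh, ?_⟩
    split_ifs with h2
    · right
      refine ⟨⟨k, by omega⟩, ?_⟩
      have : q / 2 = k := by omega
      rw [this]
    · left
      exact ⟨k, hk2, by omega, rfl⟩

theorem zeroElements_three : zeroElements 3 = ∅ := by
  ext g
  rw [mem_zeroElements_iff le_rfl]
  simp only [Set.mem_empty_iff_false, iff_false]
  rintro ⟨k, h1, h2, -⟩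
  omega

end HeckeTransfer

namespace HeckeTransfer

open Filter

/-! ### Admissible pairs of neighbourhoods -/

variable {q : ℕ}

/-- There are admissible pairs inside arbitrary neighbourhoods of `[1/ℓ, s_K/s_{K+1}]` and
`[0, 1/ℓ]`, namely pairs of thin lenses. Only the points near `0` are mapped close to end points of
the other interval, so it suffices to let `E₋₁` exceed `0` much less than the other end points. -/
theorem exists_admissiblePair (hq : 3 ≤ q) {W₀ W₁ : Set ℂ} (hW₀ : IsOpen W₀) (hW₁ : IsOpen W₁)
    (h₀ : q ≠ 3 → ∀ x ∈ Set.Icc (1 / ell q) (topEnd q), (x : ℂ) ∈ W₀)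
    (h₁ : ∀ x ∈ Set.Icc 0 (1 / ell q), (x : ℂ) ∈ W₁) :
    ∃ E : AdmissiblePair q, closure E.zero ⊆ W₀ ∧ closure E.minus ⊆ W₁ ∧
      (q = 3 → E.zero = ∅) := by
  have hL := ell_pos hq
  have hL' : 0 < 1 / ell q := by positivity
  have htop := one_div_ell_le_topEnd hq
  obtain ⟨η₁, hη₁, hrect₁⟩ := exists_rectangle_subset hW₁ h₁
  obtain ⟨η₀, hη₀, hrect₀⟩ : ∃ η > 0, q ≠ 3 → ∀ z : ℂ, 1 / ell q - η ≤ z.re →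
      z.re ≤ topEnd q + η → |z.im| ≤ η → 1 / ell q ≤ topEnd q → z ∈ W₀ := by
    by_cases hq3 : q = 3
    · exact ⟨1, one_pos, fun h => absurd hq3 h⟩
    · obtain ⟨η, hη, h⟩ := exists_rectangle_subset hW₀ (h₀ hq3)
      exact ⟨η, hη, fun _ => h⟩
  obtain ⟨δ, hδ, hδ0, hδ1, hδL⟩ : ∃ δ > 0, δ ≤ η₀ ∧ δ ≤ η₁ ∧ δ < 1 / ell q := by
    refine ⟨min (min η₀ η₁) (1 / ell q / 2), by positivity, ?_, ?_, ?_⟩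
    · exact (min_le_left _ _).trans (min_le_left _ _)
    · exact (min_le_left _ _).trans (min_le_right _ _)
    · exact (min_le_right _ _).trans_lt (half_lt_self hL')
  -- the conditions on the left end point `x = -ρ` hold for `x = 0`
  have hcont : ∀ k ∈ Finset.Icc 2 (q / 2), ∀ᶠ x : ℝ in 𝓝 0,
      (0 < sn q (k + 1) * x + sn q k ∧ 0 < sn q k * x + sn q (k + 1)) ∧
      (sn q k * x + sn q (k - 1)) / (sn q (k + 1) * x + sn q k) ∈
        Set.Ioo (1 / ell q - δ) (topEnd q + δ) ∧
      (sn q (k - 1) * x + sn q k) / (sn q k * x + sn q (k + 1)) ∈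
        Set.Ioo (1 / ell q - δ) (topEnd q + δ) := by
    intro k hk
    rw [Finset.mem_Icc] at hk
    have p0 := sn_pos_of_le hq (k := k) (by omega) hk.2
    have p1 := sn_succ_pos_of_le hq hk.2
    have r0 := one_div_ell_le_ratio hq hk.1 hk.2
    have r1 := ratio_le_topEnd hq hk.2
    have r2 : sn q (k - 1) / sn q k < sn q k / sn q (k + 1) :=
      (ratio_mem_Ioo hq (by omega) hk.2 one_pos).1.1.trans
        (ratio_mem_Ioo hq (by omega) hk.2 one_pos).1.2
    have c1 : ContinuousAt (fun x : ℝ => sn q (k + 1) * x + sn q k) 0 := by fun_prop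
    have c2 : ContinuousAt (fun x : ℝ => sn q k * x + sn q (k + 1)) 0 := by fun_prop
    have c3 : ContinuousAt
        (fun x : ℝ => (sn q k * x + sn q (k - 1)) / (sn q (k + 1) * x + sn q k)) 0 :=
      ContinuousAt.div (by fun_prop) c1 (by simpa using p0.ne')
    have c4 : ContinuousAt
        (fun x : ℝ => (sn q (k - 1) * x + sn q k) / (sn q k * x + sn q (k + 1))) 0 :=
      ContinuousAt.div (by fun_prop) c2 (by simpa using p1.ne')
    refine ((c1.eventually (lt_mem_nhds (by simpa using p0))).and
      (c2.eventually (lt_mem_nhds (by simpa using p1)))).and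
      ((c3.eventually (Ioo_mem_nhds ?_ ?_)).and (c4.eventually (Ioo_mem_nhds ?_ ?_))) <;>
    simp only [mul_zero, zero_add] <;> linarith
  have hc1 : ∀ᶠ x : ℝ in 𝓝 0, 1 / (x + ell q) < 1 / ell q + δ := by
    have : ContinuousAt (fun x : ℝ => 1 / (x + ell q)) 0 :=
      ContinuousAt.div (by fun_prop) (by fun_prop) (by simpa using hL.ne')
    exact this.eventually (gt_mem_nhds (by simpa using hδ))
  have hall := ((eventually_all_finset _).mpr hcont).and (hc1.and
    ((lt_mem_nhds (by linarith : -δ < 0)).and (lt_mem_nhds (by linarith : -(ell q) < 0))))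
  obtain ⟨x₀, ⟨hx₀k, hx₀1, hx₀δ, hx₀L⟩, hx₀⟩ :=
    ((hall.filter_mono nhdsWithin_le_nhds).and (self_mem_nhdsWithin (s := Set.Iio (0 : ℝ)))).exists
  replace hx₀ : x₀ < 0 := hx₀
  set β := 1 / ell q + δ with hβ
  set γ := 1 / ell q - δ with hγ
  set τ := topEnd q + δ with hτ
  set c := (topEnd q + 1 / ell q + 4 * δ) / δ with hcdef
  have hc : 0 < c := div_pos (by linarith) hδ
  have hxβ : x₀ < β := by linarith
  have hγτ : γ < τ := by linarith
  have hγ0 : 0 < γ := by linarith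
  have him : ∀ y w : ℝ, c * |y| ≤ w → w ≤ topEnd q + 1 / ell q + 4 * δ → |y| ≤ δ := by
    intro y w h1 h2
    have h3 : c * |y| ≤ c * δ := by
      refine (h1.trans h2).trans (le_of_eq ?_)
      rw [hcdef, div_mul_cancel₀ _ hδ.ne']
    exact le_of_mul_le_mul_left h3 hc
  -- all relevant points are mapped into `(γ, τ)` by the elements acting from `f₀`
  have hzero : ∀ k : ℕ, 2 ≤ k → k ≤ q / 2 → ∀ x : ℝ, x = x₀ ∨ 0 < x →
      (0 < sn q (k + 1) * x + sn q k ∧ 0 < sn q k * x + sn q (k + 1)) ∧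
      (sn q k * x + sn q (k - 1)) / (sn q (k + 1) * x + sn q k) ∈ Set.Ioo γ τ ∧
      (sn q (k - 1) * x + sn q k) / (sn q k * x + sn q (k + 1)) ∈ Set.Ioo γ τ := by
    rintro k hk2 hk x (rfl | hx)
    · exact hx₀k k (Finset.mem_Icc.mpr ⟨hk2, hk⟩)
    · have p0 := sn_pos_of_le hq (k := k) (by omega) hk
      have p1 := sn_succ_pos_of_le hq hk
      have r0 := one_div_ell_le_ratio hq hk2 hk
      have r1 := ratio_le_topEnd hq hk
      obtain ⟨h1, h2⟩ := ratio_mem_Ioo hq (by omega) hk hx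
      exact ⟨⟨by positivity, by positivity⟩, ⟨by linarith [h1.1], by linarith [h1.2]⟩,
        ⟨by linarith [h2.1], by linarith [h2.2]⟩⟩
  have hzero' : ∀ g ∈ zeroElements q, ∀ a b : ℝ, a < b → (a = x₀ ∨ 0 < a) → (b = x₀ ∨ 0 < b) →
      Set.MapsTo (act ℂ ((g⁻¹ : triangleGroup q) : PGL2)) (closure (lens c a b)) (lens c γ τ) := by
    intro g hg a b hab ha hb
    obtain ⟨k, hk2, hk, rfl | rfl⟩ := (mem_zeroElements_iff hq).mp hg
    · exact (represents_gel_inv hq k).mapsTo_lens (abs_sn_det hq k) hc.le hab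
        (hzero k hk2 hk a ha).1.1 (hzero k hk2 hk b hb).1.1 (hzero k hk2 hk a ha).2.1
        (hzero k hk2 hk b hb).2.1
    · exact (represents_Q_gel_inv hq k).mapsTo_lens (abs_sn_det' hq k) hc.le hab
        (hzero k hk2 hk a ha).1.2 (hzero k hk2 hk b hb).1.2 (hzero k hk2 hk a ha).2.2
        (hzero k hk2 hk b hb).2.2
  have hmono : ∀ n : ℕ, 1 ≤ n → ell q ≤ n * ell q := fun n hn => by
    have : (1 : ℝ) ≤ n := by exact_mod_cast hn
    nlinarith
  have hQ : ∀ n : ℕ, 1 ≤ n → ∀ x : ℝ, x = x₀ ∨ 0 < x → 0 < 1 * x + n * ell q ∧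
      (0 * x + 1) / (1 * x + n * ell q) ∈ Set.Ioo x₀ β := by
    intro n hn x hx
    have h1 := hmono n hn
    have h2 : 0 < x₀ + ell q := by linarith
    have h3 : x₀ + ell q ≤ 1 * x + n * ell q := by
      rcases hx with rfl | hx <;> linarith
    have h4 : 0 < 1 * x + n * ell q := h2.trans_le h3
    rw [zero_mul, zero_add]
    refine ⟨h4, ?_, ?_⟩
    · have : 0 < 1 / (1 * x + n * ell q) := by positivity
      linarith
    · exact (one_div_le_one_div_of_le h2 h3).trans_lt hx₀1
  have hQ' : ∀ n : ℕ, 1 ≤ n → ∀ a b : ℝ, a < b → (a = x₀ ∨ 0 < a) → (b = x₀ ∨ 0 < b) →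
      Set.MapsTo (act ℂ (((elQ q * elG q (-1) ^ n)⁻¹ : triangleGroup q) : PGL2))
        (closure (lens c a b)) (lens c x₀ β) := fun n hn a b hab ha hb =>
    (represents_Q_parabolic_inv hq n).mapsTo_lens (by norm_num) hc.le hab (hQ n hn a ha).1
      (hQ n hn b hb).1 (hQ n hn a ha).2 (hQ n hn b hb).2
  have hP : ∀ n : ℕ, 1 ≤ n → ∀ x : ℝ, 0 < x → 0 < n * ell q * x + 1 ∧
      (1 * x + 0) / (n * ell q * x + 1) ∈ Set.Ioo x₀ β := by
    intro n hn x hx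
    have h1 := hmono n hn
    have h2 : 0 < n * ell q * x + 1 := by positivity
    refine ⟨h2, hx₀.trans (by positivity), lt_trans ?_ (by linarith : 1 / ell q < β)⟩
    rw [div_lt_div_iff₀ h2 hL]
    nlinarith
  have hP' : ∀ n : ℕ, 1 ≤ n →
      Set.MapsTo (act ℂ (((elG q (-1) ^ n)⁻¹ : triangleGroup q) : PGL2))
        (closure (lens c γ τ)) (lens c x₀ β) := fun n hn =>
    (represents_parabolic_inv hq n).mapsTo_lens (by norm_num) hc.le hγτ (hP n hn γ hγ0).1
      (hP n hn τ (by linarith)).1 (hP n hn γ hγ0).2 (hP n hn τ (by linarith)).2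
  have hb₁ : ∀ z ∈ closure (lens c x₀ β), x₀ ≤ z.re ∧ z.re ≤ β ∧ |z.im| ≤ δ := fun z hz => by
    obtain ⟨h1, h2, h3⟩ := bounds_of_mem_closure_lens hc.le hxβ hz
    exact ⟨h1, h2, him _ _ h3 (by linarith)⟩
  have hb₀ : ∀ z ∈ closure (lens c γ τ), γ ≤ z.re ∧ z.re ≤ τ ∧ |z.im| ≤ δ := fun z hz => by
    obtain ⟨h1, h2, h3⟩ := bounds_of_mem_closure_lens hc.le hγτ hz
    exact ⟨h1, h2, him _ _ h3 (by linarith)⟩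
  have hbdd : ∀ a b : ℝ, (∀ z ∈ closure (lens c a b), a ≤ z.re ∧ z.re ≤ b ∧ |z.im| ≤ δ) →
      Bornology.IsBounded (lens c a b) := fun a b h => by
    refine isBounded_iff_forall_norm_le.mpr ⟨|a| + |b| + δ, fun z hz => ?_⟩
    obtain ⟨h1, h2, h3⟩ := h z (subset_closure hz)
    refine (Complex.norm_le_abs_re_add_abs_im z).trans (add_le_add ?_ h3)
    rw [abs_le]
    constructor <;> linarith [neg_abs_le a, le_abs_self b, abs_nonneg a, abs_nonneg b]
  have hclos : closure (dMinus q) ⊆ Set.Icc 0 (1 / ell q) :=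
    closure_minimal (fun x hx => ⟨hx.1.le, hx.2.le⟩) isClosed_Icc
  have hclos0 : closure (dZero q) ⊆ Set.Icc (1 / ell q) 1 := by
    refine closure_minimal (fun x hx => ?_) isClosed_Icc
    unfold dZero at hx
    split_ifs at hx
    · exact ⟨hx.1.le, hx.2⟩
    · exact ⟨hx.1.le, hx.2.le⟩
  have hone : 1 ≤ topEnd q := by
    by_cases he : Even q
    · have h1 : sn q ((q / 2 : ℕ) + 1) = sn q ((q / 2 : ℕ) - 1) := by
        rw [← sn_sub hq]
        congr 1
        have := Nat.even_iff.mp he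
        omega
      have h2 := sn_det hq (q / 2 : ℕ)
      have h3 := sn_pos_of_le hq (k := q / 2) (by omega) le_rfl
      have h4 := sn_succ_pos_of_le hq (k := q / 2) le_rfl
      rw [← h1] at h2
      rw [topEnd, one_le_div h4]
      nlinarith
    · exact (topEnd_of_odd hq he).ge
  by_cases hq3 : q = 3
  · subst hq3
    have hdz : dZero 3 = ∅ := by
      unfold dZero
      rw [if_neg (by decide), ell_three]
      simp
    exact ⟨{ zero := ∅
             minus := lens c x₀ β
             isOpen_zero := isOpen_empty
             isOpen_minus := isOpen_lens _ _ _
             isPreconnected_zero := isPreconnected_empty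
             isPreconnected_minus := (convex_lens hc.le hxβ).isPreconnected
             isBounded_zero := Bornology.isBounded_empty
             isBounded_minus := hbdd _ _ hb₁
             subset_zero := fun x hx => by simp [hdz] at hx
             subset_minus := fun x hx => mem_lens_ofReal
               ⟨by linarith [(hclos hx).1], by linarith [(hclos hx).2]⟩
             halfPlane_zero := fun z hz => by simp at hz
             halfPlane_minus := fun z hz => by linarith [(hb₁ z hz).1]
             mapsTo_zero_zero := fun g hg => by simp [zeroElements_three] at hg
             mapsTo_minus_zero := fun g hg => by simp [zeroElements_three] at hg
             mapsTo_zero_minus := fun h hh n hn => by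
               rw [closure_empty]
               exact Set.mapsTo_empty _ _
             mapsTo_minus_minus := fun n hn => hQ' n hn _ _ hxβ (Or.inl rfl)
               (Or.inr (by linarith)) }, by simp, fun z hz => by
        obtain ⟨h1, h2, h3⟩ := hb₁ z hz
        exact hrect₁ z (by linarith) (by linarith) (by linarith) (by linarith), fun _ => rfl⟩
  · exact ⟨{ zero := lens c γ τ
             minus := lens c x₀ β
             isOpen_zero := isOpen_lens _ _ _
             isOpen_minus := isOpen_lens _ _ _
             isPreconnected_zero := (convex_lens hc.le hγτ).isPreconnected
             isPreconnected_minus := (convex_lens hc.le hxβ).isPreconnected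
             isBounded_zero := hbdd _ _ hb₀
             isBounded_minus := hbdd _ _ hb₁
             subset_zero := fun x hx => mem_lens_ofReal
               ⟨by linarith [(hclos0 hx).1], by linarith [(hclos0 hx).2]⟩
             subset_minus := fun x hx => mem_lens_ofReal
               ⟨by linarith [(hclos hx).1], by linarith [(hclos hx).2]⟩
             halfPlane_zero := fun z hz => by linarith [(hb₀ z hz).1]
             halfPlane_minus := fun z hz => by linarith [(hb₁ z hz).1]
             mapsTo_zero_zero := fun g hg => hzero' g hg _ _ hγτ (Or.inr hγ0)
               (Or.inr (by linarith))
             mapsTo_minus_zero := fun g hg => hzero' g hg _ _ hxβ (Or.inl rfl)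
               (Or.inr (by linarith))
             mapsTo_zero_minus := fun h hh n hn => by
               rcases hh with rfl | rfl
               · rw [one_mul]
                 exact hP' n hn
               · exact hQ' n hn _ _ hγτ (Or.inr hγ0) (Or.inr (by linarith))
             mapsTo_minus_minus := fun n hn => hQ' n hn _ _ hxβ (Or.inl rfl)
               (Or.inr (by linarith)) }, fun z hz => by
        obtain ⟨h1, h2, h3⟩ := hb₀ z hz
        exact hrect₀ hq3 z (by linarith) (by linarith) (by linarith) htop, fun z hz => by
        obtain ⟨h1, h2, h3⟩ := hb₁ z hz
        exact hrect₁ z (by linarith) (by linarith) (by linarith) (by linarith),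
      fun h => absurd h hq3⟩

theorem AdmissiblePair.mem_minus (hq : 3 ≤ q) (E : AdmissiblePair q) {x : ℝ}
    (hx : x ∈ Set.Icc 0 (1 / ell q)) : (x : ℂ) ∈ E.minus := by
  apply E.subset_minus
  have hL := ell_pos hq
  rw [dMinus, closure_Ioo (by positivity)]
  exact hx

/-- For even `q`, the points beyond `1` are reached as images under `(Q g_{q/2})⁻¹`. -/
theorem AdmissiblePair.mem_zero (hq : 3 ≤ q) (hq3 : q ≠ 3) (E : AdmissiblePair q) {x : ℝ}
    (hx : x ∈ Set.Icc (1 / ell q) (topEnd q)) : (x : ℂ) ∈ E.zero := by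
  have h1 := one_div_ell_lt_one hq hq3
  have hmem : ∀ x ∈ Set.Icc (1 / ell q) 1, (x : ℂ) ∈ E.zero := by
    intro x hx
    apply E.subset_zero
    unfold dZero
    split_ifs
    · rwa [closure_Ioc h1.ne]
    · rwa [closure_Ioo h1.ne]
  by_cases he : Even q
  · rcases le_or_gt x 1 with hx1 | hx1
    · exact hmem x ⟨hx.1, hx1⟩
    have hK : 2 ≤ q / 2 := by
      have := Nat.even_iff.mp he
      omega
    have hb : sn q ((q / 2 : ℕ) + 1) = sn q ((q / 2 : ℕ) - 1) := by
      rw [← sn_sub hq]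
      congr 1
      have := Nat.even_iff.mp he
      omega
    have h2 := sn_det hq (q / 2 : ℕ)
    have h3 := sn_pos_of_le hq (k := q / 2) (by omega) le_rfl
    have h4 := sn_pred_pos_of_le hq hK le_rfl
    have hxt := hx.2
    rw [topEnd, hb, le_div_iff₀ h4] at hxt
    have hrep := represents_Q_gel_inv hq (q / 2)
    have hg : elQ q * gel q (q / 2) ∈ zeroElements q :=
      (mem_zeroElements_iff hq).mpr ⟨q / 2, hK, le_rfl, Or.inr rfl⟩
    rw [hb] at h2 hrep
    set a := sn q (q / 2 : ℕ)
    set b := sn q ((q / 2 : ℕ) - 1)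
    have hab : b < a := by nlinarith
    have hden : 0 < a * x - b := by nlinarith
    set y := (a - b * x) / (a * x - b) with hy
    have hy0 : 0 ≤ y := div_nonneg (by linarith) hden.le
    have hy1 : y ≤ 1 := by
      rw [hy, div_le_one hden]
      nlinarith
    have hact : act ℂ (((elQ q * gel q (q / 2))⁻¹ : triangleGroup q) : PGL2) (y : ℂ) = x := by
      rw [hrep.act_eq]
      simp only [Complex.coe_algebraMap]
      norm_cast
      have hd2 : 0 < a * y + b := by positivity
      rw [div_eq_iff hd2.ne']
      have : y * (a * x - b) = a - b * x := div_mul_cancel₀ _ hden.ne'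
      linarith
    rw [← hact]
    rcases le_total y (1 / ell q) with hyl | hyl
    · exact E.mapsTo_minus_zero _ hg (subset_closure (E.mem_minus hq ⟨hy0, hyl⟩))
    · exact E.mapsTo_zero_zero _ hg (subset_closure (hmem y ⟨hyl, hy1⟩))
  · exact hmem x (by rwa [topEnd_of_odd hq he] at hx)

theorem nonempty_admissiblePair (hq : 3 ≤ q) : Nonempty (AdmissiblePair q) := by
  obtain ⟨E, -⟩ := exists_admissiblePair hq isOpen_univ isOpen_univ (by simp) (by simp)
  exact ⟨E⟩

theorem exists_admissiblePair_ge (hq : 3 ≤ q) (E E' : AdmissiblePair q) :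
    ∃ E'' : AdmissiblePair q, E ≤ E'' ∧ E' ≤ E'' ∧ (q = 3 → E''.zero = ∅) := by
  obtain ⟨E'', h0, h1, h2⟩ := exists_admissiblePair hq (E.isOpen_zero.inter E'.isOpen_zero)
    (E.isOpen_minus.inter E'.isOpen_minus)
    (fun h x hx => ⟨E.mem_zero hq h hx, E'.mem_zero hq h hx⟩)
    (fun x hx => ⟨E.mem_minus hq hx, E'.mem_minus hq hx⟩)
  exact ⟨E'', ⟨fun z hz => (h0 (subset_closure hz)).1, fun z hz => (h1 (subset_closure hz)).1⟩,
    ⟨fun z hz => (h0 (subset_closure hz)).2, fun z hz => (h1 (subset_closure hz)).2⟩, h2⟩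

theorem isDirectedOrder_admissiblePair (hq : 3 ≤ q) : IsDirectedOrder (AdmissiblePair q) :=
  ⟨fun E E' => by
    obtain ⟨E'', h, h', -⟩ := exists_admissiblePair_ge hq E E'
    exact ⟨E'', h, h'⟩⟩

/-! ### Elements of the inductive limit are determined by their real restrictions -/

section

variable {V : Type*} [NormedAddCommGroup V] [InnerProductSpace ℂ V]

theorem exists_toLimit (hq : 3 ≤ q) (f : LimitSpace V q) :
    ∃ (E : AdmissiblePair q) (ψ : pairSpace V E), toLimit E ψ = f := by
  have := nonempty_admissiblePair hq
  have := isDirectedOrder_admissiblePair hq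
  obtain ⟨E, ψ, h⟩ := Module.DirectLimit.exists_of f
  exact ⟨E, ψ, h⟩

theorem resZero_toLimit (E : AdmissiblePair q) (ψ : pairSpace V E) :
    resZero (toLimit E ψ) = realRestrict (dZero q) ψ.1.1 :=
  Module.DirectLimit.lift_of _ _ _

theorem resMinus_toLimit (E : AdmissiblePair q) (ψ : pairSpace V E) :
    resMinus (toLimit E ψ) = realRestrict (dMinus q) ψ.2.1 :=
  Module.DirectLimit.lift_of _ _ _

theorem resMinus_toLimit_apply (E : AdmissiblePair q) (ψ : pairSpace V E) {x : ℝ}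
    (hx : x ∈ dMinus q) : resMinus (toLimit E ψ) x = ψ.2.1 x := by
  rw [resMinus_toLimit]
  exact Set.indicator_of_mem hx fun x : ℝ => ψ.2.1 x

theorem resZero_toLimit_apply (E : AdmissiblePair q) (ψ : pairSpace V E) {x : ℝ}
    (hx : x ∈ dZero q) : resZero (toLimit E ψ) x = ψ.1.1 x := by
  rw [resZero_toLimit]
  exact Set.indicator_of_mem hx fun x : ℝ => ψ.1.1 x

/-- Identity theorem: holomorphic functions on a connected open set that agree on a real interval
agree. -/
theorem eqOn_of_eq_on_Ioo [CompleteSpace V] {U : Set ℂ} (hU : IsOpen U) (hc : IsPreconnected U)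
    {f g : ℂ → V} (hf : DifferentiableOn ℂ f U) (hg : DifferentiableOn ℂ g U) {a b : ℝ}
    (hab : a < b) (hsub : ∀ x ∈ Set.Ioo a b, (x : ℂ) ∈ U)
    (h : ∀ x ∈ Set.Ioo a b, f (x : ℂ) = g x) : Set.EqOn f g U := by
  set m := (a + b) / 2
  have hm : m ∈ Set.Ioo a b := ⟨by simp only [m]; linarith, by simp only [m]; linarith⟩
  refine (hf.analyticOnNhd hU).eqOn_of_preconnected_of_frequently_eq (hg.analyticOnNhd hU) hc
    (hsub m hm) ?_
  have h1 : ∃ᶠ x : ℝ in 𝓝[≠] m, f (x : ℂ) = g x := by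
    refine Eventually.frequently ?_
    filter_upwards [nhdsWithin_le_nhds (Ioo_mem_nhds hm.1 hm.2)] with x hx
    exact h x hx
  have ht : Tendsto (fun x : ℝ => (x : ℂ)) (𝓝[≠] m) (𝓝[≠] (m : ℂ)) := by
    refine tendsto_nhdsWithin_iff.mpr
      ⟨(Complex.continuous_ofReal.tendsto m).mono_left nhdsWithin_le_nhds, ?_⟩
    filter_upwards [self_mem_nhdsWithin] with x hx
    simpa using hx
  exact ht.frequently h1

theorem holSpace_eq_zero {E : Set ℂ} {ψ : ℂ → V} (hψ : ψ ∈ holSpace V E)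
    (h : Set.EqOn ψ 0 E) : ψ = 0 := by
  ext z
  by_cases hz : z ∈ closure E
  · exact h.of_subset_closure hψ.1 continuousOn_const subset_closure subset_rfl hz
  · exact hψ.2.2 z hz

theorem eq_zero_of_res_eq_zero [CompleteSpace V] (hq : 3 ≤ q) {f : LimitSpace V q}
    (h0 : ∀ x ∈ dZero q, resZero f x = 0) (h1 : ∀ x ∈ dMinus q, resMinus f x = 0) : f = 0 := by
  have hL := ell_pos hq
  obtain ⟨E₁, ψ₁, rfl⟩ := exists_toLimit hq f
  -- for `q = 3` pass to a pair with empty first component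
  obtain ⟨E, hE, -, hE3⟩ := exists_admissiblePair_ge hq E₁ E₁
  have hof : toLimit E (pairRestrict V E₁ E hE ψ₁) = toLimit E₁ ψ₁ :=
    Module.DirectLimit.of_f
  rw [← hof] at h0 h1 ⊢
  generalize pairRestrict V E₁ E hE ψ₁ = ψ at h0 h1
  have hψ : ψ = 0 := by
    refine Prod.ext (Subtype.ext ?_) (Subtype.ext ?_)
    · refine holSpace_eq_zero ψ.1.2 ?_
      by_cases hq3 : q = 3
      · intro z hz
        simp [hE3 hq3] at hz
      · have hsub : Set.Ioo (1 / ell q) 1 ⊆ dZero q := by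
          unfold dZero
          split_ifs
          · exact Set.Ioo_subset_Ioc_self
          · exact subset_rfl
        refine eqOn_of_eq_on_Ioo E.isOpen_zero E.isPreconnected_zero ψ.1.2.2.1
          (differentiableOn_const 0) (one_div_ell_lt_one hq hq3)
          (fun x hx => E.subset_zero x (subset_closure (hsub hx))) fun x hx => ?_
        rw [← resZero_toLimit_apply E ψ (hsub hx)]
        exact h0 x (hsub hx)
    · refine holSpace_eq_zero ψ.2.2 ?_
      refine eqOn_of_eq_on_Ioo E.isOpen_minus E.isPreconnected_minus ψ.2.2.2.1
        (differentiableOn_const 0) (a := 0) (b := 1 / ell q) (by positivity)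
        (fun x hx => E.subset_minus x (subset_closure hx)) fun x hx => ?_
      rw [← resMinus_toLimit_apply E ψ hx]
      exact h1 x hx
  rw [hψ]
  exact map_zero _

theorem eq_of_res_eq [CompleteSpace V] (hq : 3 ≤ q) {f g : LimitSpace V q}
    (h0 : ∀ x ∈ dZero q, resZero f x = resZero g x)
    (h1 : ∀ x ∈ dMinus q, resMinus f x = resMinus g x) : f = g := by
  rw [← sub_eq_zero]
  refine eq_zero_of_res_eq_zero hq (fun x hx => ?_) (fun x hx => ?_)
  · rw [map_sub, Pi.sub_apply, h0 x hx, sub_self]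
  · rw [map_sub, Pi.sub_apply, h1 x hx, sub_self]

end

end HeckeTransfer

namespace HeckeTransfer

open Filter

/-! ### The transfer operators as sums over `k ≤ ⌊q/2⌋` -/

section

variable {V : Type*} [NormedAddCommGroup V] [InnerProductSpace ℂ V] {q : ℕ}
variable (χ : triangleGroup q →* (V ≃ₗᵢ[ℂ] V)) (ε : ℤˣ) (s : ℂ)

/-- The sums in both transfer operators, starting at `k = a`, rewritten in terms of `gel`
and `wt`. -/
theorem sum_add_ite_eq (hq : 3 ≤ q) {a : ℕ} (ha : a ≤ 2) (F : triangleGroup q → V) :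
    (∑ k ∈ Finset.Icc a (numM q), F (elG q (-(k : ℤ)))) +
      (if Even q then (1 / 2 : ℂ) • F (elG q ((q / 2 : ℕ) : ℤ)) else 0) =
    ∑ k ∈ Finset.Icc a (q / 2), wt q k • F (gel q k) := by
  have hsum : ∀ m, 2 * m < q → ∑ k ∈ Finset.Icc a m, wt q k • F (gel q k) =
      ∑ k ∈ Finset.Icc a m, F (elG q (-(k : ℤ))) := by
    intro m hm
    refine Finset.sum_congr rfl fun k hk => ?_
    have hk' := (Finset.mem_Icc.mp hk).2
    rw [wt, gel, if_neg (by omega), if_neg (by omega), one_smul]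
  unfold numM
  split_ifs with he
  · have h2 := Nat.even_iff.mp he
    have h1 : q / 2 = (q - 1) / 2 + 1 := by omega
    rw [h1, Finset.sum_Icc_succ_top (by omega), hsum _ (by omega), ← h1, wt, gel,
      if_pos (by omega), if_pos (by omega)]
  · rw [Nat.not_even_iff] at he
    have h1 : q / 2 = (q - 1) / 2 := by omega
    rw [h1, hsum _ (by omega), add_zero]

theorem fastZero_eq (hq : 3 ≤ q) (h : triangleGroup q) (ψ : ℂ → V) (z : ℂ) :
    fastZero χ s h ψ z = ∑ k ∈ Finset.Icc 2 (q / 2), wt q k • alphaC χ s (h * gel q k) ψ z :=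
  sum_add_ite_eq hq le_rfl fun g => alphaC χ s (h * g) ψ z

/-- The part of the slow transfer operator that corresponds to the elements `g_{-k}`, `k ≥ 2`. -/
noncomputable def slowRest (φ : ℝ → V) (x : ℝ) : V :=
  ∑ k ∈ Finset.Icc 2 (q / 2), wt q k •
    (alphaR χ s (gel q k) φ x + ε • alphaR χ s (elQ q * gel q k) φ x)

theorem slowOp_eq (hq : 3 ≤ q) (φ : ℝ → V) (x : ℝ) :
    slowOp χ ε s φ x = alphaR χ s (elG q (-1)) φ x +
      ε • alphaR χ s (elQ q * elG q (-1)) φ x + slowRest χ ε s φ x := by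
  have h := sum_add_ite_eq hq (a := 1) (by norm_num)
    fun g => alphaR χ s g φ x + ε • alphaR χ s (elQ q * g) φ x
  unfold slowOp
  rw [h, ← Finset.add_sum_Ioc_eq_sum_Icc (by omega : 1 ≤ q / 2)]
  have h1 : wt q 1 = 1 := if_neg (by omega)
  have h2 : gel q 1 = elG q (-1) := if_neg (by omega)
  rw [h1, h2, one_smul]
  rfl

/-! ### Regularity of the weighted translates -/

variable {χ s}

theorem alphaC_ofReal {g : triangleGroup q} {a b c d : ℝ}
    (h : Represents ((g⁻¹ : triangleGroup q) : PGL2) !![a, b; c, d])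
    (hdet : |a * d - b * c| = 1) {ψ : ℂ → V} {φ : ℝ → V} {x : ℝ} (hx : 0 < c * x + d)
    (hψ : φ ((a * x + b) / (c * x + d)) = ψ (((a * x + b) / (c * x + d) : ℝ) : ℂ)) :
    alphaC χ s g ψ x = alphaR χ s g φ x := by
  rw [alphaC_eq χ s h hdet ψ (by simpa using hx), alphaR_eq χ s h hdet φ hx, hψ]
  push_cast
  rfl

theorem differentiableAt_alphaC {g : triangleGroup q} {a b c d : ℝ}
    (h : Represents ((g⁻¹ : triangleGroup q) : PGL2) !![a, b; c, d])
    (hdet : |a * d - b * c| = 1) {ψ : ℂ → V} {z : ℂ} (hz : 0 < c * z.re + d)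
    (hψ : DifferentiableAt ℂ ψ (act ℂ ((g⁻¹ : triangleGroup q) : PGL2) z)) :
    DifferentiableAt ℂ (alphaC χ s g ψ) z := by
  rw [h.act_eq] at hψ
  have hre : 0 < (c * z + d : ℂ).re := by simpa using hz
  have h1 : DifferentiableAt ℂ (fun z : ℂ => (c * z + d : ℂ) ^ (-2 * s)) z :=
    DifferentiableAt.cpow_const (by fun_prop) (Or.inl hre)
  have h2 : DifferentiableAt ℂ (fun z : ℂ => (a * z + b) / (c * z + d : ℂ)) z :=
    DifferentiableAt.div (by fun_prop) (by fun_prop) (ne_zero_of_re_pos hre)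
  have h3 := h1.smul ((χ g).differentiable.differentiableAt.comp z
    (DifferentiableAt.comp z (f := fun z : ℂ => (a * z + b) / (c * z + d : ℂ)) hψ h2))
  refine h3.congr_of_eventuallyEq ?_
  have hc : ContinuousAt (fun z : ℂ => c * z.re + d) z := by fun_prop
  filter_upwards [hc.eventually (lt_mem_nhds hz)] with w hw
  exact alphaC_eq χ s h hdet ψ hw

theorem analyticAt_ofReal_of_differentiable [CompleteSpace V] {F : ℂ → V} {x : ℝ}
    (h : ∀ᶠ z in 𝓝 (x : ℂ), DifferentiableAt ℂ F z) :
    AnalyticAt ℝ (fun t : ℝ => F t) x := by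
  have h1 : AnalyticAt ℂ F x := Complex.analyticAt_iff_eventually_differentiableAt.mpr h
  exact AnalyticAt.comp (g := F) (f := fun t : ℝ => (t : ℂ)) (h1.restrictScalars)
    (Complex.ofRealCLM.analyticAt x)

theorem analyticAt_alphaR {g : triangleGroup q} {a b c d : ℝ}
    (h : Represents ((g⁻¹ : triangleGroup q) : PGL2) !![a, b; c, d])
    (hdet : |a * d - b * c| = 1) {φ : ℝ → V} {x : ℝ} (hx : 0 < c * x + d)
    (hφ : AnalyticAt ℝ φ ((a * x + b) / (c * x + d))) :
    AnalyticAt ℝ (alphaR χ s g φ) x := by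
  have h1 : AnalyticAt ℝ (fun t : ℝ => (c * t + d : ℂ) ^ (-2 * s)) x := by
    refine analyticAt_ofReal_of_differentiable (F := fun z : ℂ => (c * z + d : ℂ) ^ (-2 * s)) ?_
    have hc : ContinuousAt (fun z : ℂ => (c * z + d : ℂ).re) x := by fun_prop
    filter_upwards [hc.eventually (lt_mem_nhds (by simpa using hx))] with z hz
    exact DifferentiableAt.cpow_const (by fun_prop) (Or.inl hz)
  have h2 : AnalyticAt ℝ (fun t : ℝ => (a * t + b) / (c * t + d)) x :=
    ((analyticAt_const.mul analyticAt_id).add analyticAt_const).div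
      ((analyticAt_const.mul analyticAt_id).add analyticAt_const) hx.ne'
  have h3 : AnalyticAt ℝ (fun t : ℝ => χ g (φ ((a * t + b) / (c * t + d)))) x :=
    AnalyticAt.comp (g := χ g) ((((χ g).toContinuousLinearEquiv : V →L[ℂ] V).analyticAt
      _).restrictScalars) (AnalyticAt.comp (g := φ) hφ h2)
  refine (h1.smul h3).congr ?_
  have hc : ContinuousAt (fun t : ℝ => c * t + d) x := by fun_prop
  filter_upwards [hc.eventually (lt_mem_nhds hx)] with t ht
  exact (alphaR_eq χ s h hdet φ ht).symm

theorem AnalyticAt.units_smul {φ : ℝ → V} {x : ℝ} (ε : ℤˣ) (h : AnalyticAt ℝ φ x) :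
    AnalyticAt ℝ (fun t => ε • φ t) x := by
  rcases Int.units_eq_one_or ε with rfl | rfl
  · simpa using h
  · simp only [Units.neg_smul, one_smul]
    exact h.neg

theorem DifferentiableAt.units_smul {F : ℂ → V} {z : ℂ} (ε : ℤˣ) (h : DifferentiableAt ℂ F z) :
    DifferentiableAt ℂ (fun t => ε • F t) z := by
  rcases Int.units_eq_one_or ε with rfl | rfl
  · simpa using h
  · simpa using h.neg

/-! ### Intervals -/

theorem slowInterval_pos {x : ℝ} (hx : x ∈ slowInterval q) : 0 < x := by
  unfold slowInterval at hx
  split_ifs at hx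
  · exact hx
  · exact hx.1

theorem isOpen_slowInterval (q : ℕ) : IsOpen (slowInterval q) := by
  unfold slowInterval
  split_ifs
  · exact isOpen_Ioi
  · exact isOpen_Ioo

theorem isPreconnected_slowInterval (q : ℕ) : IsPreconnected (slowInterval q) := by
  unfold slowInterval
  split_ifs
  · exact isPreconnected_Ioi
  · exact isPreconnected_Ioo

theorem dMinus_subset (hq : 3 ≤ q) : dMinus q ⊆ slowInterval q := by
  intro x hx
  unfold slowInterval
  split_ifs
  · exact hx.1
  · refine ⟨hx.1, hx.2.trans_le ?_⟩
    rw [div_le_one (ell_pos hq)]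
    exact one_le_ell hq

theorem dZero_subset (hq : 3 ≤ q) : dZero q ⊆ slowInterval q := by
  have hL := ell_pos hq
  have h1 : 0 < 1 / ell q := by positivity
  intro x hx
  unfold dZero at hx
  unfold slowInterval
  split_ifs at hx ⊢
  · exact h1.trans hx.1
  · exact ⟨h1.trans hx.1, hx.2⟩

theorem mem_slowInterval_of_lt_topEnd (hq : 3 ≤ q) {x : ℝ} (hx0 : 0 < x) (hx : x < topEnd q) :
    x ∈ slowInterval q := by
  unfold slowInterval
  split_ifs with he
  · exact hx0
  · exact ⟨hx0, by rwa [topEnd_of_odd hq he] at hx⟩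

/-- All arguments occurring in the slow transfer operator lie in its interval. -/
theorem ratio_mem_slowInterval (hq : 3 ≤ q) {k : ℕ} (hk1 : 1 ≤ k) (hk : k ≤ q / 2) {x : ℝ}
    (hx : 0 < x) :
    (sn q k * x + sn q (k - 1)) / (sn q (k + 1) * x + sn q k) ∈ slowInterval q ∧
    (sn q (k - 1) * x + sn q k) / (sn q k * x + sn q (k + 1)) ∈ slowInterval q := by
  obtain ⟨h1, h2⟩ := ratio_mem_Ioo hq hk1 hk hx
  have h3 := ratio_le_topEnd hq hk
  have h4 : 0 ≤ sn q (k - 1) / sn q k :=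
    div_nonneg (sn_nonneg hq (by omega) (by omega)) (sn_pos_of_le hq hk1 hk).le
  exact ⟨mem_slowInterval_of_lt_topEnd hq (h4.trans_lt h1.1) (h1.2.trans_le h3),
    mem_slowInterval_of_lt_topEnd hq (h4.trans_lt h2.1) (h2.2.trans_le h3)⟩

variable (χ s)

theorem slowRest_congr (hq : 3 ≤ q) {φ φ' : ℝ → V} (h : ∀ y ∈ slowInterval q, φ y = φ' y) {x : ℝ}
    (hx : 0 < x) : slowRest χ ε s φ x = slowRest χ ε s φ' x := by
  refine Finset.sum_congr rfl fun k hk => ?_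
  rw [Finset.mem_Icc] at hk
  have p0 := sn_pos_of_le hq (k := k) (by omega) hk.2
  have p1 := sn_succ_pos_of_le hq hk.2
  obtain ⟨h1, h2⟩ := ratio_mem_slowInterval hq (k := k) (by omega) hk.2 hx
  rw [alphaR_eq χ s (represents_gel_inv hq k) (abs_sn_det hq k) _ (by positivity),
    alphaR_eq χ s (represents_gel_inv hq k) (abs_sn_det hq k) _ (by positivity),
    alphaR_eq χ s (represents_Q_gel_inv hq k) (abs_sn_det' hq k) _ (by positivity),
    alphaR_eq χ s (represents_Q_gel_inv hq k) (abs_sn_det' hq k) _ (by positivity), h _ h1, h _ h2]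

/-- On the positive half line, `(1 ± α_s(Q)) L_0` only involves values on `(1/ℓ, s_K/s_{K+1})`. -/
theorem slowRest_eq_fastZero (hq : 3 ≤ q) {φ : ℝ → V} {ψ : ℂ → V}
    (h : q ≠ 3 → ∀ y ∈ Set.Ioo (1 / ell q) (topEnd q), φ y = ψ y) {x : ℝ} (hx : 0 < x) :
    slowRest χ ε s φ x = fastZero χ s 1 ψ x + ε • fastZero χ s (elQ q) ψ x := by
  rw [fastZero_eq χ s hq, fastZero_eq χ s hq, Finset.smul_sum, ← Finset.sum_add_distrib]
  refine Finset.sum_congr rfl fun k hk => ?_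
  rw [Finset.mem_Icc] at hk
  have p0 := sn_pos_of_le hq (k := k) (by omega) hk.2
  have p1 := sn_succ_pos_of_le hq hk.2
  have p2 := sn_pred_pos_of_le hq hk.1 hk.2
  have r0 := one_div_ell_le_ratio hq hk.1 hk.2
  have r1 := ratio_le_topEnd hq hk.2
  obtain ⟨h1, h2⟩ := ratio_mem_Ioo hq (k := k) (by omega) hk.2 hx
  have h' := h (by omega)
  rw [one_mul, alphaC_ofReal (represents_gel_inv hq k) (abs_sn_det hq k) (φ := φ) (by positivity)
      (h' _ ⟨r0.trans_lt h1.1, h1.2.trans_le r1⟩),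
    alphaC_ofReal (represents_Q_gel_inv hq k) (abs_sn_det' hq k) (φ := φ) (by positivity)
      (h' _ ⟨r0.trans_lt h2.1, h2.2.trans_le r1⟩), smul_add, smul_comm ε (wt q k)]

/-! ### Holomorphy of the fast transfer operator -/

variable {χ s}

theorem differentiableAt_fastZero_one (hq : 3 ≤ q) {ψ : ℂ → V} {z : ℂ}
    (hz : -(1 / ell q) < z.re)
    (hψ : ∀ g ∈ zeroElements q,
      DifferentiableAt ℂ ψ (act ℂ ((g⁻¹ : triangleGroup q) : PGL2) z)) :
    DifferentiableAt ℂ (fastZero χ s 1 ψ) z := by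
  have hL := ell_pos hq
  have : fastZero χ s 1 ψ =
      fun z => ∑ k ∈ Finset.Icc 2 (q / 2), wt q k • alphaC χ s (gel q k) ψ z := by
    ext z
    rw [fastZero_eq χ s hq]
    simp only [one_mul]
  rw [this]
  refine DifferentiableAt.fun_sum fun k hk => ?_
  rw [Finset.mem_Icc] at hk
  have p1 := sn_succ_pos_of_le hq hk.2
  have p2 := sn_pred_pos_of_le hq hk.1 hk.2
  refine (differentiableAt_alphaC (represents_gel_inv hq k) (abs_sn_det hq k) ?_
    (hψ _ ((mem_zeroElements_iff hq).mpr ⟨k, hk.1, hk.2, Or.inl rfl⟩))).const_smul _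
  have h1 := sn_succ q k
  have h2 : 0 < ell q * z.re + 1 := by
    have := mul_lt_mul_of_pos_left hz hL
    rw [mul_neg, mul_one_div_cancel hL.ne'] at this
    linarith
  have h3 : ell q * (sn q (k + 1) * z.re + sn q k) =
      sn q (k + 1) * (ell q * z.re + 1) + sn q (k - 1) := by rw [h1]; ring
  refine pos_of_mul_pos_right ?_ hL.le
  rw [h3]
  positivity

theorem differentiableAt_fastZero_Q (hq : 3 ≤ q) {ψ : ℂ → V} {z : ℂ}
    (hz : -(1 / ell q) < z.re)
    (hψ : ∀ g ∈ zeroElements q,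
      DifferentiableAt ℂ ψ (act ℂ ((g⁻¹ : triangleGroup q) : PGL2) z)) :
    DifferentiableAt ℂ (fastZero χ s (elQ q) ψ) z := by
  have hL := ell_pos hq
  have : fastZero χ s (elQ q) ψ =
      fun z => ∑ k ∈ Finset.Icc 2 (q / 2), wt q k • alphaC χ s (elQ q * gel q k) ψ z := by
    ext z
    rw [fastZero_eq χ s hq]
  rw [this]
  refine DifferentiableAt.fun_sum fun k hk => ?_
  rw [Finset.mem_Icc] at hk
  have p0 := sn_pos_of_le hq (k := k) (by omega) hk.2
  have p3 := sn_nonneg hq (k := k + 1 + 1) (by omega) (by omega)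
  refine (differentiableAt_alphaC (represents_Q_gel_inv hq k) (abs_sn_det' hq k) ?_
    (hψ _ ((mem_zeroElements_iff hq).mpr ⟨k, hk.1, hk.2, Or.inr rfl⟩))).const_smul _
  have h1 := sn_succ q (k + 1)
  rw [add_sub_cancel_right] at h1
  have h2 : 0 < ell q * z.re + 1 := by
    have := mul_lt_mul_of_pos_left hz hL
    rw [mul_neg, mul_one_div_cancel hL.ne'] at this
    linarith
  have h3 : ell q * (sn q k * z.re + sn q (k + 1)) =
      sn q k * (ell q * z.re + 1) + sn q (k + 1 + 1) := by rw [h1]; ring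
  refine pos_of_mul_pos_right ?_ hL.le
  rw [h3]
  positivity

end

end HeckeTransfer

namespace HeckeTransfer

open Filter Asymptotics

section

variable {V : Type*} [NormedAddCommGroup V] [InnerProductSpace ℂ V] {q : ℕ}

/-- If all points `1/(v + nL)`, `n ≥ 1`, lie in an open neighbourhood of `0`, then the same holds
for all nearby `v`. -/
theorem eventually_forall_shift_mem {L : ℝ} (hL : 0 < L) {U : Set ℂ} (hU : IsOpen U)
    (h0 : (0 : ℂ) ∈ U) {v : ℂ} (hv : -L < v.re) (h : ∀ n : ℕ, 1 / (v + (n + 1) * L) ∈ U) :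
    ∀ᶠ w : ℂ in 𝓝 v, ∀ n : ℕ, 1 / (w + (n + 1) * L) ∈ U := by
  have hre : ∀ w : ℂ, -L < w.re → ∀ n : ℕ, n * L < (w + (n + 1) * L).re := by
    intro w hw n
    have h1 : (w + (n + 1) * L).re = w.re + (n + 1) * L := by simp
    rw [h1]
    linarith
  have hpos : ∀ w : ℂ, -L < w.re → ∀ n : ℕ, 0 < (w + (n + 1) * L).re := fun w hw n =>
    lt_of_le_of_lt (by positivity) (hre w hw n)
  obtain ⟨η, hη, hsub⟩ := Metric.isOpen_iff.mp hU 0 h0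
  obtain ⟨N, hN⟩ := exists_nat_gt (1 / (η * L))
  rw [div_lt_iff₀ (by positivity)] at hN
  have h1 : ∀ n ∈ Finset.range N, ∀ᶠ w : ℂ in 𝓝 v, 1 / (w + (n + 1) * L) ∈ U := by
    intro n _
    have hc : ContinuousAt (fun w : ℂ => 1 / (w + (n + 1) * L)) v :=
      ContinuousAt.div (by fun_prop) (by fun_prop) (ne_zero_of_re_pos (hpos v hv n))
    exact hc.eventually (hU.mem_nhds (h n))
  filter_upwards [(eventually_all_finset _).mpr h1,
    Complex.continuous_re.continuousAt.eventually (lt_mem_nhds hv)] with w hw hwre n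
  by_cases hn : n < N
  · exact hw n (Finset.mem_range.mpr hn)
  · apply hsub
    push Not at hn
    have hn' : (N : ℝ) ≤ n := by exact_mod_cast hn
    have hp := hpos w hwre n
    rw [Metric.mem_ball, dist_zero_right, norm_div, norm_one,
      div_lt_iff₀ (norm_pos_iff.mpr (ne_zero_of_re_pos hp))]
    calc 1 < N * (η * L) := hN
      _ ≤ n * (η * L) := by gcongr
      _ = η * (n * L) := by ring
      _ ≤ η * ‖w + (n + 1) * L‖ := by
        gcongr
        exact (hre w hwre n).le.trans (Complex.re_le_norm _)

variable {χ : triangleGroup q →* (V ≃ₗᵢ[ℂ] V)} {s : ℂ} {ψ : ℂ → V}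

theorem act_parabolic_inv (hq : 3 ≤ q) {z : ℂ} (hz : z ≠ 0) (n : ℕ) :
    act ℂ (((1 * elG q (-1) ^ (n + 1))⁻¹ : triangleGroup q) : PGL2) z =
      1 / (1 / z + (n + 1) * ell q) := by
  rw [one_mul, (represents_parabolic_inv hq (n + 1)).act_eq]
  have : 1 / z + (n + 1) * ell q = ((n + 1) * ell q * z + 1) / z := by
    field_simp
    ring
  rw [this]
  simp

theorem act_Q_parabolic_inv (hq : 3 ≤ q) (z : ℂ) (n : ℕ) :
    act ℂ (((elQ q * elG q (-1) ^ (n + 1))⁻¹ : triangleGroup q) : PGL2) z =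
      1 / (z + (n + 1) * ell q) := by
  rw [(represents_Q_parabolic_inv hq (n + 1)).act_eq]
  simp

theorem parabolic_mem_dMinus (hq : 3 ≤ q) {x : ℝ} (hx : 0 < x) (n : ℕ) :
    x / ((n + 1) * ell q * x + 1) ∈ dMinus q := by
  have hL := ell_pos hq
  refine ⟨by positivity, ?_⟩
  rw [div_lt_div_iff₀ (by positivity) hL]
  have : 0 ≤ n * ell q * x := by positivity
  nlinarith

/-- On the positive half line, the real and the complex version of `L_{-1}` agree. -/
theorem fastMinusR_eq (hq : 3 ≤ q) {f : ℝ → V} (hf : ∀ y ∈ dMinus q, f y = ψ y) {x : ℝ}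
    (hx : 0 < x) : fastMinusR χ s f x = fastMinus χ s 1 ψ x := by
  have hL := ell_pos hq
  unfold fastMinusR fastMinus
  congr 1
  ext w n
  rw [one_mul]
  have hm := parabolic_mem_dMinus hq hx n
  refine (alphaC_ofReal (represents_parabolic_inv hq (n + 1)) (by norm_num) (by positivity)
    ?_).symm
  refine hf _ ?_
  convert hm using 1
  push_cast
  simp

theorem onePlusFast_toLimit (hq : 3 ≤ q) (E : AdmissiblePair q) (ψ : pairSpace V E) {x : ℝ}
    (hx : x ∈ dMinus q) : onePlusFast χ s (toLimit E ψ) x =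
      ψ.2.1 x + fastMinus χ s 1 ψ.2.1 x := by
  rw [onePlusFast, resMinus_toLimit_apply E ψ hx,
    fastMinusR_eq hq (fun y hy => resMinus_toLimit_apply E ψ hy) hx.1]

theorem AdmissiblePair.eventually_differentiableAt (hq : 3 ≤ q) (E : AdmissiblePair q)
    (hψ : DifferentiableOn ℂ ψ E.minus) : ∀ᶠ y in 𝓝 0, DifferentiableAt ℂ ψ y := by
  have hL := ell_pos hq
  have h0 : (0 : ℂ) ∈ E.minus := by
    simpa using E.mem_minus hq (x := 0) ⟨le_rfl, by positivity⟩
  filter_upwards [E.isOpen_minus.mem_nhds h0] with y hy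
  exact hψ.differentiableAt (E.isOpen_minus.mem_nhds hy)

theorem AdmissiblePair.differentiableAt_zero (hq : 3 ≤ q) (E : AdmissiblePair q)
    (hψ : DifferentiableOn ℂ ψ E.minus) : DifferentiableAt ℂ ψ 0 :=
  (E.eventually_differentiableAt hq hψ).self_of_nhds

variable [FiniteDimensional ℂ V]

/-- Both fast operators applied to a function holomorphic on `E₋₁` are holomorphic near every
positive real point. -/
theorem AdmissiblePair.eventually_differentiableAt_fastMinus (hq : 3 ≤ q) (E : AdmissiblePair q)
    (hψ : DifferentiableOn ℂ ψ E.minus) (hs0 : 0 < s.re) (hs : s ≠ 1 / 2) {x : ℝ} (hx : 0 < x) :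
    ∀ᶠ z in 𝓝 (x : ℂ), DifferentiableAt ℂ (fastMinus χ s 1 ψ) z ∧
      DifferentiableAt ℂ (fastMinus χ s (elQ q) ψ) z := by
  have hL := ell_pos hq
  have h0 : (0 : ℂ) ∈ E.minus := by
    simpa using E.mem_minus hq (x := 0) ⟨le_rfl, by positivity⟩
  have hmem : ∀ v : ℝ, 0 < v → ∀ n : ℕ, 1 / ((v : ℂ) + (n + 1) * ell q) ∈ E.minus := by
    intro v hv n
    have : 1 / ((v : ℂ) + (n + 1) * ell q) = ((1 / (v + (n + 1) * ell q) : ℝ) : ℂ) := by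
      push_cast
      ring
    rw [this]
    refine E.mem_minus hq ⟨by positivity, one_div_le_one_div_of_le hL ?_⟩
    have : 0 ≤ n * ell q := by positivity
    linarith
  have hxc : (x : ℂ) ≠ 0 := by exact_mod_cast hx.ne'
  have e1 := eventually_forall_shift_mem hL E.isOpen_minus h0 (v := x) (by simp; linarith)
    (hmem x hx)
  have e2 := eventually_forall_shift_mem hL E.isOpen_minus h0 (v := ((1 / x : ℝ) : ℂ))
    (by rw [Complex.ofReal_re]; have : 0 < 1 / x := by positivity
        linarith) (hmem (1 / x) (by positivity))
  have hc : ContinuousAt (fun z : ℂ => 1 / z) x :=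
    ContinuousAt.div (by fun_prop) (by fun_prop) hxc
  have hxe : ((1 / x : ℝ) : ℂ) = 1 / (x : ℂ) := by push_cast; rfl
  rw [hxe] at e2
  have e3 := hc.eventually e2
  have hnb := E.eventually_differentiableAt hq hψ
  filter_upwards [e1, e3, Complex.continuous_re.continuousAt.eventually
    (lt_mem_nhds (by simpa using hx : 0 < (x : ℂ).re))] with z h1 h2 hz
  exact ⟨differentiableAt_fastMinus_one hq χ hs0 hs hz hnb fun n =>
    hψ.differentiableAt (E.isOpen_minus.mem_nhds (h2 n)),
    differentiableAt_fastMinus_Q hq χ hs0 hs (by linarith) hnb fun n =>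
    hψ.differentiableAt (E.isOpen_minus.mem_nhds (h1 n))⟩

/-! ### From fast to slow eigenfunctions -/

/-- A solution of the fast equations yields a real-analytic eigenfunction of the slow operator, by
evaluating the right-hand side of the first equation on the whole interval. -/
theorem exists_slowEigenAs_of_fast (hq : 3 ≤ q) {ε : ℤˣ} (hs0 : 0 < s.re) (hs : s ≠ 1 / 2)
    (E : AdmissiblePair q) (ψ : pairSpace V E)
    (heq₀ : ∀ z ∈ E.zero, ψ.1.1 z =
      (fastZero χ s 1 ψ.1.1 z + ε • fastZero χ s (elQ q) ψ.1.1 z) +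
      (fastMinus χ s 1 ψ.2.1 z + ε • fastMinus χ s (elQ q) ψ.2.1 z))
    (heq₁ : ∀ z ∈ E.minus, ψ.2.1 z =
      (fastZero χ s 1 ψ.1.1 z + ε • fastZero χ s (elQ q) ψ.1.1 z) +
      ε • fastMinus χ s (elQ q) ψ.2.1 z) :
    ∃ φ ∈ slowEigenAs χ ε s, (∀ x ∈ dZero q, φ x = ψ.1.1 x) ∧
      (∀ x ∈ dMinus q, φ x = ψ.2.1 x + fastMinus χ s 1 ψ.2.1 x) ∧
      (∀ x ∈ dMinus q, ψ.2.1 x = φ x - alphaR χ s (elG q (-1)) φ x) := by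
  have : CompleteSpace V := FiniteDimensional.complete ℂ V
  have hL := ell_pos hq
  set R : ℂ → V := fun z => (fastZero χ s 1 ψ.1.1 z + ε • fastZero χ s (elQ q) ψ.1.1 z) +
      (fastMinus χ s 1 ψ.2.1 z + ε • fastMinus χ s (elQ q) ψ.2.1 z) with hR
  set φ : ℝ → V := (slowInterval q).indicator fun x => R x with hφ
  have hφI : ∀ x ∈ slowInterval q, φ x = R x := fun x hx =>
    Set.indicator_of_mem hx fun x : ℝ => R x
  have hφ₀ : ∀ x ∈ slowInterval q, (x : ℂ) ∈ E.zero → φ x = ψ.1.1 x := fun x hx hx' => by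
    rw [hφI x hx, heq₀ x hx']
  have hφ₁ : ∀ x ∈ dMinus q, φ x = ψ.2.1 x + fastMinus χ s 1 ψ.2.1 x := fun x hx => by
    rw [hφI x (dMinus_subset hq hx), heq₁ x (E.mem_minus hq ⟨hx.1.le, hx.2.le⟩)]
    simp only [hR]
    abel
  have hψ₁ : DifferentiableAt ℂ ψ.2.1 0 := E.differentiableAt_zero hq ψ.2.2.2.1
  have hslow : φ ∈ slowEigen χ ε s := by
    refine ⟨⟨fun x hx => ?_, fun x hx => Set.indicator_of_notMem hx _⟩, fun x hx => ?_⟩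
    · have hx0 := slowInterval_pos hx
      have hR' : ∀ᶠ z in 𝓝 (x : ℂ), DifferentiableAt ℂ R z := by
        have h1 := E.eventually_differentiableAt_fastMinus (χ := χ) hq ψ.2.2.2.1 hs0 hs hx0
        have h2 : ∀ k ∈ Finset.Icc 2 (q / 2), ∀ᶠ z in 𝓝 (x : ℂ),
            act ℂ (((gel q k)⁻¹ : triangleGroup q) : PGL2) z ∈ E.zero ∧
            act ℂ (((elQ q * gel q k)⁻¹ : triangleGroup q) : PGL2) z ∈ E.zero := by
          intro k hk
          rw [Finset.mem_Icc] at hk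
          have p0 := sn_pos_of_le hq (k := k) (by omega) hk.2
          have p1 := sn_succ_pos_of_le hq hk.2
          have r0 := one_div_ell_le_ratio hq hk.1 hk.2
          have r1 := ratio_le_topEnd hq hk.2
          obtain ⟨m1, m2⟩ := ratio_mem_Ioo hq (k := k) (by omega) hk.2 hx0
          have hmem : ∀ y : ℝ, y ∈ Set.Ioo (sn q (k - 1) / sn q k) (sn q k / sn q (k + 1)) →
              (y : ℂ) ∈ E.zero := fun y hy => E.mem_zero hq (by omega)
            ⟨r0.trans hy.1.le, hy.2.le.trans r1⟩
          simp only [(represents_gel_inv hq k).act_eq, (represents_Q_gel_inv hq k).act_eq,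
            Complex.coe_algebraMap]
          have q1 : (sn q (k + 1) * x + sn q k : ℂ) ≠ 0 := by
            have : 0 < sn q (k + 1) * x + sn q k := by positivity
            exact_mod_cast this.ne'
          have q2 : (sn q k * x + sn q (k + 1) : ℂ) ≠ 0 := by
            have : 0 < sn q k * x + sn q (k + 1) := by positivity
            exact_mod_cast this.ne'
          have c1 : ContinuousAt (fun z : ℂ => (sn q k * z + sn q (k - 1)) /
              (sn q (k + 1) * z + sn q k : ℂ)) x :=
            ContinuousAt.div (by fun_prop) (by fun_prop) q1
          have c2 : ContinuousAt (fun z : ℂ => (sn q (k - 1) * z + sn q k) /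
              (sn q k * z + sn q (k + 1) : ℂ)) x :=
            ContinuousAt.div (by fun_prop) (by fun_prop) q2
          refine (c1.eventually (E.isOpen_zero.mem_nhds ?_)).and
            (c2.eventually (E.isOpen_zero.mem_nhds ?_))
          · have := hmem _ m1
            push_cast at this
            exact this
          · have := hmem _ m2
            push_cast at this
            exact this
        filter_upwards [h1, (eventually_all_finset _).mpr h2,
          Complex.continuous_re.continuousAt.eventually
          (lt_mem_nhds (by simpa using hx0 : 0 < (x : ℂ).re))] with z d1 d2 hz
        have d3 : ∀ g ∈ zeroElements q, DifferentiableAt ℂ ψ.1.1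
            (act ℂ ((g⁻¹ : triangleGroup q) : PGL2) z) := by
          intro g hg
          obtain ⟨k, hk2, hk, rfl | rfl⟩ := (mem_zeroElements_iff hq).mp hg
          · exact ψ.1.2.2.1.differentiableAt
              (E.isOpen_zero.mem_nhds (d2 k (Finset.mem_Icc.mpr ⟨hk2, hk⟩)).1)
          · exact ψ.1.2.2.1.differentiableAt
              (E.isOpen_zero.mem_nhds (d2 k (Finset.mem_Icc.mpr ⟨hk2, hk⟩)).2)
        have hz' : -(1 / ell q) < z.re := by
          have : 0 < 1 / ell q := by positivity
          linarith
        exact ((differentiableAt_fastZero_one hq hz' d3).add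
          (DifferentiableAt.units_smul ε (differentiableAt_fastZero_Q hq hz' d3))).add
          (d1.1.add (DifferentiableAt.units_smul ε d1.2))
      refine (analyticAt_ofReal_of_differentiable hR').congr ?_
      filter_upwards [(isOpen_slowInterval q).mem_nhds hx] with y hy
      exact (hφI y hy).symm
    · have hx0 := slowInterval_pos hx
      obtain ⟨a1, a2⟩ := alphaR_parabolic_eq_fastMinus hq χ hs0 hs hψ₁ hφ₁ hx0
      rw [slowOp_eq χ ε s hq, a1, a2, slowRest_eq_fastZero χ ε s hq (ψ := ψ.1.1)
        (fun hq3 y hy => ?_) hx0, hφI x hx]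
      · simp only [hR]
        abel
      · have : 0 < 1 / ell q := by positivity
        exact hφ₀ y (mem_slowInterval_of_lt_topEnd hq (this.trans hy.1) hy.2)
          (E.mem_zero hq hq3 ⟨hy.1.le, hy.2.le⟩)
  refine ⟨φ, ⟨hslow, ?_⟩, fun x hx => ?_, hφ₁, fun x hx => ?_⟩
  · obtain ⟨c, hc⟩ := exists_fastMinus_one_asymp hq χ hs0 hs hψ₁
    refine ⟨c, ?_⟩
    have hb : (fun x : ℝ => ψ.2.1 x) =O[𝓝[>] 0] fun _ : ℝ => (1 : ℝ) := by
      have h1 : ContinuousAt (fun x : ℝ => ψ.2.1 (x : ℂ)) 0 :=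
        ContinuousAt.comp (f := fun x : ℝ => (x : ℂ)) (g := ψ.2.1)
          (by simpa using hψ₁.continuousAt) Complex.continuous_ofReal.continuousAt
      exact (h1.tendsto.mono_left nhdsWithin_le_nhds).isBigO_one ℝ
    refine (hc.add hb).congr' ?_ EventuallyEq.rfl
    filter_upwards [Ioo_mem_nhdsGT (by positivity : 0 < 1 / ell q)] with x hx
    rw [hφ₁ x hx]
    abel
  · exact hφ₀ x (dZero_subset hq hx) (E.subset_zero x (subset_closure hx))
  · rw [(alphaR_parabolic_eq_fastMinus hq χ hs0 hs hψ₁ hφ₁ hx.1).1, hφ₁ x hx,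
      add_sub_cancel_right]

end

end HeckeTransfer

namespace HeckeTransfer

open Filter Asymptotics

/-! ### Complex extensions of real-analytic functions -/

section

variable {V : Type*} [NormedAddCommGroup V] [InnerProductSpace ℂ V]

theorem exists_ball_extension [CompleteSpace V] {φ : ℝ → V} {x : ℝ} (hφ : AnalyticAt ℝ φ x) :
    ∃ r > 0, ∃ F : ℂ → V, DifferentiableOn ℂ F (Metric.ball (x : ℂ) r) ∧
      ∀ t : ℝ, (t : ℂ) ∈ Metric.ball (x : ℂ) r → F t = φ t := by
  obtain ⟨p, r, hp⟩ := hφ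
  obtain ⟨r₀, hr₀, hr₀r⟩ := ENNReal.lt_iff_exists_nnreal_btwn.mp hp.r_pos
  have hpos : (0 : ℝ) < r₀ := by exact_mod_cast hr₀
  have hsum := p.summable_norm_mul_pow (hr₀r.trans_le hp.r_le)
  refine ⟨r₀, hpos, fun z => ∑' n, (z - x) ^ n • p.coeff n, ?_, fun t ht => ?_⟩
  · refine Complex.differentiableOn_tsum_of_summable_norm hsum (fun n => by fun_prop)
      Metric.isOpen_ball fun n w hw => ?_
    rw [norm_smul, norm_pow, mul_comm, p.norm_apply_eq_norm_coef]
    rw [mem_ball_iff_norm] at hw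
    gcongr
  · have h1 : ‖t - x‖ < r₀ := by
      rw [mem_ball_iff_norm] at ht
      rwa [← Complex.ofReal_sub, Complex.norm_real] at ht
    have hmem : t - x ∈ Metric.eball (0 : ℝ) r := by
      rw [Metric.mem_eball, edist_zero_right]
      refine lt_trans ?_ hr₀r
      rw [enorm_eq_nnnorm]
      exact_mod_cast h1
    have h2 := hp.hasSum hmem
    rw [add_sub_cancel] at h2
    rw [← h2.tsum_eq]
    refine tsum_congr fun n => ?_
    rw [p.apply_eq_pow_smul_coeff, ← Complex.ofReal_sub, ← Complex.ofReal_pow, Complex.coe_smul]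

theorem re_mem_ball {z : ℂ} {x r : ℝ} (hz : z ∈ Metric.ball (x : ℂ) r) :
    ((z.re : ℝ) : ℂ) ∈ Metric.ball (x : ℂ) r := by
  rw [mem_ball_iff_norm] at hz ⊢
  rw [← Complex.ofReal_sub, Complex.norm_real, Real.norm_eq_abs]
  have h := Complex.abs_re_le_norm (z - x)
  rw [Complex.sub_re, Complex.ofReal_re] at h
  exact h.trans_lt hz

open Classical in
/-- A real-analytic function near a subset `K` of the real line extends holomorphically to a
complex neighbourhood of `K`: the local extensions to discs centred at points of `K` agree on
intersections, as these are convex and symmetric about the real line. -/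
theorem exists_holomorphic_extension [CompleteSpace V] {φ : ℝ → V} {K : Set ℝ}
    (hφ : ∀ x ∈ K, AnalyticAt ℝ φ x) :
    ∃ W : Set ℂ, IsOpen W ∧ (∀ x ∈ K, (x : ℂ) ∈ W) ∧ ∃ F : ℂ → V, DifferentiableOn ℂ F W ∧
      ∀ t : ℝ, (t : ℂ) ∈ W → F t = φ t := by
  choose! r hr F hF hFφ using fun x hx => exists_ball_extension (hφ x hx)
  set G : ℂ → V := fun z => if h : ∃ x ∈ K, z ∈ Metric.ball (x : ℂ) (r x) then F h.choose z else 0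
    with hG
  have hGF : ∀ x ∈ K, Set.EqOn G (F x) (Metric.ball (x : ℂ) (r x)) := by
    intro x hx z hz
    have h : ∃ x ∈ K, z ∈ Metric.ball (x : ℂ) (r x) := ⟨x, hx, hz⟩
    simp only [hG, dif_pos h]
    obtain ⟨hy, hzy⟩ := h.choose_spec
    set y := h.choose
    set U := Metric.ball (x : ℂ) (r x) ∩ Metric.ball (y : ℂ) (r y)
    have hU : IsOpen U := Metric.isOpen_ball.inter Metric.isOpen_ball
    have hre : ((z.re : ℝ) : ℂ) ∈ U := ⟨re_mem_ball hz, re_mem_ball hzy⟩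
    obtain ⟨a, b, hab, hsub⟩ := mem_nhds_iff_exists_Ioo_subset.mp
      (Complex.continuous_ofReal.continuousAt.preimage_mem_nhds (hU.mem_nhds hre))
    refine (eqOn_of_eq_on_Ioo hU ((convex_ball _ _).inter (convex_ball _ _)).isPreconnected
      ((hF y hy).mono Set.inter_subset_right) ((hF x hx).mono Set.inter_subset_left)
      (hab.1.trans hab.2) (fun t ht => hsub ht) fun t ht => ?_) ⟨hz, hzy⟩
    rw [hFφ y hy t (hsub ht).2, hFφ x hx t (hsub ht).1]
  refine ⟨⋃ x ∈ K, Metric.ball (x : ℂ) (r x), isOpen_biUnion fun _ _ => Metric.isOpen_ball,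
    fun x hx => Set.mem_biUnion hx (Metric.mem_ball_self (hr x hx)), G, fun z hz => ?_,
    fun t ht => ?_⟩
  · obtain ⟨x, hx, hz⟩ := Set.mem_iUnion₂.mp hz
    have hn := Metric.isOpen_ball.mem_nhds hz
    exact (((hF x hx).differentiableAt hn).congr_of_eventuallyEq
      (Filter.eventuallyEq_of_mem hn (hGF x hx))).differentiableWithinAt
  · obtain ⟨x, hx, ht⟩ := Set.mem_iUnion₂.mp ht
    rw [hGF x hx ht, hFφ x hx t ht]

/-! ### Analyticity of the slow transfer operator -/

variable {q : ℕ} {χ : triangleGroup q →* (V ≃ₗᵢ[ℂ] V)} {ε : ℤˣ} {s : ℂ}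

theorem analyticAt_slowRest [CompleteSpace V] (hq : 3 ≤ q) {φ : ℝ → V} {x : ℝ} (hx : 0 ≤ x)
    (h : ∀ k : ℕ, 2 ≤ k → k ≤ q / 2 →
      AnalyticAt ℝ φ ((sn q k * x + sn q (k - 1)) / (sn q (k + 1) * x + sn q k)) ∧
      AnalyticAt ℝ φ ((sn q (k - 1) * x + sn q k) / (sn q k * x + sn q (k + 1)))) :
    AnalyticAt ℝ (slowRest χ ε s φ) x := by
  unfold slowRest
  refine Finset.analyticAt_fun_sum _ fun k hk => ?_
  rw [Finset.mem_Icc] at hk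
  have p0 := sn_pos_of_le hq (k := k) (by omega) hk.2
  have p1 := sn_succ_pos_of_le hq hk.2
  obtain ⟨h1, h2⟩ := h k hk.1 hk.2
  exact (analyticAt_const (v := wt q k)).smul
    ((analyticAt_alphaR (represents_gel_inv hq k) (abs_sn_det hq k) (by positivity) h1).add
    (AnalyticAt.units_smul ε (analyticAt_alphaR (represents_Q_gel_inv hq k) (abs_sn_det' hq k)
      (by positivity) h2)))

theorem parabolic_one_mem_dMinus (hq : 3 ≤ q) {x : ℝ} (hx : 0 < x) :
    (1 * x + 0) / (1 * ell q * x + 1) ∈ dMinus q ∧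
      (0 * x + 1) / (1 * x + 1 * ell q) ∈ dMinus q := by
  have hL := ell_pos hq
  refine ⟨⟨by positivity, ?_⟩, ⟨by positivity, ?_⟩⟩
  · rw [div_lt_div_iff₀ (by positivity) hL]
    nlinarith
  · rw [div_lt_div_iff₀ (by positivity) hL]
    nlinarith

theorem represents_parabolic_one_inv (hq : 3 ≤ q) :
    Represents (((elG q (-1))⁻¹ : triangleGroup q) : PGL2) !![1, 0; 1 * ell q, 1] := by
  simpa using represents_parabolic_inv hq 1

theorem represents_Q_parabolic_one_inv (hq : 3 ≤ q) :
    Represents (((elQ q * elG q (-1))⁻¹ : triangleGroup q) : PGL2) !![0, 1; 1, 1 * ell q] := by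
  simpa using represents_Q_parabolic_inv hq 1

theorem alphaR_parabolic_congr (hq : 3 ≤ q) {φ φ' : ℝ → V} (h : ∀ y ∈ dMinus q, φ y = φ' y) {x : ℝ}
    (hx : 0 < x) : alphaR χ s (elG q (-1)) φ x = alphaR χ s (elG q (-1)) φ' x ∧
      alphaR χ s (elQ q * elG q (-1)) φ x = alphaR χ s (elQ q * elG q (-1)) φ' x := by
  have hL := ell_pos hq
  obtain ⟨m1, m2⟩ := parabolic_one_mem_dMinus hq hx
  rw [alphaR_eq χ s (represents_parabolic_one_inv hq) (by norm_num) _ (by positivity),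
    alphaR_eq χ s (represents_parabolic_one_inv hq) (by norm_num) _ (by positivity),
    alphaR_eq χ s (represents_Q_parabolic_one_inv hq) (by norm_num) _ (by positivity),
    alphaR_eq χ s (represents_Q_parabolic_one_inv hq) (by norm_num) _ (by positivity),
    h _ m1, h _ m2]
  exact ⟨rfl, rfl⟩

/-- The slow operator extends functions on its interval to the positive half line. -/
theorem analyticAt_slowOp [CompleteSpace V] (hq : 3 ≤ q) {φ : ℝ → V}
    (h : AnalyticOnNhd ℝ φ (slowInterval q)) {x : ℝ} (hx : 0 < x) :
    AnalyticAt ℝ (slowOp χ ε s φ) x := by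
  have hL := ell_pos hq
  obtain ⟨m1, m2⟩ := parabolic_one_mem_dMinus hq hx
  have : slowOp χ ε s φ = fun x => alphaR χ s (elG q (-1)) φ x +
      ε • alphaR χ s (elQ q * elG q (-1)) φ x + slowRest χ ε s φ x :=
    funext (slowOp_eq χ ε s hq φ)
  rw [this]
  exact ((analyticAt_alphaR (represents_parabolic_one_inv hq) (by norm_num) (by positivity)
    (h _ (dMinus_subset hq m1))).add (AnalyticAt.units_smul ε
    (analyticAt_alphaR (represents_Q_parabolic_one_inv hq) (by norm_num) (by positivity)
    (h _ (dMinus_subset hq m2))))).add (analyticAt_slowRest hq hx.le fun k hk2 hk =>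
    ⟨h _ (ratio_mem_slowInterval hq (by omega) hk hx).1,
      h _ (ratio_mem_slowInterval hq (by omega) hk hx).2⟩)

/-! ### Inverting `1 - α_s(g_{-1})` -/

variable [FiniteDimensional ℂ V]

/-- If `ψ = (1 - α_s(g_{-1}))φ` and `φ` has at most a simple pole at `0⁺`, then
`φ = (1 + L_{-1})ψ`. -/
theorem eq_add_fastMinus_of_eq_sub (hq : 3 ≤ q) (hs0 : 0 < s.re) (hs : s ≠ 1 / 2)
    {ψ : ℂ → V} (hψ : DifferentiableAt ℂ ψ 0) {φ : ℝ → V} {c : V}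
    (hc : (fun x : ℝ => φ x - x⁻¹ • c) =O[𝓝[>] 0] (fun _ : ℝ => (1 : ℝ)))
    (h : ∀ x ∈ dMinus q, ψ x = φ x - alphaR χ s (elG q (-1)) φ x) {x : ℝ} (hx : x ∈ dMinus q) :
    φ x = ψ x + fastMinus χ s 1 ψ x := by
  have : CompleteSpace V := FiniteDimensional.complete ℂ V
  have hL := ell_pos hq
  set d := lerchData hq χ ψ hψ with hd
  set p : ℝ → V := fun v => (v : ℂ) ^ (-2 * s) • (φ (1 / v) - ψ ((1 / v : ℝ) : ℂ)) - d.cont s v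
    with hp
  obtain ⟨c₂, hc₂⟩ := d.exists_cont_asymp hs0 hs
  have hshift : ∀ v, ell q < v → p v = χ (elG q (-1)) (p (v + ell q)) := by
    intro v hv
    have hv0 : 0 < v := hL.trans hv
    have hvL : 0 < v + ell q := by positivity
    have e0 := h (1 / v) ⟨by positivity, one_div_lt_one_div_of_lt hL hv⟩
    rw [alphaR_eq χ s (represents_parabolic_one_inv hq) (by norm_num) _ (by positivity)] at e0
    have e1 : (1 * (1 / v) + 0) / (1 * ell q * (1 / v) + 1) = 1 / (v + ell q) := by
      field_simp
      ring
    have e2 : ((1 * ell q : ℝ) * ((1 / v : ℝ) : ℂ) + (1 : ℝ) : ℂ) =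
        (((v + ell q) / v : ℝ) : ℂ) := by
      have : (v : ℂ) ≠ 0 := by exact_mod_cast hv0.ne'
      push_cast
      field_simp
      ring
    rw [e1, e2] at e0
    have e3 : (v : ℂ) ^ (-2 * s) * (((v + ell q) / v : ℝ) : ℂ) ^ (-2 * s) =
        ((v + ell q : ℝ) : ℂ) ^ (-2 * s) := by
      rw [← Complex.mul_cpow_ofReal_nonneg hv0.le (by positivity), ← Complex.ofReal_mul,
        mul_div_cancel₀ _ hv0.ne']
    have e4 := d.cont_eq hs0 hs (v := v) (by change -ell q < _; simp; linarith)
    have e5 : d.A = χ (elG q (-1)) := rfl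
    have e6 : d.L = ell q := rfl
    have e7 : d.term s (v + ell q) = ((v + ell q : ℝ) : ℂ) ^ (-2 * s) •
        ψ ((1 / (v + ell q) : ℝ) : ℂ) := by
      simp [LerchData.term, hd, lerchData]
    rw [e5, e6, e7] at e4
    simp only [hp]
    rw [e4, e0, sub_sub_cancel, smul_smul, e3]
    simp only [map_sub, map_add, map_smul, smul_sub, Complex.ofReal_add]
    abel
  have hasymp : (fun v : ℝ => p v - (v : ℂ) ^ (1 - 2 * s) • (c - c₂)) =O[atTop]
      fun v : ℝ => v ^ (-2 * s.re) := by
    have hpow : (fun v : ℝ => (v : ℂ) ^ (-2 * s)) =O[atTop] fun v : ℝ => v ^ (-2 * s.re) := by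
      refine IsBigO.of_bound 1 ?_
      filter_upwards [eventually_gt_atTop 0] with v hv
      rw [Complex.norm_cpow_eq_rpow_re_of_pos (by positivity), one_mul]
      simp [le_abs_self]
    have hinv : Tendsto (fun v : ℝ => 1 / v) atTop (𝓝[>] 0) := by
      simpa only [one_div] using tendsto_inv_atTop_nhdsGT_zero
    have b1 := hc.comp_tendsto hinv
    have b2 : (fun v : ℝ => ψ ((1 / v : ℝ) : ℂ)) =O[atTop] fun _ : ℝ => (1 : ℝ) := by
      have h1 : Tendsto (fun v : ℝ => ((1 / v : ℝ) : ℂ)) atTop (𝓝 0) := by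
        have := (Complex.continuous_ofReal.tendsto 0).comp (hinv.mono_right nhdsWithin_le_nhds)
        rwa [Complex.ofReal_zero] at this
      exact (hψ.continuousAt.tendsto.comp h1).isBigO_one ℝ
    have b3 := hpow.smul (b1.sub b2)
    simp only [Function.comp_apply, smul_eq_mul, mul_one] at b3
    refine (b3.sub hc₂).congr' ?_ EventuallyEq.rfl
    filter_upwards [eventually_gt_atTop 0] with v hv
    have hvc : (v : ℂ) ≠ 0 := by exact_mod_cast hv.ne'
    have e1 : (v : ℂ) ^ (1 - 2 * s) = (v : ℂ) ^ (-2 * s) * v := by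
      have : 1 - 2 * s = -2 * s + 1 := by ring
      rw [this, Complex.cpow_add _ _ hvc, Complex.cpow_one]
    have e2 : (1 / v)⁻¹ • c = (v : ℂ) • c := by
      rw [one_div, inv_inv, Complex.coe_smul]
    simp only [hp, e1, e2]
    module
  have hx1 : ell q < 1 / x := by
    rw [lt_div_iff₀ hx.1, ← lt_div_iff₀' hL]
    exact hx.2
  have hzero := eq_zero_of_shift_eq (χ (elG q (-1))) hL hs0 hs hL.le hshift (c - c₂) hasymp hx1
  have hx0 := hx.1
  simp only [hp, one_div_one_div] at hzero
  have h1 : (x : ℂ) ^ (-2 * s) * ((1 / x : ℝ) : ℂ) ^ (-2 * s) = 1 := by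
    rw [← Complex.mul_cpow_ofReal_nonneg hx0.le (by positivity), ← Complex.ofReal_mul,
      mul_one_div_cancel hx0.ne', Complex.ofReal_one, Complex.one_cpow]
  rw [fastMinus_one_eq hq χ hψ hs0 hs (by simpa using hx0)]
  have h2 : (1 / x : ℂ) = ((1 / x : ℝ) : ℂ) := by simp
  rw [h2, ← sub_eq_zero.mp hzero, smul_smul, h1, one_smul, add_sub_cancel]

/-! ### From slow to fast eigenfunctions -/

theorem exists_fastEigen_of_slow (hq : 3 ≤ q) (hs0 : 0 < s.re) (hs : s ≠ 1 / 2) {φ : ℝ → V}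
    (hφ : φ ∈ slowEigenAs χ ε s) :
    ∃ f ∈ fastEigen χ ε s, (∀ x ∈ dZero q, resZero f x = φ x) ∧
      (∀ x ∈ dMinus q, resMinus f x = φ x - alphaR χ s (elG q (-1)) φ x) ∧
      (∀ x ∈ dMinus q, onePlusFast χ s f x = φ x) := by
  have : CompleteSpace V := FiniteDimensional.complete ℂ V
  have hL := ell_pos hq
  have hLi : 0 < 1 / ell q := by positivity
  obtain ⟨⟨⟨han, -⟩, heig⟩, c, hc⟩ := hφ
  -- the extension of `φ` to the positive half line, and `(1 - α_s(g_{-1}))φ` near `[0, 1/ℓ]`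
  obtain ⟨φ', hφ'⟩ : ∃ φ' : ℝ → V, φ' = slowOp χ ε s φ := ⟨_, rfl⟩
  have hφ'an : ∀ x : ℝ, 0 < x → AnalyticAt ℝ φ' x := fun x hx =>
    hφ' ▸ analyticAt_slowOp hq han hx
  have heig' : ∀ x ∈ slowInterval q, φ' x = φ x := fun x hx => by rw [hφ', ← heig x hx]
  set B : ℝ → V := fun x => ε • alphaR χ s (elQ q * elG q (-1)) φ' x + slowRest χ ε s φ' x with hB
  have hBan : ∀ x ∈ Set.Icc 0 (1 / ell q), AnalyticAt ℝ B x := by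
    intro x hx
    have hx0 := hx.1
    refine (AnalyticAt.units_smul ε (analyticAt_alphaR (represents_Q_parabolic_one_inv hq)
      (by norm_num) (by positivity) (hφ'an _ (by positivity)))).add
      (analyticAt_slowRest hq hx0 fun k hk2 hk => ?_)
    have p0 := sn_pos_of_le hq (k := k) (by omega) hk
    have p1 := sn_succ_pos_of_le hq hk
    have p2 := sn_pred_pos_of_le hq hk2 hk
    exact ⟨hφ'an _ (by positivity), hφ'an _ (by positivity)⟩
  have hBeq : ∀ x ∈ dMinus q, B x = φ x - alphaR χ s (elG q (-1)) φ x := by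
    intro x hx
    have hx0 := hx.1
    rw [heig x (dMinus_subset hq hx), slowOp_eq χ ε s hq]
    simp only [hB]
    rw [slowRest_congr χ ε s hq heig' hx0,
      (alphaR_parabolic_congr hq (fun y hy => heig' y (dMinus_subset hq hy)) hx0).2]
    abel
  obtain ⟨W₀, hW₀, hKW₀, F₀, hF₀, hF₀φ⟩ :=
    exists_holomorphic_extension (K := Set.Icc (1 / ell q) (topEnd q))
      fun x hx => hφ'an x (hLi.trans_le hx.1)
  obtain ⟨W₁, hW₁, hKW₁, F₁, hF₁, hF₁B⟩ := exists_holomorphic_extension hBan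
  obtain ⟨E, hE₀, hE₁, hE3⟩ := exists_admissiblePair hq hW₀ hW₁ (fun _ => hKW₀) hKW₁
  have hol : ∀ {S W : Set ℂ} {F : ℂ → V}, DifferentiableOn ℂ F W → closure S ⊆ W →
      (closure S).indicator F ∈ holSpace V S := fun hF h =>
    ⟨(hF.continuousOn.mono h).congr fun z hz => Set.indicator_of_mem hz _,
      (hF.mono (subset_closure.trans h)).congr fun z hz =>
        Set.indicator_of_mem (subset_closure hz) _, fun z hz => Set.indicator_of_notMem hz _⟩
  set ψ : pairSpace V E := (⟨_, hol hF₀ hE₀⟩, ⟨_, hol hF₁ hE₁⟩) with hψ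
  have hψ₀ : ∀ x ∈ slowInterval q, (x : ℂ) ∈ E.zero → ψ.1.1 x = φ x := by
    intro x hx hxE
    rw [← heig' x hx, ← hF₀φ x (hE₀ (subset_closure hxE))]
    exact Set.indicator_of_mem (subset_closure hxE) _
  have hψ₁ : ∀ x ∈ dMinus q, ψ.2.1 x = φ x - alphaR χ s (elG q (-1)) φ x := by
    intro x hx
    have hxE : (x : ℂ) ∈ closure E.minus := subset_closure (E.mem_minus hq ⟨hx.1.le, hx.2.le⟩)
    rw [← hBeq x hx, ← hF₁B x (hE₁ hxE)]
    exact Set.indicator_of_mem hxE _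
  have hd1 : DifferentiableOn ℂ ψ.2.1 E.minus := ψ.2.2.2.1
  have hd0 : DifferentiableOn ℂ ψ.1.1 E.zero := ψ.1.2.2.1
  have hdz : DifferentiableAt ℂ ψ.2.1 0 := E.differentiableAt_zero hq hd1
  have hnb := E.eventually_differentiableAt hq hd1
  have hφ₁ : ∀ x ∈ dMinus q, φ x = ψ.2.1 x + fastMinus χ s 1 ψ.2.1 x := fun x hx =>
    eq_add_fastMinus_of_eq_sub hq hs0 hs hdz hc hψ₁ hx
  -- the right-hand sides on the positive half line
  have hrest : ∀ x : ℝ, 0 < x → slowRest χ ε s φ x =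
      fastZero χ s 1 ψ.1.1 x + ε • fastZero χ s (elQ q) ψ.1.1 x := by
    intro x hx
    refine slowRest_eq_fastZero χ ε s hq (fun hq3 y hy => (hψ₀ y ?_ ?_).symm) hx
    · exact mem_slowInterval_of_lt_topEnd hq (hLi.trans hy.1) hy.2
    · exact E.mem_zero hq hq3 ⟨hy.1.le, hy.2.le⟩
  have heq₀ : ∀ z ∈ E.zero, ψ.1.1 z =
      (fastZero χ s 1 ψ.1.1 z + ε • fastZero χ s (elQ q) ψ.1.1 z) +
      (fastMinus χ s 1 ψ.2.1 z + ε • fastMinus χ s (elQ q) ψ.2.1 z) := by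
    by_cases hq3 : q = 3
    · simp [hE3 hq3]
    have htop := one_div_ell_lt_one hq hq3
    have hmem : ∀ x ∈ Set.Ioo (1 / ell q) 1, x ∈ slowInterval q ∧ (x : ℂ) ∈ E.zero := by
      intro x hx
      have hxD : x ∈ dZero q := by
        unfold dZero
        split_ifs
        · exact ⟨hx.1, hx.2.le⟩
        · exact hx
      exact ⟨dZero_subset hq hxD, E.subset_zero x (subset_closure hxD)⟩
    refine eqOn_of_eq_on_Ioo E.isOpen_zero E.isPreconnected_zero hd0 (fun z hz => ?_) htop
      (fun x hx => (hmem x hx).2) fun x hx => ?_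
    · have hzc := subset_closure hz
      have hre := E.halfPlane_zero z hzc
      have hz0 := ne_zero_of_re_pos hre
      have hm : ∀ g ∈ zeroElements q, DifferentiableAt ℂ ψ.1.1
          (act ℂ ((g⁻¹ : triangleGroup q) : PGL2) z) := fun g hg =>
        hd0.differentiableAt (E.isOpen_zero.mem_nhds (E.mapsTo_zero_zero g hg hzc))
      refine DifferentiableAt.differentiableWithinAt ?_
      refine ((differentiableAt_fastZero_one hq (by linarith) hm).add
        (DifferentiableAt.units_smul ε (differentiableAt_fastZero_Q hq (by linarith) hm))).add
        ((differentiableAt_fastMinus_one hq χ hs0 hs hre hnb fun n => ?_).add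
        (DifferentiableAt.units_smul ε
          (differentiableAt_fastMinus_Q hq χ hs0 hs (by linarith) hnb fun n => ?_)))
      · rw [← act_parabolic_inv hq hz0]
        exact hd1.differentiableAt (E.isOpen_minus.mem_nhds
          (E.mapsTo_zero_minus 1 (Or.inl rfl) (n + 1) (by omega) hzc))
      · rw [← act_Q_parabolic_inv hq]
        exact hd1.differentiableAt (E.isOpen_minus.mem_nhds
          (E.mapsTo_zero_minus (elQ q) (Or.inr rfl) (n + 1) (by omega) hzc))
    · obtain ⟨hxI, hxE⟩ := hmem x hx
      have hx0 := slowInterval_pos hxI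
      obtain ⟨a1, a2⟩ := alphaR_parabolic_eq_fastMinus hq χ hs0 hs hdz hφ₁ hx0
      rw [hψ₀ x hxI hxE, heig x hxI, slowOp_eq χ ε s hq, hrest x hx0, a1, a2]
      abel
  have heq₁ : ∀ z ∈ E.minus, ψ.2.1 z =
      (fastZero χ s 1 ψ.1.1 z + ε • fastZero χ s (elQ q) ψ.1.1 z) +
      ε • fastMinus χ s (elQ q) ψ.2.1 z := by
    refine eqOn_of_eq_on_Ioo E.isOpen_minus E.isPreconnected_minus hd1 (fun z hz => ?_) hLi
      (fun x hx => E.mem_minus hq ⟨hx.1.le, hx.2.le⟩) fun x hx => ?_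
    · have hzc := subset_closure hz
      have hre := E.halfPlane_minus z hzc
      have hre' : -ell q < z.re := by
        have h1 := one_le_ell hq
        have h2 : 1 / ell q ≤ 1 := by rwa [div_le_one hL]
        linarith
      have hm : ∀ g ∈ zeroElements q, DifferentiableAt ℂ ψ.1.1
          (act ℂ ((g⁻¹ : triangleGroup q) : PGL2) z) := fun g hg =>
        hd0.differentiableAt (E.isOpen_zero.mem_nhds (E.mapsTo_minus_zero g hg hzc))
      refine DifferentiableAt.differentiableWithinAt ?_
      refine ((differentiableAt_fastZero_one hq hre hm).add
        (DifferentiableAt.units_smul ε (differentiableAt_fastZero_Q hq hre hm))).add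
        (DifferentiableAt.units_smul ε
          (differentiableAt_fastMinus_Q hq χ hs0 hs hre' hnb fun n => ?_))
      rw [← act_Q_parabolic_inv hq]
      exact hd1.differentiableAt (E.isOpen_minus.mem_nhds
        (E.mapsTo_minus_minus (n + 1) (by omega) hzc))
    · have hx0 : 0 < x := hx.1
      obtain ⟨a1, a2⟩ := alphaR_parabolic_eq_fastMinus hq χ hs0 hs hdz hφ₁ hx0
      rw [hψ₁ x hx, heig x (dMinus_subset hq hx), slowOp_eq χ ε s hq, hrest x hx0, a2]
      abel
  refine ⟨toLimit E ψ, ⟨E, ψ, rfl, heq₀, heq₁⟩, fun x hx => ?_, fun x hx => ?_, fun x hx => ?_⟩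
  · rw [resZero_toLimit_apply E ψ hx,
      hψ₀ x (dZero_subset hq hx) (E.subset_zero x (subset_closure hx))]
  · rw [resMinus_toLimit_apply E ψ hx, hψ₁ x hx]
  · rw [onePlusFast_toLimit hq E ψ hx, hφ₁ x hx]

end

end HeckeTransfer

namespace HeckeTransfer

open Filter Asymptotics

section

variable {V : Type*} [NormedAddCommGroup V] [InnerProductSpace ℂ V]
variable {q : ℕ} {χ : triangleGroup q →* (V ≃ₗᵢ[ℂ] V)} {ε : ℤˣ} {s : ℂ}

/-! ### The isomorphism -/

theorem eq_of_eqOn_dMinus (hq : 3 ≤ q) {φ φ' : ℝ → V} (hφ : φ ∈ analyticSpace V q)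
    (hφ' : φ' ∈ analyticSpace V q) (h : ∀ x ∈ dMinus q, φ x = φ' x) : φ = φ' := by
  have hL := ell_pos hq
  have hx : 1 / ell q / 2 ∈ dMinus q := ⟨by positivity, half_lt_self (by positivity)⟩
  have hEq : Set.EqOn φ φ' (slowInterval q) :=
    hφ.1.eqOn_of_preconnected_of_eventuallyEq hφ'.1 (isPreconnected_slowInterval q)
      (dMinus_subset hq hx) (eventuallyEq_of_mem (Ioo_mem_nhds hx.1 hx.2) h)
  ext x
  by_cases hxI : x ∈ slowInterval q
  · exact hEq hxI
  · rw [hφ.2 x hxI, hφ'.2 x hxI]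

theorem slowEigenDec_le_slowEigenAs (hq : 3 ≤ q) : slowEigenDec χ ε s ≤ slowEigenAs χ ε s := by
  have hL := ell_pos hq
  rintro φ ⟨hφ, G, hG, hGp, -⟩
  have hpos : 0 < 1 / ell q := by positivity
  refine ⟨hφ, 0, ?_⟩
  have hG0 : ContinuousAt G 0 :=
    hG.continuousOn.continuousAt (Ioo_mem_nhds (by linarith) hpos)
  refine ((hG0.tendsto.mono_left (nhdsWithin_le_nhds (s := Set.Ioi 0))).isBigO_one ℝ).congr' ?_
    EventuallyEq.rfl
  filter_upwards [Ioo_mem_nhdsGT hpos] with x hx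
  rw [smul_zero, sub_zero, hGp x hx]

variable [FiniteDimensional ℂ V]

/-- Smoothness at `0` is all that the condition defining `SFE^{dec,±}` requires: away from `0` it
follows from the analyticity of `φ`. -/
theorem mem_slowEigenDec_of_contDiffOn (hq : 3 ≤ q) {φ : ℝ → V}
    (hφ : φ ∈ slowEigen χ ε s) {δ : ℝ} (hδ : 0 < δ)
    {G : ℝ → V} (hG : ContDiffOn ℝ ∞ G (Set.Ioo (-δ) δ))
    (hp : ∀ x ∈ Set.Ioo 0 δ, G x = φ x)
    (hn : ∀ x ∈ Set.Ioo (-δ) 0, G x = -(ε • alphaR χ s (elJ q) φ x)) :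
    φ ∈ slowEigenDec χ ε s := by
  classical
  have : CompleteSpace V := FiniteDimensional.complete ℂ V
  set H : ℝ → V := fun x => if 0 < x then φ x else
    if x < 0 then -(ε • alphaR χ s (elJ q) φ x) else G 0 with hH
  have hHp : ∀ x, 0 < x → H x = φ x := fun x hx => if_pos hx
  have hHn : ∀ x, x < 0 → H x = -(ε • alphaR χ s (elJ q) φ x) := fun x hx => by
    simp only [hH, if_neg hx.le.not_gt, if_pos hx]
  refine ⟨hφ, H, fun x hx => ContDiffAt.contDiffWithinAt ?_, fun x hx => hHp x hx.1,
    fun x hx => hHn x hx.2⟩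
  rcases lt_trichotomy x 0 with h | rfl | h
  · have hmem : -x ∈ slowInterval q := dMinus_subset hq ⟨by linarith, by linarith [hx.1]⟩
    have h1 : AnalyticAt ℝ (fun t : ℝ => χ (elJ q) (φ (-t))) x :=
      AnalyticAt.comp (g := χ (elJ q)) ((((χ (elJ q)).toContinuousLinearEquiv :
        V →L[ℂ] V).analyticAt _).restrictScalars)
        (AnalyticAt.comp (g := φ) (f := fun t : ℝ => -t) (hφ.1.1 _ hmem) analyticAt_id.neg)
    refine (AnalyticAt.units_smul ε h1).neg.contDiffAt.congr_of_eventuallyEq ?_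
    filter_upwards [Iio_mem_nhds h] with t ht
    rw [hHn t ht, alphaR_J]
    rfl
  · refine (hG.contDiffAt (Ioo_mem_nhds (by linarith) hδ)).congr_of_eventuallyEq ?_
    filter_upwards [Ioo_mem_nhds (by linarith : -δ < 0) hδ] with t ht
    rcases lt_trichotomy t 0 with h' | rfl | h'
    · rw [hHn t h', hn t ⟨ht.1, h'⟩]
    · simp [hH]
    · rw [hHp t h', hp t ⟨h', ht.2⟩]
  · refine (hφ.1.1 x (dMinus_subset hq ⟨h, hx.2⟩)).contDiffAt.congr_of_eventuallyEq ?_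
    filter_upwards [Ioi_mem_nhds h] with t ht
    exact hHp t ht

/-- The linear map `φ ↦ f` with `f₀ = φ` on `D₀` and `f₋₁ = (1 - α_s(g_{-1}))φ` on `D₋₁`. -/
noncomputable def toFast (hq : 3 ≤ q) (hs0 : 0 < s.re) (hs : s ≠ 1 / 2)
    (χ : triangleGroup q →* (V ≃ₗᵢ[ℂ] V)) (ε : ℤˣ) : slowEigenAs χ ε s →ₗ[ℂ] LimitSpace V q where
  toFun φ := (exists_fastEigen_of_slow hq hs0 hs φ.2).choose
  map_add' φ₁ φ₂ := by
    have : CompleteSpace V := FiniteDimensional.complete ℂ V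
    obtain ⟨-, h0, h1, -⟩ := (exists_fastEigen_of_slow hq hs0 hs φ₁.2).choose_spec
    obtain ⟨-, h0', h1', -⟩ := (exists_fastEigen_of_slow hq hs0 hs φ₂.2).choose_spec
    obtain ⟨-, h0'', h1'', -⟩ := (exists_fastEigen_of_slow hq hs0 hs (φ₁ + φ₂).2).choose_spec
    refine eq_of_res_eq hq (fun x hx => ?_) fun x hx => ?_
    · rw [h0'' x hx, map_add, Pi.add_apply, h0 x hx, h0' x hx]
      rfl
    · rw [h1'' x hx, map_add, Pi.add_apply, h1 x hx, h1' x hx, Submodule.coe_add, alphaR_add,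
        Pi.add_apply]
      abel
  map_smul' a φ := by
    have : CompleteSpace V := FiniteDimensional.complete ℂ V
    obtain ⟨-, h0, h1, -⟩ := (exists_fastEigen_of_slow hq hs0 hs φ.2).choose_spec
    obtain ⟨-, h0', h1', -⟩ := (exists_fastEigen_of_slow hq hs0 hs (a • φ).2).choose_spec
    refine eq_of_res_eq hq (fun x hx => ?_) fun x hx => ?_
    · rw [h0' x hx, map_smul, Pi.smul_apply, h0 x hx]
      rfl
    · rw [h1' x hx, map_smul, Pi.smul_apply, h1 x hx, Submodule.coe_smul, alphaR_smul,
        Pi.smul_apply, smul_sub]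
      rfl

variable (hq : 3 ≤ q) (hs0 : 0 < s.re) (hs : s ≠ 1 / 2)

theorem toFast_mem (φ : slowEigenAs χ ε s) : toFast hq hs0 hs χ ε φ ∈ fastEigen χ ε s :=
  (exists_fastEigen_of_slow hq hs0 hs φ.2).choose_spec.1

theorem resZero_toFast (φ : slowEigenAs χ ε s) {x : ℝ} (hx : x ∈ dZero q) :
    resZero (toFast hq hs0 hs χ ε φ) x = (φ : ℝ → V) x :=
  (exists_fastEigen_of_slow hq hs0 hs φ.2).choose_spec.2.1 x hx

theorem resMinus_toFast (φ : slowEigenAs χ ε s) {x : ℝ} (hx : x ∈ dMinus q) :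
    resMinus (toFast hq hs0 hs χ ε φ) x =
      (φ : ℝ → V) x - alphaR χ s (elG q (-1)) (φ : ℝ → V) x :=
  (exists_fastEigen_of_slow hq hs0 hs φ.2).choose_spec.2.2.1 x hx

theorem onePlusFast_toFast (φ : slowEigenAs χ ε s) {x : ℝ} (hx : x ∈ dMinus q) :
    onePlusFast χ s (toFast hq hs0 hs χ ε φ) x = (φ : ℝ → V) x :=
  (exists_fastEigen_of_slow hq hs0 hs φ.2).choose_spec.2.2.2 x hx

theorem eq_toFast_iff {φ : slowEigenAs χ ε s} {f : LimitSpace V q} :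
    f = toFast hq hs0 hs χ ε φ ↔ (∀ x ∈ dZero q, resZero f x = (φ : ℝ → V) x) ∧
      (∀ x ∈ dMinus q, resMinus f x =
        (φ : ℝ → V) x - alphaR χ s (elG q (-1)) (φ : ℝ → V) x) := by
  have : CompleteSpace V := FiniteDimensional.complete ℂ V
  constructor
  · rintro rfl
    exact ⟨fun x => resZero_toFast hq hs0 hs φ, fun x => resMinus_toFast hq hs0 hs φ⟩
  · rintro ⟨h0, h1⟩
    exact eq_of_res_eq hq (fun x hx => by rw [h0 x hx, resZero_toFast hq hs0 hs φ hx])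
      fun x hx => by rw [h1 x hx, resMinus_toFast hq hs0 hs φ hx]

theorem toFast_injective : Function.Injective (toFast hq hs0 hs χ ε) := by
  intro φ φ' h
  refine Subtype.ext (eq_of_eqOn_dMinus hq φ.2.1.1 φ'.2.1.1 fun x hx => ?_)
  rw [← onePlusFast_toFast hq hs0 hs φ hx, h, onePlusFast_toFast hq hs0 hs φ' hx]

theorem range_toFast : (LinearMap.range (toFast hq hs0 hs χ ε) : Set (LimitSpace V q)) =
    fastEigen χ ε s := by
  ext f
  constructor
  · rintro ⟨φ, rfl⟩
    exact toFast_mem hq hs0 hs φ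
  · rintro ⟨E, ψ, rfl, heq₀, heq₁⟩
    obtain ⟨φ, hφ, h0, -, h1⟩ := exists_slowEigenAs_of_fast hq hs0 hs E ψ heq₀ heq₁
    refine ⟨⟨φ, hφ⟩, ((eq_toFast_iff hq hs0 hs).mpr ⟨fun x hx => ?_, fun x hx => ?_⟩).symm⟩
    · exact (resZero_toLimit_apply E ψ hx).trans (h0 x hx).symm
    · exact (resMinus_toLimit_apply E ψ hx).trans (h1 x hx)

theorem toFast_mem_fastEigenDec_iff (φ : slowEigenAs χ ε s) :
    toFast hq hs0 hs χ ε φ ∈ fastEigenDec χ ε s ↔ (φ : ℝ → V) ∈ slowEigenDec χ ε s := by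
  have hL := ell_pos hq
  have hpos : 0 < 1 / ell q := by positivity
  have hp : ∀ x ∈ dMinus q, onePlusFast χ s (toFast hq hs0 hs χ ε φ) x = (φ : ℝ → V) x :=
    fun x => onePlusFast_toFast hq hs0 hs φ
  have hn : ∀ x ∈ Set.Ioo (-(1 / ell q)) 0,
      alphaR χ s (elJ q) (onePlusFast χ s (toFast hq hs0 hs χ ε φ)) x =
        alphaR χ s (elJ q) (φ : ℝ → V) x := fun x hx => by
    rw [alphaR_J, alphaR_J, hp (-x) ⟨by linarith [hx.2], by linarith [hx.1]⟩]
  constructor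
  · rintro ⟨-, δ, hδ, hδL, G, hG, hGp, hGn⟩
    refine mem_slowEigenDec_of_contDiffOn hq φ.2.1 hδ hG (fun x hx => ?_) fun x hx => ?_
    · rw [hGp x hx, hp x ⟨hx.1, hx.2.trans_le hδL⟩]
    · rw [hGn x hx, hn x ⟨by linarith [hx.1], hx.2⟩]
  · rintro ⟨-, G, hG, hGp, hGn⟩
    refine ⟨toFast_mem hq hs0 hs φ, 1 / ell q, hpos, le_rfl, G, hG, fun x hx => ?_,
      fun x hx => ?_⟩
    · rw [hGp x hx, hp x hx]
    · rw [hGn x hx, hn x hx]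

end

end HeckeTransfer

open HeckeTransfer in
theorem mainTheorem1 {V : Type*} [NormedAddCommGroup V] [InnerProductSpace ℂ V]
    [FiniteDimensional ℂ V] (q : ℕ) (hq : 3 ≤ q)
    (χ : triangleGroup q →* (V ≃ₗᵢ[ℂ] V)) (ε : ℤˣ) (s : ℂ) (hs : s ≠ 1 / 2) (hs0 : 0 < s.re) :
    ∃ F : Submodule ℂ (LimitSpace V q), (F : Set (LimitSpace V q)) = fastEigen χ ε s ∧
    ∃ Φ : F ≃ₗ[ℂ] slowEigenAs χ ε s,
      (∀ (f : F), ∀ φ ∈ analyticSpace V q, φ = (Φ f : ℝ → V) ↔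
        (∀ x ∈ dZero q, φ x = resZero (f : LimitSpace V q) x) ∧
        (∀ x ∈ dMinus q, φ x = resMinus (f : LimitSpace V q) x +
          fastMinusR χ s (resMinus (f : LimitSpace V q)) x)) ∧
      (∀ (φ : slowEigenAs χ ε s) (f : LimitSpace V q), f = (Φ.symm φ : LimitSpace V q) ↔
        (∀ x ∈ dZero q, resZero f x = (φ : ℝ → V) x) ∧
        (∀ x ∈ dMinus q, resMinus f x =
          (φ : ℝ → V) x - alphaR χ s (elG q (-1)) (φ : ℝ → V) x)) ∧
      ∃ Fdec : Submodule ℂ (LimitSpace V q),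
        (Fdec : Set (LimitSpace V q)) = fastEigenDec χ ε s ∧
        ∃ Ψ : Fdec ≃ₗ[ℂ] slowEigenDec χ ε s,
          ∀ (f : F) (g : Fdec), (f : LimitSpace V q) = g → (Φ f : ℝ → V) = Ψ g := by
  have hinj := toFast_injective (χ := χ) (ε := ε) hq hs0 hs
  set Θ := toFast hq hs0 hs χ ε with hΘ
  set Φ := (LinearEquiv.ofInjective Θ hinj).symm with hΦ
  have hΘΦ : ∀ f : LinearMap.range Θ, Θ (Φ f) = f := fun f =>
    congrArg Subtype.val ((LinearEquiv.ofInjective Θ hinj).apply_symm_apply f)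
  have hle : slowEigenDec χ ε s ≤ slowEigenAs χ ε s := slowEigenDec_le_slowEigenAs hq
  set Θd := Θ ∘ₗ Submodule.inclusion hle with hΘd
  have hinjd : Function.Injective Θd := hinj.comp (Submodule.inclusion_injective hle)
  refine ⟨LinearMap.range Θ, range_toFast hq hs0 hs, Φ, fun f φ hφ => ?_, fun φ f => ?_,
    LinearMap.range Θd, ?_, (LinearEquiv.ofInjective Θd hinjd).symm, fun f g hfg => ?_⟩
  · constructor
    · rintro rfl
      rw [← hΘΦ f]
      exact ⟨fun x hx => (resZero_toFast hq hs0 hs _ hx).symm,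
        fun x hx => (onePlusFast_toFast hq hs0 hs _ hx).symm⟩
    · rintro ⟨-, h⟩
      refine eq_of_eqOn_dMinus hq hφ (Φ f).2.1.1 fun x hx => ?_
      rw [← onePlusFast_toFast hq hs0 hs (Φ f) hx, ← hΘ, hΘΦ f, h x hx]
      rfl
  · exact eq_toFast_iff hq hs0 hs
  · ext f
    constructor
    · rintro ⟨φ, rfl⟩
      exact (toFast_mem_fastEigenDec_iff hq hs0 hs _).mpr φ.2
    · intro hf
      obtain ⟨φ, rfl⟩ := (range_toFast hq hs0 hs).ge hf.1
      exact ⟨⟨φ, (toFast_mem_fastEigenDec_iff hq hs0 hs φ).mp hf⟩, rfl⟩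
  · have h1 : Θd ((LinearEquiv.ofInjective Θd hinjd).symm g) = g :=
      congrArg Subtype.val ((LinearEquiv.ofInjective Θd hinjd).apply_symm_apply g)
    rw [← hfg, ← hΘΦ f] at h1
    exact congrArg Subtype.val (hinj h1).symm
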